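/- Let $B/\mathbb{Q}$ be a bicyclic bicubic field, i.e. a Galois extension with $\mathrm{Gal}(B/\mathbb{Q})\simeq(\mathbb{Z}/3\mathbb{Z})^2$, and let $k\subset B$ be a cyclic cubic subfield such that exactly three rational primes ramify in $k$ (equivalently, the conductor of $k$ has exactly three prime divisors) and such that $B/k$ is unramified. Let $U_B$, $U_k$ be the unit groups of the rings of integers of $B$ and $k$, let $V$ be the subgroup of $U_B$ generated by the units of the four cubic subfields of $B$, and put $I=(U_B:V)$. Let $\mathrm{Cl}_3(k)$ be the $3$-class group of $k$, and let $T_{B/k}:\mathrm{Cl}_3(k)\to\mathrm{Cl}(B)$ be the transfer, i.e. the homomorphism induced by extension of ideals. For an ordering $k_1,k_2,k_3,k_4$ of the four cubic subfields of $B$ with $k_4=k$, a canonical basis of $V$ is a family $(\varepsilon_1,\dots,\varepsilon_8)$ such that, for $1\le i\le 4$, the unit $\varepsilon_{2i}$ is a conjugate of $\varepsilon_{2i-1}$ and $U_{k_i}=\langle -1,\varepsilon_{2i-1},\varepsilon_{2i}\rangle$. A unit transition matrix for $(\varepsilon_1,\dots,\varepsilon_8)$ is an upper triangular integer matrix $A=(a_{\iota\lambda})\in\mathbb{Z}^{8\times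 8}$ with positive diagonal entries such that $\gamma_\lambda^3=\prod_{\iota=1}^{8}\varepsilon_\iota^{a_{\iota\lambda}}$ for $1\le\lambda\le 8$, where $(\gamma_1,\dots,\gamma_8)$ is a torsion-free basis of $U_B$ (that is, the $\gamma_\lambda$ are multiplicatively independent and generate $U_B$ together with $-1$). Then: 1. $I\in\{3,9,27\}$. 2. The cubic subfields of $B$ can be ordered as $k_1,k_2,k_3,k_4$ with $k_4=k$ in such a way that canonical bases exist, every canonical basis has a unit transition matrix, and each unit transition matrix $A$ for each canonical basis satisfies $$I=27\iff a_{77}=1,\ a_{88}=1,\ a_{66}=1,$$ and, if $\mathrm{Cl}_3(k)\simeq(\mathbb{Z}/3\mathbb{Z})^2$, also $$I=3\iff a_{77}=3,\ a_{66}=3,\ a_{88}=1,\qquad\qquad I=9\iff a_{77}=3,\ a_{66}=1,\ a_{88}=1.$$ 3. $I=27$ if and only if $(U_k:N_{B/k}(U_B))=1$, and in this case $\#\ker T_{B/k}=3$. 4. If $\mathrm{Cl}_3(k)\simeq(\mathbb{Z}/3\mathbb{Z})^2$ and $I\in\{3,9\}$, then $(U_k:N_{B/k}(U_B))=3$, $\#\ker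 T_{B/k}=9$, and $\ker T_{B/k}=\mathrm{Cl}_3(k)$ (total capitulation). -/

import Mathlib

open NumberField

/-- The set of rational primes that ramify in the number field `k`. -/
def ramifiedPrimes (k : Type*) [Field k] [NumberField k] : Set ℕ :=
  {p | p.Prime ∧ ¬ Algebra.IsUnramifiedIn (𝓞 k) (Ideal.span {(p : ℤ)})}

/-- The extension `L / k` of number fields is unramified at all prime ideals of `L` and at all
infinite places. -/
def IsUnramifiedExtension (k L : Type*) [Field k] [NumberField k] [Field L] [NumberField L]
    [Algebra k L] : Prop :=
  (∀ (P : Ideal (𝓞 L)) (_ : P.IsPrime), Algebra.IsUnramifiedAt (𝓞 k) P) ∧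
    IsUnramifiedAtInfinitePlaces k L

/-- The units of the subfield `k` of `B`, as a subgroup of the units of `B`. -/
noncomputable def unitsOfSubfield {B : Type*} [Field B] [NumberField B]
    (k : IntermediateField ℚ B) : Subgroup (𝓞 B)ˣ :=
  (Units.map (algebraMap (𝓞 k) (𝓞 B)).toMonoidHom).range

/-- For a bicyclic bicubic field `B`: the group `V` generated by the units of all the cubic
subfields of `B`. -/
noncomputable def subfieldUnits (B : Type*) [Field B] [NumberField B] : Subgroup (𝓞 B)ˣ :=
  ⨆ (k : IntermediateField ℚ B) (_ : Module.finrank ℚ k = 3), unitsOfSubfield k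

/-- The group `N_{L/k}(U_L)` of norms of units, as a subgroup of the unit group of `k`. -/
noncomputable def normUnits (k L : Type*) [Field k] [NumberField k] [Field L] [NumberField L]
    [Algebra k L] [FiniteDimensional k L] : Subgroup (𝓞 k)ˣ :=
  (Units.map (RingOfIntegers.norm k (L := L))).range

/-- The `3`-class group: the subgroup of all ideal classes of `3`-power order. -/
noncomputable abbrev threeClassGroup (k : Type*) [Field k] [NumberField k] :
    Subgroup (ClassGroup (𝓞 k)) :=
  CommGroup.primaryComponent (ClassGroup (𝓞 k)) 3

/-- The transfer kernel (capitulation kernel): the classes in the `3`-class group of `k` that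
become principal under extension of ideals to `L`. -/
noncomputable def transferKernel (k L : Type*) [Field k] [NumberField k] [Field L] [NumberField L]
    [Algebra k L] : Subgroup (threeClassGroup k) :=
  ((ClassGroup.extendedHom (𝓞 k) (𝓞 L)).comp (threeClassGroup k).subtype).ker

/-- `κ` enumerates the four cubic subfields of the bicyclic bicubic field `B`, and the field in the
last position is `k`. -/
def IsOrdering {B : Type*} [Field B] [NumberField B] (k : IntermediateField ℚ B)
    (κ : Fin 4 → IntermediateField ℚ B) : Prop :=
  Function.Injective κ ∧ Set.range κ = {F : IntermediateField ℚ B | Module.finrank ℚ F = 3} ∧ κ 3 = k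

/-- The conjugate of a unit of `B` under an automorphism of `B`. -/
noncomputable def conjUnit {B : Type*} [Field B] [NumberField B] (σ : B ≃ₐ[ℚ] B) (u : (𝓞 B)ˣ) :
    (𝓞 B)ˣ :=
  Units.map (RingOfIntegers.mapRingEquiv (σ : B ≃+* B)).toMonoidHom u

/-- A canonical basis of the group of subfield units, with respect to an ordering of the four cubic
subfields: the `i`-th subfield contributes the pair consisting of a fundamental unit `ε i` and one
of its conjugates, these two units and `-1` generating its unit group. -/
def IsCanonicalBasis {B : Type*} [Field B] [NumberField B] (κ : Fin 4 → IntermediateField ℚ B)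
    (e : Fin 8 → (𝓞 B)ˣ) : Prop :=
  ∃ (ε : Fin 4 → (𝓞 B)ˣ) (σ : Fin 4 → (B ≃ₐ[ℚ] B)),
    (∀ i, Subgroup.closure {-1, ε i, conjUnit (σ i) (ε i)} = unitsOfSubfield (κ i)) ∧
    e = ![ε 0, conjUnit (σ 0) (ε 0), ε 1, conjUnit (σ 1) (ε 1),
      ε 2, conjUnit (σ 2) (ε 2), ε 3, conjUnit (σ 3) (ε 3)]

/-- `γ` is a torsion-free basis of the unit group of `B`: the `γ j` are multiplicatively
independent and generate the unit group together with `-1`. -/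
def IsUnitBasis {B : Type*} [Field B] [NumberField B] (γ : Fin 8 → (𝓞 B)ˣ) : Prop :=
  (∀ n : Fin 8 → ℤ, ∏ j, γ j ^ n j = 1 → n = 0) ∧
    Subgroup.closure (insert (-1) (Set.range γ)) = ⊤

/-- `A` is the unit transition matrix from the basis `e` to the cubes of the torsion-free basis `γ`
of the unit group: it is upper triangular with positive diagonal, and
`(γ₁³, …, γ₈³) = (e₁, …, e₈) · A` in the sense of exponentiation. -/
def IsUnitTransition {B : Type*} [Field B] [NumberField B] (e γ : Fin 8 → (𝓞 B)ˣ)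
    (A : Matrix (Fin 8) (Fin 8) ℤ) : Prop :=
  IsUnitBasis γ ∧ (∀ i j, j < i → A i j = 0) ∧ (∀ j, 0 < A j j) ∧
    ∀ j, γ j ^ 3 = ∏ i, e i ^ A i j

set_option linter.unusedSectionVars false

/-! Let ζ be a primitive cube root of unity and let N_i be the norm from B to k_i. The four
subgroups of order three partition the nontrivial elements of the Galois group, and the absolute
norm of a unit is ±1, so u³ = ± ∏ N_i(u) for every unit u of B. Each group U_{k_i}/±1 is free of
rank one over ℤ[ζ]. The exponents of the N_i(u) in a canonical basis therefore embed U_B/±1 into Λ =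
ℤ[ζ]⁴ as a lattice L, in such a way that V corresponds to 3Λ. Hence I = (L : 3Λ), and the columns of
a unit transition matrix form an upper triangular basis of L.

Two properties of L are formal (`IsCubicFrame.isStable`): u ↦ u/τ_i(u) kills the block i and
multiplies the other blocks by 1 - ζ or 1 - ζ², and a vector of L supported in one block lies in 3Λ.
The arithmetic enters through Hilbert 90: up to sign ε_i = a/σ(a), whence a³ = A_i ε_i² σ(ε_i) with
a rational integer A_i. Consequently (L ∩ (1 - ζ)Λ)/3Λ is the space of 𝔽₃-linear relations between
the exponent vectors of A_1, …, A_4 modulo 3, and these vectors are supported at ramified primes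
(`exists_ramification_vectors`). Since B/k is unramified, only the three primes ramified in k occur.
Four vectors in 𝔽₃³ are dependent, so L ≠ 3Λ. Moreover every prime is unramified in one of the other
three cubic fields, so the vectors of these fields cannot all be proportional. They can thus be
ordered so that vectors of L supported in the first two blocks lie in 3Λ
(`exists_isCubicFrame_independent`).

The rest of the unit computation is linear algebra modulo 1 - ζ. If L is nonzero modulo 1 - ζ in the
last block (`IsFull`), then I = 27; otherwise L lies in (1 - ζ)Λ and I is 3 or 9. The same
alternative is visible on the diagonal of the transition matrix, and in (U_k : N(U_B)), which is the
index of the projection of L to the last block.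

For the transfer, an unramified cyclic extension has capitulation kernel isomorphic to H¹ of the
units (`exists_transfer_hom`). Comparing L with 3Λ, as for a Herbrand quotient, gives this group the
order 3 (U_k : N(U_B)). If Cl_3(k) has order 9, then the norm index divides 3, and it equals 3
unless I = 27. -/

/-- Four planes `ℤ × ℤ`, each thought of as a copy of the Eisenstein integers `ℤ ⊕ ℤ ζ`. -/
abbrev EisensteinBlocks := Fin 4 → ℤ × ℤ

/-! ### Stable lattices between 3Λ and Λ = ℤ[ζ]⁴ -/

namespace EisensteinBlocks

/-- The multiples of `3`. -/
def triple : AddSubgroup EisensteinBlocks where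
  carrier := {x | ∀ i, 3 ∣ (x i).1 ∧ 3 ∣ (x i).2}
  zero_mem' := by simp
  add_mem' := fun hx hy i => ⟨dvd_add (hx i).1 (hy i).1, dvd_add (hx i).2 (hy i).2⟩
  neg_mem' := fun hx i => ⟨(dvd_neg).2 (hx i).1, (dvd_neg).2 (hx i).2⟩

theorem mem_triple {x : EisensteinBlocks} : x ∈ triple ↔ ∀ i, 3 ∣ (x i).1 ∧ 3 ∣ (x i).2 := Iff.rfl

theorem mem_triple_iff_exists {x : EisensteinBlocks} : x ∈ triple ↔ ∃ y, x = (3 : ℤ) • y := by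
  constructor
  · intro h
    choose h1 h2 using h
    choose f hf using h1
    choose g hg using h2
    exact ⟨fun i => (f i, g i), funext fun i => Prod.ext (by simp [hf]) (by simp [hg])⟩
  · rintro ⟨y, rfl⟩ i
    simp

/-- Reduction of every block modulo the prime `1 - ζ`. -/
def residue : EisensteinBlocks →+ (Fin 4 → ZMod 3) where
  toFun x i := (((x i).1 + (x i).2 : ℤ) : ZMod 3)
  map_zero' := by ext; simp
  map_add' x y := by ext; simp; ring

/-- Reduction of the first coordinate of every block modulo `3`. -/
def firstMod : EisensteinBlocks →+ (Fin 4 → ZMod 3) where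
  toFun x i := (((x i).1 : ℤ) : ZMod 3)
  map_zero' := by ext; simp
  map_add' x y := by ext; simp

/-- `y` arises from `x` through multiplication by `1 - ζ` or by `1 - ζ²`. -/
def IsTwist (x y : ℤ × ℤ) : Prop :=
  y = (x.1 + x.2, 2 * x.2 - x.1) ∨ y = (2 * x.1 - x.2, x.1 + x.2)

/-- A lattice containing all multiples of `3` that, for every `i`, is stable under an endomorphism
killing the `i`-th block and acting as `1 - ζ` or `1 - ζ²` on the other blocks, and whose elements
supported in a single block are multiples of `3`. -/
structure IsStable (L : AddSubgroup EisensteinBlocks) : Prop where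
  triple_le : triple ≤ L
  twist : ∀ i, ∀ x ∈ L, ∃ y ∈ L, y i = 0 ∧ ∀ j, j ≠ i → IsTwist (x j) (y j)
  single : ∀ i, ∀ x ∈ L, (∀ j, j ≠ i → x j = 0) → x ∈ triple

/-- The relations modulo `1 - ζ` that are satisfied in `L`. -/
def relations (L : AddSubgroup EisensteinBlocks) : AddSubgroup (Fin 4 → ZMod 3) :=
  (residue.ker ⊓ L).map firstMod

theorem mem_residue_ker {x : EisensteinBlocks} :
    x ∈ residue.ker ↔ ∀ i, 3 ∣ (x i).1 + (x i).2 := by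
  rw [AddMonoidHom.mem_ker, funext_iff]
  refine forall_congr' fun i => ?_
  exact ZMod.intCast_zmod_eq_zero_iff_dvd _ 3

theorem firstMod_apply_eq_zero {x : EisensteinBlocks} {i : Fin 4} :
    firstMod x i = 0 ↔ 3 ∣ (x i).1 := ZMod.intCast_zmod_eq_zero_iff_dvd _ 3

theorem residue_apply_eq_zero {x : EisensteinBlocks} {i : Fin 4} :
    residue x i = 0 ↔ 3 ∣ (x i).1 + (x i).2 := ZMod.intCast_zmod_eq_zero_iff_dvd _ 3

theorem firstMod_ker_inf : firstMod.ker ⊓ residue.ker = triple := by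
  ext x
  rw [AddSubgroup.mem_inf, mem_residue_ker, AddMonoidHom.mem_ker, funext_iff, mem_triple]
  have this : ∀ i, firstMod x i = (0 : Fin 4 → ZMod 3) i ↔ 3 ∣ (x i).1 :=
    fun i => firstMod_apply_eq_zero
  simp only [this]
  constructor
  · rintro ⟨h1, h2⟩ i
    have := h1 i; have := h2 i
    constructor <;> omega
  · intro h
    constructor <;> intro i <;> have := h i <;> omega

theorem IsTwist.residue_eq_zero {x y : ℤ × ℤ} (h : IsTwist x y) : 3 ∣ y.1 + y.2 := by
  rcases h with rfl | rfl
  · exact ⟨x.2, by ring⟩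
  · exact ⟨x.1, by ring⟩

/-- Multiplication by 1 - ζ carries the layer modulo 1 - ζ to the layer (1 - ζ)/3. In the
coordinates `residue` and `firstMod` this is the identity up to a sign, so supports are preserved.
-/
theorem IsTwist.firstMod_eq {x y : ℤ × ℤ} (h : IsTwist x y) :
    ((y.1 : ℤ) : ZMod 3) = ((x.1 + x.2 : ℤ) : ZMod 3) ∨
      ((y.1 : ℤ) : ZMod 3) = -((x.1 + x.2 : ℤ) : ZMod 3) := by
  rcases h with rfl | rfl
  · exact Or.inl rfl
  · right
    rw [← Int.cast_neg, ZMod.intCast_eq_intCast_iff_dvd_sub]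
    exact ⟨-x.1, by push_cast; ring⟩

variable {L : AddSubgroup EisensteinBlocks}

/-- Subtracting multiples of `3`, a relation is realized by a vector of `L` that vanishes where the
relation does. -/
theorem IsStable.exists_of_mem_relations (hL : IsStable L) {c : Fin 4 → ZMod 3}
    (hc : c ∈ relations L) :
    ∃ x ∈ L, (∀ i, c i = 0 → x i = 0) ∧ (∀ i, c i ≠ 0 → ¬ 3 ∣ (x i).2) := by
  obtain ⟨x, ⟨hx1, hx2⟩, rfl⟩ := hc
  replace hx1 := mem_residue_ker.1 hx1
  classical
  refine ⟨fun i => if firstMod x i = 0 then 0 else x i, ?_, ?_, ?_⟩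
  · have : (fun i => if firstMod x i = 0 then 0 else x i) =
        x - fun i => if firstMod x i = 0 then x i else 0 := by
      ext i <;> simp only [Pi.sub_apply] <;> split_ifs <;> simp
    rw [this]
    refine L.sub_mem hx2 (hL.triple_le fun i => ?_)
    have := hx1 i
    by_cases h : firstMod x i = 0
    · simp only [h, if_true]
      rw [firstMod_apply_eq_zero] at h
      constructor <;> omega
    · simp [h]
  · intro i hi
    simp [hi]
  · intro i hi
    simp only [hi, if_false]
    rw [ne_eq, firstMod_apply_eq_zero] at hi
    have := hx1 i
    omega

theorem IsStable.relations_single (hL : IsStable L) (i : Fin 4) {c : Fin 4 → ZMod 3}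
    (hc : c ∈ relations L) (h : ∀ j, j ≠ i → c j = 0) : c = 0 := by
  obtain ⟨x, hx, h0, h1⟩ := hL.exists_of_mem_relations hc
  have := hL.single i x hx fun j hj => h0 j (h j hj)
  ext j
  by_contra hj
  exact h1 j hj (this j).2

theorem IsStable.relations_pair (hL : IsStable L)
    (hP : ∀ x ∈ L, x 2 = 0 → x 3 = 0 → x ∈ triple) {c : Fin 4 → ZMod 3}
    (hc : c ∈ relations L) (h2 : c 2 = 0) (h3 : c 3 = 0) : c = 0 := by
  obtain ⟨x, hx, h0, h1⟩ := hL.exists_of_mem_relations hc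
  have := hP x hx (h0 2 h2) (h0 3 h3)
  ext j
  by_contra hj
  exact h1 j hj (this j).2

/-- The link between the two layers of L/3Λ: a residue vector becomes a relation after its entry i
is erased. The signs may differ from block to block, so only the support is recorded. -/
theorem IsStable.exists_twist (hL : IsStable L) (i : Fin 4) {c : Fin 4 → ZMod 3}
    (hc : c ∈ L.map residue) :
    ∃ v ∈ relations L, v i = 0 ∧ ∀ j, j ≠ i → (v j = 0 ↔ c j = 0) := by
  obtain ⟨x, hx, rfl⟩ := hc
  obtain ⟨y, hy, hyi, hyj⟩ := hL.twist i x hx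
  refine ⟨firstMod y, ⟨y, ⟨?_, hy⟩, rfl⟩, ?_, ?_⟩
  · refine mem_residue_ker.2 fun j => ?_
    by_cases hj : j = i
    · subst hj; simp [hyi]
    · exact (hyj j hj).residue_eq_zero
  · rw [firstMod_apply_eq_zero, hyi]; simp
  · intro j hj
    rcases (hyj j hj).firstMod_eq with h | h
    · exact Eq.congr_left h
    · change ((y j).1 : ZMod 3) = 0 ↔ (((x j).1 + (x j).2 : ℤ) : ZMod 3) = 0
      rw [h, neg_eq_zero]

/-- Filter by 3Λ ≤ L ∩ (1 - ζ)Λ ≤ L: the lower quotient is detected by `firstMod`, the upper one by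
`residue`. -/
theorem relIndex_triple (L : AddSubgroup EisensteinBlocks) (h : triple ≤ L) :
    triple.relIndex L = Nat.card (relations L) * Nat.card (L.map residue) := by
  have h1 : triple.relIndex (residue.ker ⊓ L) * (residue.ker ⊓ L).relIndex L =
      triple.relIndex L := by
    refine AddSubgroup.relIndex_mul_relIndex _ _ _ (le_inf ?_ h) inf_le_right
    rw [← firstMod_ker_inf]; exact inf_le_right
  have h3 : triple ⊓ residue.ker = triple :=
    inf_eq_left.2 (by rw [← firstMod_ker_inf]; exact inf_le_right)
  have h2 : triple.relIndex (residue.ker ⊓ L) = firstMod.ker.relIndex (residue.ker ⊓ L) := by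
    rw [← AddSubgroup.inf_relIndex_right, ← AddSubgroup.inf_relIndex_right firstMod.ker,
      ← inf_assoc, ← inf_assoc, firstMod_ker_inf, h3]
  rw [← h1, h2, AddSubgroup.inf_relIndex_right, AddSubgroup.relIndex_ker, AddSubgroup.relIndex_ker,
    relations]

/-! ### The possible indices 3, 9 and 27 -/

section Dichotomy

variable (hL : IsStable L) (hP : ∀ x ∈ L, x 2 = 0 → x 3 = 0 → x ∈ triple)

/-- Some element of `L` is nonzero modulo `1 - ζ` in the last block. -/
def IsFull (L : AddSubgroup EisensteinBlocks) : Prop := ∃ x ∈ L, ¬ 3 ∣ (x 3).1 + (x 3).2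

include hL hP

/-- Erasing entry 2 leaves a relation in blocks 0 and 1, which vanishes by `hP`. Then c is supported
at entry 2, and erasing entry 0 yields a relation in a single block, which vanishes as well. -/
theorem eq_zero_of_mem_map_residue {c : Fin 4 → ZMod 3} (hc : c ∈ L.map residue) (h3 : c 3 = 0) :
    c = 0 := by
  obtain ⟨v, hv, hv0, hv'⟩ := hL.exists_twist 0 hc
  obtain ⟨w, hw, hw1, hw'⟩ := hL.exists_twist 1 hc
  obtain ⟨z, hz, hz2, hz'⟩ := hL.exists_twist 2 hc
  have hz3 : z = 0 := hL.relations_pair hP hz hz2 ((hz' 3 (by decide)).2 h3)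
  have c0 : c 0 = 0 := (hz' 0 (by decide)).1 (by simp [hz3])
  have c1 : c 1 = 0 := (hz' 1 (by decide)).1 (by simp [hz3])
  have hv2 : v = 0 := by
    refine hL.relations_single 2 hv fun j hj => ?_
    fin_cases j
    · exact hv0
    · exact (hv' 1 (by decide)).2 c1
    · exact absurd rfl hj
    · exact (hv' 3 (by decide)).2 h3
  have c2 : c 2 = 0 := (hv' 2 (by decide)).1 (by simp [hv2])
  ext j
  fin_cases j <;> assumption

theorem map_residue_eq_bot_of_not_isFull (h : ¬ IsFull L) : L.map residue = ⊥ := by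
  rw [eq_bot_iff]
  intro c hc
  refine eq_zero_of_mem_map_residue hL hP hc ?_
  obtain ⟨x, hx, rfl⟩ := hc
  by_contra h'
  exact h ⟨x, hx, by rwa [residue_apply_eq_zero] at h'⟩

omit hL hP in
theorem card_eq_pow {n : ℕ} (S : AddSubgroup (Fin n → ZMod 3)) : ∃ m, Nat.card S = 3 ^ m := by
  have h : Nat.card S ∣ 3 ^ n := by
    have := AddSubgroup.card_addSubgroup_dvd_card S
    rwa [Nat.card_fun, Nat.card_zmod, Nat.card_fin] at this
  obtain ⟨m, -, hm⟩ := (Nat.dvd_prime_pow Nat.prime_three).1 h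
  exact ⟨m, hm⟩

omit hL hP in
theorem card_le_of_injOn {m n : ℕ} (S : AddSubgroup (Fin n → ZMod 3)) (f : Fin m → Fin n)
    (h : ∀ c ∈ S, (∀ i, c (f i) = 0) → c = 0) : Nat.card S ≤ 3 ^ m := by
  have := Nat.card_le_card_of_injective (fun (c : S) (i : Fin m) => (c : Fin n → ZMod 3) (f i)) ?_
  · rwa [Nat.card_fun, Nat.card_zmod, Nat.card_fin] at this
  · intro c d hcd
    have := h (c - d : S) (c - d : S).2 fun i => by
      simpa [sub_eq_zero] using congrFun hcd i
    simpa [sub_eq_zero] using this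

theorem card_relations_le : Nat.card (relations L) ≤ 9 := by
  refine card_le_of_injOn (m := 2) (relations L) ![2, 3] fun c hc h => ?_
  exact hL.relations_pair hP hc (h 0) (h 1)

theorem card_map_residue_le : Nat.card (L.map residue) ≤ 3 := by
  refine card_le_of_injOn (m := 1) _ ![3] fun c hc h => ?_
  exact eq_zero_of_mem_map_residue hL hP hc (h 0)

/-- Erasing different entries of one residue vector c with c 3 ≠ 0 produces two independent
relations, which is what makes the relation space as large as possible. -/
theorem IsFull.exists_relation (h : IsFull L) :
    (∃ v ∈ relations L, v 3 = 0 ∧ v 2 ≠ 0) ∧ ∃ w ∈ relations L, w 3 ≠ 0 := by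
  obtain ⟨x, hx, hx3⟩ := h
  rw [← residue_apply_eq_zero] at hx3
  set c := residue x with hc
  have hcm : c ∈ L.map residue := ⟨x, hx, rfl⟩
  have key : ∀ i : Fin 4, i ≠ 3 → ∃ w ∈ relations L, w i = 0 ∧ w 3 ≠ 0 := by
    intro i hi
    obtain ⟨w, hw, hw0, hw'⟩ := hL.exists_twist i hcm
    exact ⟨w, hw, hw0, fun h => hx3 ((hw' 3 hi.symm).1 h)⟩
  obtain ⟨v, hv, hv3, hv'⟩ := hL.exists_twist 3 hcm
  refine ⟨⟨v, hv, hv3, fun hv2 => ?_⟩, ?_⟩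
  -- If v vanished, c would be supported in block 3, and erasing entry 0 would give a nonzero
  -- relation in a single block.
  · have hv0 := hL.relations_pair hP hv hv2 hv3
    obtain ⟨w, hw, hw0, hw'⟩ := hL.exists_twist 0 hcm
    have : w = 0 := by
      refine hL.relations_single 3 hw fun j hj => ?_
      by_cases hj0 : j = 0
      · rw [hj0, hw0]
      · exact (hw' j hj0).2 ((hv' j hj).1 (by simp [hv0]))
    exact hx3 ((hw' 3 (by decide)).1 (by simp [this]))
  · obtain ⟨w, hw, -, hw3⟩ := key 0 (by decide)
    exact ⟨w, hw, hw3⟩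

omit hL hP in
theorem three_le_card_of_ne_zero {n : ℕ} {S : AddSubgroup (Fin n → ZMod 3)} {v : Fin n → ZMod 3}
    (hv : v ∈ S) (h : v ≠ 0) : 3 ≤ Nat.card S := by
  obtain ⟨m, hm⟩ := card_eq_pow S
  rcases m with _ | m
  · exfalso
    have := (AddSubgroup.eq_bot_iff_card S).2 (by simpa using hm)
    rw [this] at hv
    exact h hv
  · rw [hm, pow_succ]
    have := Nat.one_le_pow m 3 (by norm_num)
    omega

omit hL hP in
theorem nine_le_card_of_independent {n : ℕ} {S : AddSubgroup (Fin n → ZMod 3)}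
    {v w : Fin n → ZMod 3} (hv : v ∈ S) (hw : w ∈ S) (h : v ≠ 0) (i : Fin n) (hvi : v i = 0)
    (hwi : w i ≠ 0) : 9 ≤ Nat.card S := by
  obtain ⟨m, hm⟩ := card_eq_pow S
  have h3 := three_le_card_of_ne_zero hv h
  have hlt : 3 < Nat.card S := by
    -- Six distinct elements suffice, since the order is a power of 3 and so exceeding 3 forces at
    -- least 9.
    have hf : ∀ k : ZMod 3 × Fin 2, ∃ s : S, (s : Fin n → ZMod 3) =
        k.1 • v + (k.2 : ℕ) • w := fun k =>
      ⟨⟨_, S.add_mem (by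
        rw [← ZMod.natCast_zmod_val k.1, Nat.cast_smul_eq_nsmul]
        exact S.nsmul_mem hv _) (S.nsmul_mem hw _)⟩, rfl⟩
    choose f hf using hf
    have hinj : Function.Injective f := by
      rintro ⟨a, b⟩ ⟨a', b'⟩ hab
      have h1 : a • v + (b : ℕ) • w = a' • v + (b' : ℕ) • w := by
        rw [← hf (a, b), ← hf (a', b'), hab]
      have h2 := congrFun h1 i
      have hbb : b = b' := by
        simp only [Pi.add_apply, Pi.smul_apply, hvi, smul_zero, zero_add] at h2
        fin_cases b <;> fin_cases b' <;> simp_all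
      subst hbb
      rw [add_left_inj] at h1
      obtain ⟨j, hj⟩ := Function.ne_iff.1 h
      have h4 := congrFun h1 j
      simp only [Pi.smul_apply, smul_eq_mul] at h4
      have : a = a' := mul_right_cancel₀ hj h4
      rw [this]
    have := Nat.card_le_card_of_injective f hinj
    simp only [Nat.card_prod, Nat.card_zmod, Nat.card_fin] at this
    omega
  rw [hm] at hlt ⊢
  have : 1 < m := (Nat.pow_lt_pow_iff_right (by norm_num : 1 < 3)).1 (by simpa using hlt)
  calc 9 = 3 ^ 2 := by norm_num
    _ ≤ 3 ^ m := Nat.pow_le_pow_right (by norm_num) this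

theorem IsFull.relIndex_eq (h : IsFull L) : triple.relIndex L = 27 := by
  obtain ⟨⟨v, hv, hv3, hv2⟩, w, hw, hw3⟩ := h.exists_relation hL hP
  have h1 := nine_le_card_of_independent hv hw (fun h => hv2 (by simp [h])) 3 hv3 hw3
  have h2 := card_relations_le hL hP
  have h3 := card_map_residue_le hL hP
  obtain ⟨x, hx, hx3⟩ := h
  rw [← residue_apply_eq_zero] at hx3
  have h4 := three_le_card_of_ne_zero (S := L.map residue) ⟨x, hx, rfl⟩
    (fun h => hx3 (by simp [h]))
  rw [relIndex_triple L hL.triple_le, le_antisymm h2 h1, le_antisymm h3 h4]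

theorem relIndex_eq_of_not_isFull (h : ¬ IsFull L) :
    triple.relIndex L = Nat.card (relations L) := by
  rw [relIndex_triple L hL.triple_le, map_residue_eq_bot_of_not_isFull hL hP h]
  simp

theorem relIndex_of_not_isFull (h : ¬ IsFull L) (hne : ¬ L ≤ triple) :
    triple.relIndex L = 3 ∨ triple.relIndex L = 9 := by
  have h1 := card_relations_le hL hP
  have h2 : triple.relIndex L ≠ 1 := fun h => hne (AddSubgroup.relIndex_eq_one.1 h)
  rw [relIndex_eq_of_not_isFull hL hP h] at h2 ⊢
  obtain ⟨m, hm⟩ := card_eq_pow (relations L)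
  rw [hm] at h1 h2 ⊢
  have : m < 3 := by
    by_contra hm3
    have := Nat.pow_le_pow_right (n := 3) (by norm_num) (not_lt.1 hm3)
    omega
  interval_cases m <;> simp_all

theorem relIndex_eq_iff_isFull (hne : ¬ L ≤ triple) : triple.relIndex L = 27 ↔ IsFull L := by
  refine ⟨fun h => ?_, fun h => h.relIndex_eq hL hP⟩
  by_contra hF
  rcases relIndex_of_not_isFull hL hP hF hne with h' | h' <;> omega

theorem relIndex_trichotomy (hne : ¬ L ≤ triple) :
    triple.relIndex L = 3 ∨ triple.relIndex L = 9 ∨ triple.relIndex L = 27 := by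
  by_cases hF : IsFull L
  · exact Or.inr (Or.inr (hF.relIndex_eq hL hP))
  · rcases relIndex_of_not_isFull hL hP hF hne with h | h <;> simp [h]

omit hL hP in
theorem mem_relations_of_not_isFull (h : L.map residue = ⊥) {x : EisensteinBlocks} (hx : x ∈ L) :
    firstMod x ∈ relations L := by
  refine ⟨x, ⟨?_, hx⟩, rfl⟩
  have : residue x ∈ L.map residue := ⟨x, hx, rfl⟩
  rwa [h] at this

/-- If some vector of `L` has a last coordinate prime to `3`, then the index is `3` unless there is
a vector ending in the third block with this property. -/
theorem relIndex_eq_three_iff (hF : ¬ IsFull L) (h8 : ∃ x ∈ L, ¬ 3 ∣ (x 3).2) :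
    triple.relIndex L = 3 ↔ ¬ ∃ x ∈ L, x 3 = 0 ∧ ¬ 3 ∣ (x 2).2 := by
  have hbot := map_residue_eq_bot_of_not_isFull hL hP hF
  have hsum : ∀ x ∈ L, ∀ i, 3 ∣ (x i).1 + (x i).2 := by
    intro x hx
    have : residue x ∈ L.map residue := ⟨x, hx, rfl⟩
    rw [hbot] at this
    exact mem_residue_ker.1 this
  obtain ⟨w, hw, hw3⟩ := h8
  have hwr := mem_relations_of_not_isFull hbot hw
  have hw3' : firstMod w 3 ≠ 0 := by
    rw [ne_eq, firstMod_apply_eq_zero]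
    have := hsum w hw 3
    omega
  rw [relIndex_eq_of_not_isFull hL hP hF]
  constructor
  · rintro h ⟨x, hx, hx3, hx2⟩
    have h0 : firstMod x 2 ≠ 0 := by
      rw [ne_eq, firstMod_apply_eq_zero]
      have := hsum x hx 2
      omega
    have := nine_le_card_of_independent (mem_relations_of_not_isFull hbot hx) hwr
      (fun h => h0 (by simp [h])) 3 (by rw [firstMod_apply_eq_zero, hx3]; simp) hw3'
    omega
  -- Without such a vector, relations with last entry zero also vanish at entry 2, hence are zero by
  -- `hP`; the last entry is then injective on relations.
  · intro h
    refine le_antisymm ?_ (three_le_card_of_ne_zero hwr fun h => hw3' (by simp [h]))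
    refine card_le_of_injOn (m := 1) _ ![3] fun c hc hc3 => ?_
    obtain ⟨x, hx, hx0, hx1⟩ := hL.exists_of_mem_relations hc
    refine hL.relations_pair hP hc ?_ (hc3 0)
    by_contra h2
    exact h ⟨x, hx, hx0 3 (hc3 0), hx1 2 h2⟩

theorem IsFull.exists_third (h : IsFull L) : ∃ x ∈ L, x 3 = 0 ∧ ¬ 3 ∣ (x 2).2 := by
  obtain ⟨⟨v, hv, hv3, hv2⟩, -⟩ := h.exists_relation hL hP
  obtain ⟨x, hx, hx0, hx1⟩ := hL.exists_of_mem_relations hv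
  exact ⟨x, hx, hx0 3 hv3, hx1 2 hv2⟩

end Dichotomy

end EisensteinBlocks

/-! ### The projection to the last block and the Herbrand quotient -/

namespace EisensteinBlocks

/-- The last block. -/
def lastBlock : EisensteinBlocks →+ ℤ × ℤ := Pi.evalAddMonoidHom _ 3

@[simp] theorem lastBlock_apply (x : EisensteinBlocks) : lastBlock x = x 3 := rfl

/-- The multiples of `3` in a plane. -/
def planeTriple : AddSubgroup (ℤ × ℤ) :=
  ((Int.castAddHom (ZMod 3)).prodMap (Int.castAddHom (ZMod 3))).ker

theorem mem_planeTriple {z : ℤ × ℤ} : z ∈ planeTriple ↔ 3 ∣ z.1 ∧ 3 ∣ z.2 := by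
  rw [planeTriple, AddMonoidHom.mem_ker, Prod.ext_iff]
  exact and_congr (ZMod.intCast_zmod_eq_zero_iff_dvd _ 3) (ZMod.intCast_zmod_eq_zero_iff_dvd _ 3)

theorem planeTriple_index : planeTriple.index = 9 := by
  rw [planeTriple, AddSubgroup.index_ker, AddMonoidHom.range_eq_top.2]
  · rw [AddSubgroup.card_top, Nat.card_prod, Nat.card_zmod]
  · exact Function.Surjective.prodMap (ZMod.intCast_surjective) (ZMod.intCast_surjective)

variable {L : AddSubgroup EisensteinBlocks}

theorem planeTriple_le_map_lastBlock (h : triple ≤ L) : planeTriple ≤ L.map lastBlock := by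
  intro z hz
  rw [mem_planeTriple] at hz
  refine ⟨fun _ => z, h fun _ => hz, rfl⟩

theorem triple_map_lastBlock : triple.map lastBlock = planeTriple := by
  refine le_antisymm ?_ (planeTriple_le_map_lastBlock le_rfl)
  rintro _ ⟨x, hx, rfl⟩
  exact mem_planeTriple.2 (hx 3)

/-- The projection contains 3ℤ[ζ], an element prime to 1 - ζ, and a twist of it that generates (1 -
ζ) modulo 3. -/
theorem IsFull.map_lastBlock_eq_top (hL : IsStable L) (h : IsFull L) : L.map lastBlock = ⊤ := by
  obtain ⟨x, hx, hx3⟩ := h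
  obtain ⟨y, hy, -, hy'⟩ := hL.twist 0 x hx
  have hT := planeTriple_le_map_lastBlock hL.triple_le
  set S := L.map lastBlock with hS
  have hxS : x 3 ∈ S := ⟨x, hx, rfl⟩
  have hyS : y 3 ∈ S := ⟨y, hy, rfl⟩
  -- The ideal (1 - ζ) lies in S. With s the coordinate sum of `x 3` one has s² ≡ 1 modulo 3, so the
  -- multiple of `y 3` by s u (or by -s u for the other twist) is congruent to (u, v) modulo 3.
  have key : ∀ u v : ℤ, (3 ∣ u + v) → (u, v) ∈ S := by
    intro u v huv
    rcases hy' 3 (by decide) with h | h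
    · have h0 : ((x 3).1 + (x 3).2) * u * ((x 3).1 + (x 3).2) - u ≡ 0 [ZMOD 3] := by
        have : ((x 3).1 + (x 3).2) ≡ 1 [ZMOD 3] ∨ ((x 3).1 + (x 3).2) ≡ 2 [ZMOD 3] := by
          unfold Int.ModEq; omega
        rcases this with h | h
        · calc _ ≡ 1 * u * 1 - u [ZMOD 3] := by gcongr
            _ = 0 := by ring
        · calc _ ≡ 2 * u * 2 - u [ZMOD 3] := by gcongr
            _ = 3 * u := by ring
            _ ≡ 0 [ZMOD 3] := by simp [Int.ModEq]
      have h1 : (u, v) = (((x 3).1 + (x 3).2) * u) • y 3 +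
          ((u, v) - (((x 3).1 + (x 3).2) * u) • y 3) := by abel
      rw [h1]
      refine S.add_mem (S.zsmul_mem hyS _) (hT (mem_planeTriple.2 ?_))
      rw [h]
      simp only [Prod.smul_mk, Prod.mk_sub_mk, smul_eq_mul]
      have h2 := Int.modEq_zero_iff_dvd.1 h0
      constructor
      · have := (Int.dvd_neg).2 h2
        convert this using 1; ring
      · obtain ⟨r, hr⟩ := h2
        obtain ⟨t, ht⟩ := huv
        refine ⟨t + r - (x 3).2 * ((x 3).1 + (x 3).2) * u, ?_⟩
        linear_combination ht + hr
    · have h0 : ((x 3).1 + (x 3).2) * u * ((x 3).1 + (x 3).2) - u ≡ 0 [ZMOD 3] := by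
        have : ((x 3).1 + (x 3).2) ≡ 1 [ZMOD 3] ∨ ((x 3).1 + (x 3).2) ≡ 2 [ZMOD 3] := by
          unfold Int.ModEq; omega
        rcases this with h | h
        · calc _ ≡ 1 * u * 1 - u [ZMOD 3] := by gcongr
            _ = 0 := by ring
        · calc _ ≡ 2 * u * 2 - u [ZMOD 3] := by gcongr
            _ = 3 * u := by ring
            _ ≡ 0 [ZMOD 3] := by simp [Int.ModEq]
      have h1 : (u, v) = (-((x 3).1 + (x 3).2) * u) • y 3 +
          ((u, v) - (-((x 3).1 + (x 3).2) * u) • y 3) := by abel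
      rw [h1]
      refine S.add_mem (S.zsmul_mem hyS _) (hT (mem_planeTriple.2 ?_))
      rw [h]
      simp only [Prod.smul_mk, Prod.mk_sub_mk, smul_eq_mul]
      obtain ⟨r, hr⟩ := Int.modEq_zero_iff_dvd.1 h0
      obtain ⟨t, ht⟩ := huv
      constructor
      · refine ⟨-r + u * ((x 3).1 + (x 3).2) * (x 3).1, ?_⟩
        linear_combination -hr
      · refine ⟨t + r, ?_⟩
        linear_combination ht + hr
  -- Subtracting an element of (1 - ζ) moves the whole coordinate sum of u • `x 3` to the first
  -- coordinate.
  have h1 : ∀ u : ℤ, (u * ((x 3).1 + (x 3).2), (0 : ℤ)) ∈ S := by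
    intro u
    have : (u * ((x 3).1 + (x 3).2), (0 : ℤ)) =
        u • (x 3) + (u * (x 3).2, -(u * (x 3).2)) := by
      ext <;> simp; ring
    rw [this]
    exact S.add_mem (S.zsmul_mem hxS _) (key _ _ (by simp))
  have h2 : ((1 : ℤ), (0 : ℤ)) ∈ S := by
    have : ∃ u k : ℤ, u * ((x 3).1 + (x 3).2) + k * 3 = 1 := by
      have hc : IsCoprime ((x 3).1 + (x 3).2) (3 : ℤ) :=
        ((Int.prime_three.coprime_iff_not_dvd).2 hx3).symm
      obtain ⟨a, b, hab⟩ := hc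
      exact ⟨a, b, hab⟩
    obtain ⟨u, k, huk⟩ := this
    have h3 : ((1 : ℤ), (0 : ℤ)) = (u * ((x 3).1 + (x 3).2), (0 : ℤ)) + (k * 3, 0) := by
      ext <;> simp [huk]
    rw [h3]
    exact S.add_mem (h1 u) (hT (mem_planeTriple.2 ⟨by simp, by simp⟩))
  rw [eq_top_iff]
  rintro ⟨a, b⟩ -
  have : (a, b) = (a + b) • ((1 : ℤ), (0 : ℤ)) + (-b, b) := by ext <;> simp
  rw [this]
  exact S.add_mem (S.zsmul_mem h2 _) (key _ _ (by simp))

theorem IsFull.exists_seventh (hL : IsStable L) (h : IsFull L) :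
    ∃ x ∈ L, (x 3).2 = 0 ∧ ¬ 3 ∣ (x 3).1 := by
  obtain ⟨x, hx, hx'⟩ : ((1 : ℤ), (0 : ℤ)) ∈ L.map lastBlock := by
    rw [h.map_lastBlock_eq_top hL]; trivial
  rw [lastBlock_apply] at hx'
  exact ⟨x, hx, by simp [hx'], by simp [hx']⟩

theorem IsFull.exists_eighth (hL : IsStable L) (h : IsFull L) : ∃ x ∈ L, ¬ 3 ∣ (x 3).2 := by
  obtain ⟨x, hx, hx'⟩ : ((0 : ℤ), (1 : ℤ)) ∈ L.map lastBlock := by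
    rw [h.map_lastBlock_eq_top hL]; trivial
  rw [lastBlock_apply] at hx'
  exact ⟨x, hx, by simp [hx']⟩

theorem isFull_of_exists_seventh (h : ∃ x ∈ L, (x 3).2 = 0 ∧ ¬ 3 ∣ (x 3).1) : IsFull L := by
  obtain ⟨x, hx, h0, h1⟩ := h
  exact ⟨x, hx, by rwa [h0, add_zero]⟩

theorem index_map_lastBlock_eq_one_iff (hL : IsStable L) :
    (L.map lastBlock).index = 1 ↔ IsFull L := by
  rw [AddSubgroup.index_eq_one]
  refine ⟨fun h => ?_, fun h => h.map_lastBlock_eq_top hL⟩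
  obtain ⟨x, hx, hx'⟩ : ((1 : ℤ), (0 : ℤ)) ∈ L.map lastBlock := by rw [h]; trivial
  rw [lastBlock_apply] at hx'
  exact ⟨x, hx, by simp [hx']⟩

/-- If all second coordinates in the last block were divisible by 3, so would be those of the
twists, 2b - a or a + b. This forces 3 ∣ a, and the projection would be 3ℤ[ζ], of index 9. -/
theorem exists_eighth_of_index_lt (hL : IsStable L) (h : (L.map lastBlock).index < 9) :
    ∃ x ∈ L, ¬ 3 ∣ (x 3).2 := by
  by_contra! hc
  have h0 : L.map lastBlock = planeTriple := by
    refine le_antisymm ?_ (planeTriple_le_map_lastBlock hL.triple_le)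
    rintro _ ⟨x, hx, rfl⟩
    rw [lastBlock_apply, mem_planeTriple]
    refine ⟨?_, hc x hx⟩
    obtain ⟨y, hy, -, hy'⟩ := hL.twist 0 x hx
    have h1 := hc x hx
    have h2 := hc y hy
    rcases hy' 3 (by decide) with h | h <;> rw [h] at h2 <;> simp only at h2 <;> omega
  rw [h0, planeTriple_index] at h
  omega

/-- An endomorphism that kills the last block and is multiplication by `1 - ζ` or by `1 - ζ²` on
each of the other ones. -/
structure IsDifference (Δ : EisensteinBlocks →+ EisensteinBlocks) : Prop where
  last : ∀ x, Δ x 3 = 0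
  other : ∀ j, j ≠ 3 → (∀ x, Δ x j = ((x j).1 + (x j).2, 2 * (x j).2 - (x j).1)) ∨
    ∀ x, Δ x j = (2 * (x j).1 - (x j).2, (x j).1 + (x j).2)

variable {Δ : EisensteinBlocks →+ EisensteinBlocks}

theorem IsDifference.apply_eq_zero_iff (hΔ : IsDifference Δ) {x : EisensteinBlocks} :
    Δ x = 0 ↔ ∀ j, j ≠ 3 → x j = 0 := by
  constructor
  · intro h j hj
    have h0 := congrFun h j
    rcases hΔ.other j hj with h1 | h1 <;> rw [h1, Pi.zero_apply, Prod.mk_eq_zero] at h0 <;>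
      ext <;> simp <;> omega
  · intro h
    ext1 j
    by_cases hj : j = 3
    · rw [hj, hΔ.last]; rfl
    · rcases hΔ.other j hj with h1 | h1 <;> rw [h1, h j hj] <;> rfl

theorem IsDifference.mem_range_iff (hΔ : IsDifference Δ) {y : EisensteinBlocks} :
    y ∈ Δ.range ↔ y 3 = 0 ∧ ∀ j, j ≠ 3 → 3 ∣ (y j).1 + (y j).2 := by
  constructor
  · rintro ⟨x, rfl⟩
    refine ⟨hΔ.last x, fun j hj => ?_⟩
    rcases hΔ.other j hj with h1 | h1 <;> rw [h1]
    · exact ⟨(x j).2, by ring⟩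
    · exact ⟨(x j).1, by ring⟩
  · rintro ⟨h3, h⟩
    have : ∀ j, ∃ z : ℤ × ℤ, ∀ x : EisensteinBlocks, x j = z → Δ x j = y j := by
      intro j
      by_cases hj : j = 3
      · exact ⟨0, fun x _ => by rw [hj, hΔ.last, h3]⟩
      · obtain ⟨k, hk⟩ := h j hj
        rcases hΔ.other j hj with h1 | h1
        · refine ⟨((y j).1 - k, k), fun x hx => ?_⟩
          rw [h1, hx]
          ext <;> simp; linarith
        · refine ⟨(k, (y j).2 - k), fun x hx => ?_⟩
          rw [h1, hx]
          ext <;> simp; linarith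
    choose z hz using this
    exact ⟨z, funext fun j => hz j z rfl⟩

/-- Each of the first three blocks contributes ℤ[ζ]/(1 - ζ), of order 3. -/
theorem IsDifference.relIndex_range (hΔ : IsDifference Δ) :
    Δ.range.relIndex lastBlock.ker = 27 := by
  let f : EisensteinBlocks →+ (Fin 3 → ZMod 3) :=
    (AddMonoidHom.pi fun i : Fin 3 => Pi.evalAddMonoidHom (fun _ => ZMod 3) i.castSucc).comp residue
  have hf : ∀ x (i : Fin 3), f x i = residue x i.castSucc := fun x i => rfl
  have h1 : Δ.range = f.ker ⊓ lastBlock.ker := by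
    ext y
    rw [hΔ.mem_range_iff, AddSubgroup.mem_inf, and_comm, AddMonoidHom.mem_ker, AddMonoidHom.mem_ker,
      lastBlock_apply, funext_iff]
    refine and_congr_left fun _ => ?_
    constructor
    · intro h i
      rw [hf]
      exact residue_apply_eq_zero.2 (h _ (Fin.castSucc_lt_last i).ne)
    · intro h j hj
      obtain ⟨i, rfl⟩ := Fin.exists_castSucc_eq.2 hj
      exact residue_apply_eq_zero.1 (h i)
  rw [h1, AddSubgroup.inf_relIndex_right, AddSubgroup.relIndex_ker]
  have : lastBlock.ker.map f = ⊤ := by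
    rw [eq_top_iff]
    intro c _
    refine ⟨![((c 0).val, 0), ((c 1).val, 0), ((c 2).val, 0), 0], rfl, ?_⟩
    ext i
    rw [hf]
    fin_cases i <;> simp [residue]
  rw [this, AddSubgroup.card_top, Nat.card_fun, Nat.card_zmod, Nat.card_fin]
  norm_num

theorem IsDifference.map_triple_relIndex (hΔ : IsDifference Δ) :
    (triple.map Δ).relIndex (triple ⊓ lastBlock.ker) = 27 := by
  let m : EisensteinBlocks →+ EisensteinBlocks := zsmulAddGroupHom 3
  have hm : Function.Injective m := by
    intro x y hxy
    exact zsmul_right_injective (G := EisensteinBlocks) (by norm_num : (3 : ℤ) ≠ 0) hxy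
  have h1 : triple = (⊤ : AddSubgroup EisensteinBlocks).map m := by
    ext x
    rw [mem_triple_iff_exists]
    constructor
    · rintro ⟨y, rfl⟩; exact ⟨y, trivial, rfl⟩
    · rintro ⟨y, -, rfl⟩; exact ⟨y, rfl⟩
  have h2 : triple.map Δ = Δ.range.map m := by
    rw [h1, AddSubgroup.map_map, AddMonoidHom.range_eq_map, AddSubgroup.map_map]
    congr 1
    exact AddMonoidHom.ext fun x => map_zsmul Δ 3 x
  have h3 : triple ⊓ lastBlock.ker = lastBlock.ker.map m := by
    ext x
    rw [AddSubgroup.mem_inf, mem_triple_iff_exists]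
    constructor
    · rintro ⟨⟨y, rfl⟩, hy⟩
      refine ⟨y, ?_, rfl⟩
      have : (3 : ℤ) • y 3 = 0 := hy
      exact (smul_eq_zero.1 this).resolve_left (by norm_num)
    · rintro ⟨y, hy, rfl⟩
      refine ⟨⟨y, rfl⟩, ?_⟩
      have : y 3 = 0 := hy
      change (3 : ℤ) • y 3 = 0
      rw [this, smul_zero]
  rw [h2, h3, AddSubgroup.relIndex_map_map_of_injective _ _ hm, hΔ.relIndex_range]

/-- Multiplicativity of indices along L ∩ ker → L → image, for the projection to the last block. -/
theorem relIndex_triple_eq_mul (h : triple ≤ L) :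
    triple.relIndex L = (triple ⊓ lastBlock.ker).relIndex (L ⊓ lastBlock.ker) *
      (triple.map lastBlock).relIndex (L.map lastBlock) := by
  have h1 := AddSubgroup.relIndex_inf_mul_relIndex triple (triple ⊔ lastBlock.ker) L
  rw [inf_eq_left.2 (le_sup_left : triple ≤ triple ⊔ lastBlock.ker)] at h1
  rw [← h1]
  congr 1
  · have h2 : (triple ⊔ lastBlock.ker) ⊓ L = (L ⊓ lastBlock.ker) ⊔ triple := by
      rw [sup_comm (L ⊓ _), inf_comm L, sup_inf_assoc_of_le _ h]
    rw [h2, AddSubgroup.relIndex_sup_right, ← AddSubgroup.inf_relIndex_right]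
    conv_rhs => rw [← AddSubgroup.inf_relIndex_right]
    congr 1
    ext x
    simp only [AddSubgroup.mem_inf]
    tauto
  · rw [← AddSubgroup.relIndex_comap, AddSubgroup.comap_map_eq]

/-- The Herbrand quotient computation for `L`. -/
theorem IsDifference.relIndex_map (hΔ : IsDifference Δ) (hL : IsStable L) (hΔL : L.map Δ ≤ L)
    (h0 : triple.relIndex L ≠ 0) :
    (L.map Δ).relIndex (L ⊓ lastBlock.ker) = 3 * (L.map lastBlock).index := by
  have hle : ∀ S : AddSubgroup EisensteinBlocks, S.map Δ ≤ lastBlock.ker := by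
    rintro S _ ⟨x, -, rfl⟩
    exact hΔ.last x
  have hT : triple.map Δ ≤ triple := by
    rintro _ ⟨x, hx, rfl⟩
    obtain ⟨y, rfl⟩ := mem_triple_iff_exists.1 hx
    exact mem_triple_iff_exists.2 ⟨Δ y, map_zsmul Δ 3 y⟩
  -- Write K for the kernel of the last-block projection. The index (L ∩ K : Δ(3Λ)) is computed
  -- through ΔL and through 3Λ ∩ K.
  have e1 := AddSubgroup.relIndex_mul_relIndex (triple.map Δ) (L.map Δ) (L ⊓ lastBlock.ker)
    (AddSubgroup.map_mono hL.triple_le) (le_inf hΔL (hle L))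
  have e2 := AddSubgroup.relIndex_mul_relIndex (triple.map Δ) (triple ⊓ lastBlock.ker)
    (L ⊓ lastBlock.ker) (le_inf hT (hle _)) (inf_le_inf_right _ hL.triple_le)
  -- The kernel of Δ on L consists of vectors supported in the last block, hence lies in 3Λ, so Δ
  -- preserves the index of 3Λ in L.
  have e3 : (triple.map Δ).relIndex (L.map Δ) = triple.relIndex L := by
    rw [← AddSubgroup.relIndex_comap, AddSubgroup.comap_map_eq, ← AddSubgroup.inf_relIndex_right]
    congr 1
    refine le_antisymm ?_ (le_inf le_sup_left hL.triple_le)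
    rintro x ⟨hx, hxL⟩
    obtain ⟨t, ht, n, hn, rfl⟩ := AddSubgroup.mem_sup.1 hx
    refine triple.add_mem ht (hL.single 3 n ?_ (hΔ.apply_eq_zero_iff.1 hn))
    have := L.sub_mem hxL (hL.triple_le ht)
    rwa [add_sub_cancel_left] at this
  have e4 := relIndex_triple_eq_mul hL.triple_le
  have e5 := AddSubgroup.relIndex_mul_index (planeTriple_le_map_lastBlock hL.triple_le)
  rw [planeTriple_index] at e5
  rw [hΔ.map_triple_relIndex, ← e1, e3] at e2
  rw [triple_map_lastBlock] at e4
  set a := (triple ⊓ lastBlock.ker).relIndex (L ⊓ lastBlock.ker)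
  set b := planeTriple.relIndex (L.map lastBlock)
  set c := (L.map lastBlock).index
  set d := (L.map Δ).relIndex (L ⊓ lastBlock.ker)
  rw [e4] at e2 h0
  have ha : a ≠ 0 := left_ne_zero_of_mul h0
  have hb : b ≠ 0 := right_ne_zero_of_mul h0
  -- The two chains give d · a b = a · 27. Together with b c = 9 this yields d = 3 c.
  have h1 : b * d = 27 := by
    apply mul_left_cancel₀ ha
    linarith
  apply mul_left_cancel₀ hb
  linarith

end EisensteinBlocks

/-! ### Upper triangular bases of lattices between 3ℤⁿ and ℤⁿ -/

section Triangular

variable {n : ℕ}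

/-- If an upper triangular matrix maps `c` to a vector vanishing beyond position `i`, then so does
`c` vanish there. -/
theorem Matrix.eq_zero_of_upperTriangular_mulVec {A : Matrix (Fin n) (Fin n) ℤ}
    (hA : ∀ i j, j < i → A i j = 0) (hd : ∀ j, 0 < A j j) {c : Fin n → ℤ} {i : Fin n}
    (h : ∀ j, i < j → A.mulVec c j = 0) : ∀ j, i < j → c j = 0 := by
  by_contra! hc
  obtain ⟨j₀, hj₀⟩ := hc
  classical
  obtain ⟨j, hj, hmax⟩ := Finset.exists_max_image ({j | i < j ∧ c j ≠ 0} : Finset (Fin n)) id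
    ⟨j₀, by simpa using hj₀⟩
  obtain ⟨hij, hcj⟩ : i < j ∧ c j ≠ 0 := by simpa using hj
  have h0 := h j hij
  rw [Matrix.mulVec, dotProduct, Finset.sum_eq_single j] at h0
  · rcases mul_eq_zero.1 h0 with h1 | h1
    · exact (hd j).ne' h1
    · exact hcj h1
  · intro k _ hk
    rcases lt_or_gt_of_ne hk with h1 | h1
    · rw [hA j k h1, zero_mul]
    · have : c k = 0 := by
        by_contra hck
        exact absurd (hmax k (by simpa using ⟨hij.trans h1, hck⟩)) (not_le.2 h1)
      rw [this, mul_zero]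
  · simp

theorem Matrix.upperTriangular_mulVec_apply {A : Matrix (Fin n) (Fin n) ℤ}
    (hA : ∀ i j, j < i → A i j = 0) {c : Fin n → ℤ} {i : Fin n} (h : ∀ j, i < j → c j = 0) :
    A.mulVec c i = A i i * c i := by
  rw [Matrix.mulVec, dotProduct, Finset.sum_eq_single i]
  · intro k _ hk
    rcases lt_or_gt_of_ne hk with h1 | h1
    · rw [hA i k h1, zero_mul]
    · rw [h k h1, mul_zero]
  · simp

/-- For a triangular basis of a lattice between `3 ℤⁿ` and `ℤⁿ`, a diagonal entry is `3`, or it is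
`1` and the lattice has a vector ending at this position with an entry prime to `3`. -/
theorem Matrix.diagonal_dichotomy {L : AddSubgroup (Fin n → ℤ)} (h3 : ∀ x, (3 : ℤ) • x ∈ L)
    {A : Matrix (Fin n) (Fin n) ℤ} (hA : ∀ i j, j < i → A i j = 0) (hd : ∀ j, 0 < A j j)
    (hL : ∀ x, x ∈ L ↔ ∃ c, x = A.mulVec c) (i : Fin n) :
    (A i i = 1 ∧ ∃ x ∈ L, (∀ j, i < j → x j = 0) ∧ ¬ 3 ∣ x i) ∨
      (A i i = 3 ∧ ¬ ∃ x ∈ L, (∀ j, i < j → x j = 0) ∧ ¬ 3 ∣ x i) := by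
  have key : ∀ x ∈ L, (∀ j, i < j → x j = 0) → A i i ∣ x i := by
    intro x hx h
    obtain ⟨c, rfl⟩ := (hL x).1 hx
    have := Matrix.eq_zero_of_upperTriangular_mulVec hA hd h
    exact ⟨c i, Matrix.upperTriangular_mulVec_apply hA this⟩
  -- Three times the i-th unit vector lies in L and ends at position i.
  have h1 : A i i ∣ 3 := by
    have := key _ (h3 (Pi.single i 1)) fun j hj => by simp [Pi.single_eq_of_ne hj.ne']
    simpa using this
  have h2 : A i i = 1 ∨ A i i = 3 := by
    have := Int.le_of_dvd (by norm_num) h1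
    have := hd i
    have h4 : A i i ≠ 2 := by
      intro h; rw [h] at h1; omega
    omega
  rcases h2 with h | h
  · refine Or.inl ⟨h, A.mulVec (Pi.single i 1), (hL _).2 ⟨_, rfl⟩, ?_, ?_⟩
    · intro j hj
      simp [hA j i hj]
    · simp [h]
  · refine Or.inr ⟨h, ?_⟩
    rintro ⟨x, hx, hx0, hx3⟩
    exact hx3 (h ▸ key x hx hx0)

/-- Existence of the Hermite normal form of a lattice between `3 ℤⁿ` and `ℤⁿ`. -/
theorem AddSubgroup.exists_upperTriangular (L : AddSubgroup (Fin n → ℤ))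
    (h3 : ∀ x, (3 : ℤ) • x ∈ L) :
    ∃ A : Matrix (Fin n) (Fin n) ℤ, (∀ i j, j < i → A i j = 0) ∧ (∀ j, 0 < A j j) ∧
      ∀ x, x ∈ L ↔ ∃ c, x = A.mulVec c := by
  -- Column j is a vector of L ending at position j whose last entry generates the ideal of all such
  -- entries; this ideal contains 3, so it is nonzero.
  have hcol : ∀ j : Fin n, ∃ g ∈ L, (∀ i, j < i → g i = 0) ∧ 0 < g j ∧
      ∀ x ∈ L, (∀ i, j < i → x i = 0) → g j ∣ x j := by
    intro j
    let S : AddSubgroup ℤ := (L ⊓ ⨅ i ∈ Set.Ioi j,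
      (Pi.evalAddMonoidHom (fun _ : Fin n => ℤ) i).ker).map (Pi.evalAddMonoidHom _ j)
    have hS : ∀ a, a ∈ S ↔ ∃ x ∈ L, (∀ i, j < i → x i = 0) ∧ x j = a := by
      intro a
      simp only [S, AddSubgroup.mem_map, AddSubgroup.mem_inf, AddSubgroup.mem_iInf,
        AddMonoidHom.mem_ker, Pi.evalAddMonoidHom_apply, Set.mem_Ioi]
      exact exists_congr fun x => by tauto
    obtain ⟨a, ha⟩ := Int.subgroup_cyclic S
    have haS : |a| ∈ S := by
      have : a ∈ S := by rw [ha]; exact AddSubgroup.subset_closure rfl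
      rcases abs_choice a with h | h <;> rw [h]
      · exact this
      · exact S.neg_mem this
    have hdvd : ∀ b ∈ S, |a| ∣ b := by
      intro b hb
      rw [ha, AddSubgroup.mem_closure_singleton] at hb
      obtain ⟨k, rfl⟩ := hb
      rw [abs_dvd]
      exact ⟨k, by rw [smul_eq_mul, mul_comm]⟩
    obtain ⟨g, hg, hg0, hgj⟩ := (hS _).1 haS
    refine ⟨g, hg, hg0, ?_, fun x hx hx0 => hgj ▸ hdvd _ ((hS _).2 ⟨x, hx, hx0, rfl⟩)⟩
    rw [hgj, abs_pos]
    rintro rfl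
    have : (3 : ℤ) ∈ S := (hS _).2 ⟨(3 : ℤ) • Pi.single j 1, h3 _,
      fun i hi => by simp [Pi.single_eq_of_ne hi.ne'], by simp⟩
    have := hdvd _ this
    rw [abs_zero, zero_dvd_iff] at this
    omega
  choose g hgL hg0 hgpos hgdvd using hcol
  let A : Matrix (Fin n) (Fin n) ℤ := Matrix.of fun i j => g j i
  have hAc : ∀ c, A.mulVec c = ∑ j, c j • g j := by
    intro c
    ext i
    simp [Matrix.mulVec, dotProduct, A, mul_comm]
  refine ⟨A, fun i j h => hg0 j i h, hgpos, fun x => ⟨?_, ?_⟩⟩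
  -- Induction on the number of possibly nonzero leading coordinates, each step removing the last of
  -- them by a column.
  · have key : ∀ k : ℕ, ∀ x ∈ L, (∀ i : Fin n, k ≤ i → x i = 0) → ∃ c, x = A.mulVec c := by
      intro k
      induction k with
      | zero =>
        intro x _ h
        refine ⟨0, ?_⟩
        rw [Matrix.mulVec_zero]
        exact funext fun i => h i (Nat.zero_le _)
      | succ k ih =>
        intro x hx h
        by_cases hk : k < n
        · obtain ⟨t, ht⟩ := hgdvd ⟨k, hk⟩ x hx fun i hi => h i hi
          obtain ⟨c, hc⟩ := ih (x - t • g ⟨k, hk⟩) (L.sub_mem hx (L.zsmul_mem (hgL _) _)) (by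
            intro i hi
            rcases Nat.eq_or_lt_of_le hi with h' | h'
            · have : i = ⟨k, hk⟩ := Fin.ext h'.symm
              subst this
              rw [Pi.sub_apply, Pi.smul_apply, ht, smul_eq_mul]
              ring
            · rw [Pi.sub_apply, Pi.smul_apply, h i h', hg0 ⟨k, hk⟩ i h']
              simp)
          refine ⟨c + Pi.single ⟨k, hk⟩ t, ?_⟩
          rw [Matrix.mulVec_add, ← hc]
          ext i
          simp [A, mul_comm]
        · exact ih x hx fun i hi => absurd i.2 (by omega)
    intro hx
    exact key n x hx fun i hi => absurd i.2 (by omega)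
  · rintro ⟨c, rfl⟩
    rw [hAc]
    exact L.sum_mem fun j _ => L.zsmul_mem (hgL j) _

end Triangular

/-! ### Cyclic modules over the Eisenstein integers -/

/-- Rounding both coordinates to nearest integers leaves a remainder in ℤ[ζ] of norm at most 3/4 of
the square of the divisor N; this is what makes the Euclidean descent work. -/
theorem abs_sq_sub_mul_add_sq_le {c d N : ℤ} (hc : 2 * |c| ≤ |N|) (hd : 2 * |d| ≤ |N|) :
    4 * |c ^ 2 - c * d + d ^ 2| ≤ 3 * |N| ^ 2 := by
  have hc' : (2 * |c|) ^ 2 ≤ |N| ^ 2 := pow_le_pow_left₀ (by positivity) hc 2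
  have hd' : (2 * |d|) ^ 2 ≤ |N| ^ 2 := pow_le_pow_left₀ (by positivity) hd 2
  rw [mul_pow, sq_abs c] at hc'
  rw [mul_pow, sq_abs d] at hd'
  have h0 : 0 ≤ c ^ 2 - c * d + d ^ 2 := by nlinarith [sq_nonneg (c - d), sq_nonneg c, sq_nonneg d]
  rw [abs_of_nonneg h0]
  linarith [sq_nonneg (c + d)]

theorem abs_lt_of_mul_eq {N g E : ℤ} (hN : N ≠ 0) (h : |N| * |g| = |E|)
    (hE : 4 * |E| ≤ 3 * |N| ^ 2) : |g| < |N| := by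
  have hpos : 0 < |N| := abs_pos.2 hN
  by_contra! hcon
  have := mul_le_mul_of_nonneg_left hcon hpos.le
  nlinarith

/-- The positive definite (up to sign) binary quadratic form of discriminant `-3` attached to an
integer matrix of order `3` represents a unit; equivalently, `ℤ²` is a cyclic module over the
Eisenstein integers. -/
theorem exists_generator_of_order_three {p q r s : ℤ} (htr : p + s = -1)
    (hdet : p * s - q * r = 1) :
    ∃ x y : ℤ, ∀ u v : ℤ, ∃ m n : ℤ,
      u = m * x + n * (p * x + q * y) ∧ v = m * y + n * (r * x + s * y) := by
  -- With M the given matrix, f(w) is the determinant of w and M w, and f((c + d M) w) = (c² - c d +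
  -- d²) f(w). A vector w generates ℤ² over ℤ[M] exactly if f(w) = ±1; one of least nonzero |f| is
  -- shown to generate.
  let f : ℤ → ℤ → ℤ := fun x y => x * (r * x + s * y) - y * (p * x + q * y)
  have hf : ∀ x y, f x y = x * (r * x + s * y) - y * (p * x + q * y) := fun x y => rfl
  obtain rfl : s = -1 - p := by linarith
  have hr : r ≠ 0 := by
    rintro rfl
    nlinarith [sq_nonneg (2 * p + 1)]
  have hf0 : ∀ x y, f x y = 0 → x = 0 ∧ y = 0 := by
    intro x y h
    rw [hf] at h
    -- Completing the square in 4 r f(x, y): the discriminant -3 makes the form anisotropic.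
    have h1 : (2 * r * x - (1 + 2 * p) * y) ^ 2 + 3 * y ^ 2 = 0 := by
      linear_combination 4 * r * h - 4 * y ^ 2 * hdet
    have hy : y = 0 := by
      have : y ^ 2 = 0 := by nlinarith [sq_nonneg (2 * r * x - (1 + 2 * p) * y), sq_nonneg y]
      exact pow_eq_zero_iff (two_ne_zero) |>.1 this
    subst hy
    simp only [mul_zero, sub_zero, ne_eq, OfNat.ofNat_ne_zero, not_false_eq_true, zero_pow,
      add_zero] at h1
    have := pow_eq_zero_iff (two_ne_zero) |>.1 h1
    refine ⟨?_, rfl⟩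
    rcases mul_eq_zero.1 this with h2 | h2
    · exact absurd h2 (by simpa using hr)
    · exact h2
  have hne : ∃ k : ℕ, ∃ x y, (f x y).natAbs = k ∧ k ≠ 0 :=
    ⟨_, 1, 0, rfl, by simpa [hf] using hr⟩
  classical
  obtain ⟨x, y, hxy, hk0⟩ := Nat.find_spec hne
  set k := Nat.find hne with hk
  have hmin : ∀ x' y', (f x' y').natAbs < k → x' = 0 ∧ y' = 0 := by
    intro x' y' h
    by_contra hc
    exact Nat.find_min hne h ⟨x', y', rfl, fun h0 => hc (hf0 _ _ (Int.natAbs_eq_zero.1 h0))⟩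
  refine ⟨x, y, fun u v => ?_⟩
  set N := f x y with hN
  have hN0 : N ≠ 0 := fun h => hk0 (by rw [← hxy, h]; rfl)
  have hNabs : |N| = (k : ℤ) := by rw [Int.abs_eq_natAbs, hxy]
  set X := p * x + q * y with hX
  set Y := r * x + (-1 - p) * y with hY
  have hNd : N = x * Y - y * X := rfl
  -- By Cramer's rule N (u, v) = a (x, y) + b (X, Y). Rounding a/N and b/N is division with
  -- remainder in ℤ[M].
  set a := u * Y - v * X with ha
  set b := x * v - y * u with hb
  have round : ∀ a : ℤ, ∃ m c : ℤ, a = N * m + c ∧ 2 * |c| ≤ |N| := by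
    intro a
    refine ⟨round ((a : ℚ) / N), a - N * round ((a : ℚ) / N), by ring, ?_⟩
    have h1 := abs_sub_round ((a : ℚ) / N)
    have hNq : (0 : ℚ) < |(N : ℚ)| := abs_pos.2 (by exact_mod_cast hN0)
    have h2 : |((a : ℚ) - N * round ((a : ℚ) / N))| ≤ 1 / 2 * |(N : ℚ)| := by
      have : ((a : ℚ) - N * round ((a : ℚ) / N)) = ((a : ℚ) / N - round ((a : ℚ) / N)) * N := by
        have : (N : ℚ) ≠ 0 := by exact_mod_cast hN0
        field_simp
      rw [this, abs_mul]
      gcongr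
    have h3 : 2 * |((a : ℚ) - N * round ((a : ℚ) / N))| ≤ |(N : ℚ)| := by linarith
    exact_mod_cast h3
  obtain ⟨m, c, hac, hc⟩ := round a
  obtain ⟨n, d, hbd, hd⟩ := round b
  refine ⟨m, n, ?_⟩
  have e1 : N * (u - m * x - n * X) = c * x + d * X := by
    linear_combination (-u) * (by rfl : N = N) + u * hNd + x * hac + X * hbd - x * ha - X * hb
  have e2 : N * (v - m * y - n * Y) = c * y + d * Y := by
    linear_combination v * hNd + y * hac + Y * hbd - y * ha - Y * hb
  have e3 : N ^ 2 * f (u - m * x - n * X) (v - m * y - n * Y) = N * (c ^ 2 - c * d + d ^ 2) := by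
    have h1 : N ^ 2 * f (u - m * x - n * X) (v - m * y - n * Y) =
        f (N * (u - m * x - n * X)) (N * (v - m * y - n * Y)) := by
      simp only [hf]; ring
    rw [h1, e1, e2]
    have hYX : r * X + (-1 - p) * Y = -y - Y ∧ p * X + q * Y = - x - X := by
      constructor
      · rw [hX, hY]; linear_combination -y * hdet
      · rw [hX, hY]; linear_combination -x * hdet
    have h4 : ∀ t w t' w' : ℤ, f (t + t') (w + w') = f t w + f t' w' +
        (t * (r * t' + (-1 - p) * w') + t' * (r * t + (-1 - p) * w)
          - w * (p * t' + q * w') - w' * (p * t + q * w)) := by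
      intro t w t' w'
      simp only [hf]; ring
    rw [hf]
    have g1 : r * (c * x + d * X) + (-1 - p) * (c * y + d * Y) = c * Y + d * (-y - Y) := by
      rw [← hYX.1, hY]; ring
    have g2 : p * (c * x + d * X) + q * (c * y + d * Y) = c * X + d * (-x - X) := by
      rw [← hYX.2, hX]; ring
    rw [g1, g2, hNd]
    ring
  -- The remainder has |f| at most 3/4 |N|, so it vanishes by minimality of N.
  have e4 : N * f (u - m * x - n * X) (v - m * y - n * Y) = c ^ 2 - c * d + d ^ 2 := by
    apply mul_left_cancel₀ hN0
    linear_combination e3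
  have e5 : (f (u - m * x - n * X) (v - m * y - n * Y)).natAbs < k := by
    have h1 : |N| * |f (u - m * x - n * X) (v - m * y - n * Y)| = |c ^ 2 - c * d + d ^ 2| := by
      rw [← abs_mul, e4]
    have h3 := abs_lt_of_mul_eq hN0 h1 (abs_sq_sub_mul_add_sq_le hc hd)
    rw [hNabs, Int.abs_eq_natAbs] at h3
    exact_mod_cast h3
  obtain ⟨h1, h2⟩ := hmin _ _ e5
  exact ⟨by linarith, by linarith⟩

/-! ### The Galois group and the four cubic subfields -/

/-- Generators of the four subgroups of order three in an elementary abelian group of order nine. -/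
def fourGenerators {A : Type*} [CommGroup A] (t y : A) : Fin 4 → A := ![y, y * t, y * t ^ 2, t]

theorem exists_fourGenerators_aux (t : Multiplicative (ZMod 3 × ZMod 3)) (ht : t ≠ 1) :
    ∃ y, (∀ i, fourGenerators t y i ≠ 1) ∧
    (∀ i j, i ≠ j → fourGenerators t y i ≠ fourGenerators t y j ∧
      fourGenerators t y i ≠ fourGenerators t y j ^ 2) ∧
    ∀ g, g ≠ 1 → ∃ i, g = fourGenerators t y i ∨ g = fourGenerators t y i ^ 2 := by
  revert t
  unfold fourGenerators
  set_option synthInstance.maxHeartbeats 400000 in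
  set_option synthInstance.maxSize 100000 in
  set_option maxRecDepth 100000 in
  decide

theorem exists_fourGenerators {G : Type*} [CommGroup G]
    (e : G ≃* Multiplicative (ZMod 3) × Multiplicative (ZMod 3)) (t : G) (ht : t ≠ 1) :
    ∃ τ : Fin 4 → G, τ 3 = t ∧ (∀ i, τ i ≠ 1) ∧ (∀ i j, i ≠ j → τ i ≠ τ j ∧ τ i ≠ τ j ^ 2) ∧
      ∀ g, g ≠ 1 → ∃ i, g = τ i ∨ g = τ i ^ 2 := by
  let f : G ≃* Multiplicative (ZMod 3 × ZMod 3) := e.trans (MulEquiv.prodMultiplicative _ _).symm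
  obtain ⟨y, h1, h2, h3⟩ := exists_fourGenerators_aux (f t) (by simpa using ht)
  have hf : ∀ i, f.symm (fourGenerators (f t) y i) = fourGenerators t (f.symm y) i := by
    intro i
    fin_cases i <;> simp [fourGenerators]
  have hf' : ∀ i, f (fourGenerators t (f.symm y) i) = fourGenerators (f t) y i := by
    intro i
    rw [← hf, f.apply_symm_apply]
  refine ⟨fourGenerators t (f.symm y), rfl, fun i h => h1 i ?_, fun i j hij => ⟨fun h => ?_,
    fun h => ?_⟩, fun g hg => ?_⟩
  · rw [← hf', h, map_one]
  · exact (h2 i j hij).1 (by rw [← hf', ← hf', h])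
  · exact (h2 i j hij).2 (by rw [← hf', ← hf', h, map_pow])
  · obtain ⟨i, hi⟩ := h3 (f g) (by simpa using hg)
    refine ⟨i, ?_⟩
    rw [← hf', ← map_pow, f.injective.eq_iff, f.injective.eq_iff] at hi
    exact hi

section Frame

variable {B : Type*} [Field B] [NumberField B]

/-- The four cubic subfields of a bicyclic bicubic field `B` together with generators of the
Galois groups of `B` over them. -/
structure IsCubicFrame (κ : Fin 4 → IntermediateField ℚ B) (τ : Fin 4 → (B ≃ₐ[ℚ] B)) : Prop where
  comm : ∀ g h : B ≃ₐ[ℚ] B, g * h = h * g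
  cube : ∀ g : B ≃ₐ[ℚ] B, g ^ 3 = 1
  card : Nat.card (B ≃ₐ[ℚ] B) = 9
  fixing : ∀ i, (κ i).fixingSubgroup = Subgroup.zpowers (τ i)
  ne_one : ∀ i, τ i ≠ 1
  ne : ∀ i j, i ≠ j → τ i ≠ τ j ∧ τ i ≠ τ j ^ 2
  cover : ∀ g, g ≠ 1 → ∃ i, g = τ i ∨ g = τ i ^ 2
  finrank_eq : ∀ F : IntermediateField ℚ B, Module.finrank ℚ F = 3 ↔ ∃ i, κ i = F

theorem mem_zpowers_of_cube {G : Type*} [Group G] {g h : G} (hg : g ^ 3 = 1) :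
    h ∈ Subgroup.zpowers g ↔ h = 1 ∨ h = g ∨ h = g ^ 2 := by
  constructor
  · rintro ⟨m, rfl⟩
    have h1 : g ^ m = g ^ (m % 3) := by
      conv_lhs => rw [← Int.emod_add_mul_ediv m 3, zpow_add, zpow_mul]
      have : g ^ (3 : ℤ) = 1 := by exact_mod_cast hg
      rw [this, one_zpow, mul_one]
    have h2 : m % 3 = 0 ∨ m % 3 = 1 ∨ m % 3 = 2 := by omega
    simp only [h1]
    rcases h2 with h | h | h <;> rw [h]
    · left; simp
    · right; left; simp
    · right; right; norm_cast
  · rintro (rfl | rfl | rfl)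
    · exact Subgroup.one_mem _
    · exact Subgroup.mem_zpowers _
    · exact Subgroup.pow_mem _ (Subgroup.mem_zpowers _) 2

theorem card_zpowers_of_cube {G : Type*} [Group G] {g : G} (hg : g ^ 3 = 1) (h1 : g ≠ 1) :
    Nat.card (Subgroup.zpowers g) = 3 := by
  rw [Nat.card_zpowers]
  exact orderOf_eq_prime hg h1

variable [IsGalois ℚ B]

/-- The Galois correspondence matches cubic subfields with subgroups of order 3; a generator of the
subgroup belonging to k is completed to generators of all four. -/
theorem exists_isCubicFrame
    (hB : Nonempty ((B ≃ₐ[ℚ] B) ≃* Multiplicative (ZMod 3) × Multiplicative (ZMod 3)))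
    (k : IntermediateField ℚ B) (hk : Module.finrank ℚ k = 3) :
    ∃ κ τ, IsCubicFrame κ τ ∧ κ 3 = k := by
  obtain ⟨e⟩ := hB
  have comm : ∀ g h : B ≃ₐ[ℚ] B, g * h = h * g := fun g h =>
    e.injective (by rw [map_mul, map_mul, mul_comm])
  have cube : ∀ g : B ≃ₐ[ℚ] B, g ^ 3 = 1 := fun g => e.injective (by
    rw [map_pow, map_one]
    generalize e g = x
    revert x
    decide)
  have card : Nat.card (B ≃ₐ[ℚ] B) = 9 := by
    rw [Nat.card_congr e.toEquiv, Nat.card_prod]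
    simp
  have hcard : ∀ F : IntermediateField ℚ B,
      Module.finrank ℚ F = 3 ↔ Nat.card F.fixingSubgroup = 3 := by
    intro F
    have h1 := Module.finrank_mul_finrank ℚ F B
    rw [← IsGalois.card_aut_eq_finrank ℚ B, card] at h1
    rw [IsGalois.card_fixingSubgroup_eq_finrank]
    constructor
    · intro h; rw [h] at h1; omega
    · intro h; rw [h] at h1; omega
  have hgen : ∀ H : Subgroup (B ≃ₐ[ℚ] B), Nat.card H = 3 → ∃ t, t ≠ 1 ∧ H = Subgroup.zpowers t := by
    intro H hH
    have : Nontrivial H := Finite.one_lt_card_iff_nontrivial.1 (by omega)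
    obtain ⟨t, ht⟩ := exists_ne (1 : H)
    have ht1 : (t : B ≃ₐ[ℚ] B) ≠ 1 := by simpa using ht
    refine ⟨t, ht1, ?_⟩
    symm
    apply Subgroup.eq_of_le_of_card_ge
    · rw [Subgroup.zpowers_le]; exact t.2
    · rw [hH, card_zpowers_of_cube (cube _) ht1]
  obtain ⟨t, ht, hkt⟩ := hgen _ ((hcard k).1 hk)
  let _ : CommGroup (B ≃ₐ[ℚ] B) := { mul_comm := comm }
  obtain ⟨τ, hτ3, hτ1, hτne, hτc⟩ := exists_fourGenerators e t ht
  have hfix : ∀ i, (IntermediateField.fixedField (Subgroup.zpowers (τ i))).fixingSubgroup =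
      Subgroup.zpowers (τ i) := fun i => IntermediateField.fixingSubgroup_fixedField _
  refine ⟨fun i => IntermediateField.fixedField (Subgroup.zpowers (τ i)), τ,
    ⟨comm, cube, card, hfix, hτ1, hτne, hτc, fun F => ?_⟩, ?_⟩
  · constructor
    · intro hF
      obtain ⟨g, hg, hFg⟩ := hgen _ ((hcard F).1 hF)
      obtain ⟨i, hi⟩ := hτc g hg
      refine ⟨i, ?_⟩
      rw [← IsGalois.fixedField_fixingSubgroup F, hFg]
      congr 1
      symm
      apply Subgroup.eq_of_le_of_card_ge
      · rw [Subgroup.zpowers_le, mem_zpowers_of_cube (cube _)]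
        right; exact hi
      · rw [card_zpowers_of_cube (cube _) hg, card_zpowers_of_cube (cube _) (hτ1 i)]
    · rintro ⟨i, rfl⟩
      rw [hcard, hfix, card_zpowers_of_cube (cube _) (hτ1 i)]
  · simp only [hτ3, ← hkt]
    exact IsGalois.fixedField_fixingSubgroup k

namespace IsCubicFrame

variable {κ : Fin 4 → IntermediateField ℚ B} {τ : Fin 4 → (B ≃ₐ[ℚ] B)} (h : IsCubicFrame κ τ)
include h

omit [IsGalois ℚ B] in
theorem perm (π : Equiv.Perm (Fin 4)) : IsCubicFrame (κ ∘ π) (τ ∘ π) where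
  comm := h.comm
  cube := h.cube
  card := h.card
  fixing i := h.fixing (π i)
  ne_one i := h.ne_one (π i)
  ne i j hij := h.ne _ _ (π.injective.ne hij)
  cover g hg := by
    obtain ⟨i, hi⟩ := h.cover g hg
    exact ⟨π.symm i, by simpa using hi⟩
  finrank_eq F := by
    rw [h.finrank_eq]
    exact ⟨fun ⟨i, hi⟩ => ⟨π.symm i, by simpa using hi⟩, fun ⟨i, hi⟩ => ⟨π i, hi⟩⟩

theorem mem_iff {i : Fin 4} {x : B} : x ∈ κ i ↔ τ i x = x := by
  rw [← IsGalois.fixedField_fixingSubgroup (κ i), h.fixing, IntermediateField.mem_fixedField_iff]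
  constructor
  · intro hx; exact hx _ (Subgroup.mem_zpowers _)
  · intro hx f hf
    rw [mem_zpowers_of_cube (h.cube _)] at hf
    rcases hf with rfl | rfl | rfl
    · rfl
    · exact hx
    · rw [pow_two, AlgEquiv.mul_apply, hx, hx]

omit [IsGalois ℚ B] in
theorem notMem_zpowers {i j : Fin 4} (hij : i ≠ j) : τ i ∉ Subgroup.zpowers (τ j) := by
  rw [mem_zpowers_of_cube (h.cube _)]
  rintro (h1 | h1 | h1)
  · exact h.ne_one i h1
  · exact (h.ne i j hij).1 h1
  · exact (h.ne i j hij).2 h1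

theorem injective : Function.Injective κ := by
  intro i j hij
  by_contra hne
  apply h.notMem_zpowers hne
  rw [← h.fixing, ← hij, h.fixing]
  exact Subgroup.mem_zpowers _

theorem isOrdering : IsOrdering (κ 3) κ := by
  refine ⟨h.injective, ?_, rfl⟩
  ext F
  rw [Set.mem_ofPred_eq, h.finrank_eq]
  rfl

theorem finrank (i : Fin 4) : Module.finrank ℚ (κ i) = 3 := (h.finrank_eq _).2 ⟨i, rfl⟩

theorem finrank_top : Module.finrank ℚ B = 9 := by
  rw [← IsGalois.card_aut_eq_finrank, h.card]

/-- Modulo the subgroup fixing the cubic field `κ j`, every automorphism is a power of any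
automorphism that acts nontrivially on `κ j`. -/
theorem exists_coset {j : Fin 4} {σ : B ≃ₐ[ℚ] B} (hσ : σ ∉ Subgroup.zpowers (τ j))
    (g : B ≃ₐ[ℚ] B) : ∃ z ∈ Subgroup.zpowers (τ j), g = z ∨ g = σ * z ∨ g = σ ^ 2 * z := by
  let _ : CommGroup (B ≃ₐ[ℚ] B) := { mul_comm := h.comm }
  let Z := Subgroup.zpowers (τ j)
  have hcard : Nat.card ((B ≃ₐ[ℚ] B) ⧸ Z) = 3 := by
    have h1 := Subgroup.card_eq_card_quotient_mul_card_subgroup Z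
    rw [h.card, card_zpowers_of_cube (h.cube _) (h.ne_one j)] at h1
    omega
  have : Fact (Nat.Prime 3) := ⟨Nat.prime_three⟩
  have hne : (σ : (B ≃ₐ[ℚ] B) ⧸ Z) ≠ 1 := by
    rwa [ne_eq, QuotientGroup.eq_one_iff]
  have hmem := mem_zpowers_of_prime_card (g' := (g : (B ≃ₐ[ℚ] B) ⧸ Z)) hcard hne
  rw [mem_zpowers_of_cube (by rw [← QuotientGroup.mk_pow, h.cube]; rfl)] at hmem
  rcases hmem with h1 | h1 | h1
  · exact ⟨g, (QuotientGroup.eq_one_iff g).1 h1, Or.inl rfl⟩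
  · exact ⟨σ⁻¹ * g, QuotientGroup.eq.1 h1.symm, Or.inr (Or.inl (by simp))⟩
  · rw [← QuotientGroup.mk_pow] at h1
    exact ⟨(σ ^ 2)⁻¹ * g, QuotientGroup.eq.1 h1.symm, Or.inr (Or.inr (by simp))⟩

end IsCubicFrame

end Frame

/-! ### Conjugates and relative norms of units -/

section ConjHom

variable {B : Type*} [Field B] [NumberField B]

/-- Conjugation of units as a homomorphism. -/
noncomputable def conjHom (σ : B ≃ₐ[ℚ] B) : (𝓞 B)ˣ →* (𝓞 B)ˣ :=
  Units.map (RingOfIntegers.mapRingEquiv (σ : B ≃+* B)).toMonoidHom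

@[simp] theorem coe_conjHom (σ : B ≃ₐ[ℚ] B) (u : (𝓞 B)ˣ) :
    (conjHom σ u : B) = σ (u : B) := rfl

theorem units_ext {u v : (𝓞 B)ˣ} (h : (u : B) = v) : u = v :=
  NumberField.Units.coe_injective B h

theorem conjHom_mul (σ ρ : B ≃ₐ[ℚ] B) (u : (𝓞 B)ˣ) :
    conjHom (σ * ρ) u = conjHom σ (conjHom ρ u) := rfl

@[simp] theorem conjHom_one (u : (𝓞 B)ˣ) : conjHom 1 u = u := units_ext rfl

@[simp] theorem conjHom_neg (σ : B ≃ₐ[ℚ] B) (u : (𝓞 B)ˣ) : conjHom σ (-u) = -conjHom σ u :=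
  units_ext (by
    rw [coe_conjHom, Units.val_neg, Units.val_neg, map_neg, map_neg, map_neg, coe_conjHom])

theorem mem_unitsOfSubfield {k : IntermediateField ℚ B} {u : (𝓞 B)ˣ} :
    u ∈ unitsOfSubfield k ↔ (u : B) ∈ k := by
  constructor
  · rintro ⟨v, rfl⟩
    exact ((v : 𝓞 k) : k).2
  · intro hu
    have hmk : ∀ w : (𝓞 B)ˣ, (w : B) ∈ k → ∃ v : 𝓞 k, algebraMap (𝓞 k) (𝓞 B) v = w := by
      intro w hw
      have hint : IsIntegral ℤ (⟨(w : B), hw⟩ : k) := by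
        have := (w : 𝓞 B).isIntegral_coe
        rw [← isIntegral_algebraMap_iff (A := k) (B := B) (algebraMap k B).injective]
        exact this
      exact ⟨⟨_, hint⟩, RingOfIntegers.ext rfl⟩
    have hu' : ((u⁻¹ : (𝓞 B)ˣ) : B) ∈ k := by
      have : ((u⁻¹ : (𝓞 B)ˣ) : B) = (u : B)⁻¹ := by
        exact eq_inv_of_mul_eq_one_left (by
        rw [← NumberField.Units.coe_mul, inv_mul_cancel, NumberField.Units.coe_one])
      rw [this]
      exact k.inv_mem hu
    obtain ⟨v, hv⟩ := hmk u hu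
    obtain ⟨w, hw⟩ := hmk u⁻¹ hu'
    have hinj : Function.Injective (algebraMap (𝓞 k) (𝓞 B)) :=
      FaithfulSMul.algebraMap_injective _ _
    refine ⟨⟨v, w, hinj ?_, hinj ?_⟩, Units.ext hv⟩
    · rw [map_mul, hv, hw, map_one, Units.mul_inv]
    · rw [map_mul, hv, hw, map_one, Units.inv_mul]

theorem neg_one_mem_unitsOfSubfield (k : IntermediateField ℚ B) : -1 ∈ unitsOfSubfield k := by
  rw [mem_unitsOfSubfield]
  rw [NumberField.Units.coe_neg_one]
  exact k.neg_mem k.one_mem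

theorem neg_one_ne_one_units : (-1 : (𝓞 B)ˣ) ≠ 1 := by
  intro h
  have : ((-1 : (𝓞 B)ˣ) : B) = ((1 : (𝓞 B)ˣ) : B) := by rw [h]
  rw [NumberField.Units.coe_neg_one, NumberField.Units.coe_one] at this
  norm_num at this

/-- A unit is trivial up to sign. -/
def IsSign (u : (𝓞 B)ˣ) : Prop := u = 1 ∨ u = -1

theorem IsSign.mul {u v : (𝓞 B)ˣ} (hu : IsSign u) (hv : IsSign v) : IsSign (u * v) := by
  rcases hu with rfl | rfl <;> rcases hv with rfl | rfl <;> simp [IsSign]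

theorem IsSign.inv {u : (𝓞 B)ˣ} (hu : IsSign u) : IsSign u⁻¹ := by
  rcases hu with rfl | rfl <;> simp [IsSign]

theorem isSign_one : IsSign (1 : (𝓞 B)ˣ) := Or.inl rfl

theorem isSign_neg_one : IsSign (-1 : (𝓞 B)ˣ) := Or.inr rfl

/-- In odd degree the only roots of unity are ±1. -/
theorem isSign_of_pow_eq_one (hodd : Odd (Module.finrank ℚ B)) {u : (𝓞 B)ˣ} {n : ℕ} (hn : n ≠ 0)
    (h : IsSign (u ^ n)) : IsSign u := by
  have h2 : u ^ (2 * n) = 1 := by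
    rw [mul_comm, pow_mul]
    rcases h with h | h <;> rw [h] <;> simp
  have hmem : u ∈ NumberField.Units.torsion B := by
    rw [NumberField.Units.torsion, CommGroup.mem_torsion, isOfFinOrder_iff_pow_eq_one]
    exact ⟨2 * n, by omega, h2⟩
  exact NumberField.Units.torsion_eq_one_or_neg_one_of_odd_finrank hodd ⟨u, hmem⟩

theorem isSign_of_rational [IsGalois ℚ B] {u : (𝓞 B)ˣ} (h : ∀ g, conjHom g u = u) : IsSign u := by
  have key : ∀ w : (𝓞 B)ˣ, (∀ g, conjHom g w = w) → ∃ n : ℤ, (w : B) = n := by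
    intro w hw
    have h1 : (w : B) ∈ (⊥ : IntermediateField ℚ B) := by
      rw [IsGalois.mem_bot_iff_fixed]
      intro g
      rw [← coe_conjHom, hw]
    obtain ⟨q, hq⟩ := IntermediateField.mem_bot.1 h1
    have h2 : IsIntegral ℤ q := by
      rw [← isIntegral_algebraMap_iff (A := ℚ) (B := B) (algebraMap ℚ B).injective, hq]
      exact (w : 𝓞 B).isIntegral_coe
    obtain ⟨n, hn⟩ := IsIntegrallyClosed.isIntegral_iff.1 h2
    refine ⟨n, ?_⟩
    rw [← hq, ← hn]
    simp
  obtain ⟨n, hn⟩ := key u h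
  obtain ⟨m, hm⟩ := key u⁻¹ fun g => by rw [map_inv, h]
  have h1 : n * m = 1 := by
    have : (u : B) * ((u⁻¹ : (𝓞 B)ˣ) : B) = 1 := by
      rw [← NumberField.Units.coe_mul, mul_inv_cancel, NumberField.Units.coe_one]
    rw [hn, hm] at this
    exact_mod_cast this
  rcases Int.eq_one_or_neg_one_of_mul_eq_one h1 with rfl | rfl
  · left; apply units_ext; rw [hn]; simp
  · right; apply units_ext; rw [hn, NumberField.Units.coe_neg_one]; simp

end ConjHom

namespace IsCubicFrame

variable {B : Type*} [Field B] [NumberField B] [IsGalois ℚ B]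
variable {κ : Fin 4 → IntermediateField ℚ B} {τ : Fin 4 → (B ≃ₐ[ℚ] B)} (h : IsCubicFrame κ τ)
include h

theorem odd_finrank : Odd (Module.finrank ℚ B) := by rw [h.finrank_top]; decide

theorem conjHom_comm (g g' : B ≃ₐ[ℚ] B) (u : (𝓞 B)ˣ) :
    conjHom g (conjHom g' u) = conjHom g' (conjHom g u) := by
  rw [← conjHom_mul, h.comm, conjHom_mul]

theorem conjHom_cube (g : B ≃ₐ[ℚ] B) (u : (𝓞 B)ˣ) :
    conjHom g (conjHom g (conjHom g u)) = u := by
  rw [← conjHom_mul, ← conjHom_mul, ← pow_three', h.cube, conjHom_one]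

theorem mem_units_iff {i : Fin 4} {u : (𝓞 B)ˣ} :
    u ∈ unitsOfSubfield (κ i) ↔ conjHom (τ i) u = u := by
  rw [mem_unitsOfSubfield, h.mem_iff]
  exact ⟨fun h => units_ext h, fun h => by rw [← coe_conjHom, h]⟩

omit [IsGalois ℚ B] h in
/-- The product `u · g u · g² u`. -/
noncomputable def normHom (g : B ≃ₐ[ℚ] B) : (𝓞 B)ˣ →* (𝓞 B)ˣ where
  toFun u := u * conjHom g u * conjHom g (conjHom g u)
  map_one' := by simp
  map_mul' u v := by
    simp only [map_mul]
    rw [mul_mul_mul_comm u v, mul_mul_mul_comm]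

omit [IsGalois ℚ B] h in
theorem normHom_apply (g : B ≃ₐ[ℚ] B) (u : (𝓞 B)ˣ) :
    normHom g u = u * conjHom g u * conjHom g (conjHom g u) := rfl

theorem conjHom_normHom_self (g : B ≃ₐ[ℚ] B) (u : (𝓞 B)ˣ) :
    conjHom g (normHom g u) = normHom g u := by
  rw [normHom_apply, map_mul, map_mul, h.conjHom_cube]
  rw [mul_comm, mul_assoc]

theorem conjHom_normHom (g g' : B ≃ₐ[ℚ] B) (u : (𝓞 B)ˣ) :
    conjHom g (normHom g' u) = normHom g' (conjHom g u) := by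
  simp only [normHom_apply, map_mul, h.conjHom_comm g g']

omit [IsGalois ℚ B] h in
@[simp] theorem normHom_neg_one (g : B ≃ₐ[ℚ] B) : normHom g (-1) = -1 := by
  rw [normHom_apply]; simp

theorem normHom_mem (i : Fin 4) (u : (𝓞 B)ˣ) : normHom (τ i) u ∈ unitsOfSubfield (κ i) :=
  h.mem_units_iff.2 (h.conjHom_normHom_self _ _)

theorem normHom_of_mem {i : Fin 4} {u : (𝓞 B)ˣ} (hu : u ∈ unitsOfSubfield (κ i)) :
    normHom (τ i) u = u ^ 3 := by
  rw [h.mem_units_iff] at hu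
  rw [normHom_apply, hu, hu, pow_three']

theorem conjHom_zpowers {i : Fin 4} {u : (𝓞 B)ˣ} (hu : u ∈ unitsOfSubfield (κ i)) {z : B ≃ₐ[ℚ] B}
    (hz : z ∈ Subgroup.zpowers (τ i)) : conjHom z u = u := by
  rw [h.mem_units_iff] at hu
  rw [mem_zpowers_of_cube (h.cube _)] at hz
  rcases hz with rfl | rfl | rfl
  · simp
  · exact hu
  · rw [pow_two, conjHom_mul, hu, hu]

/-- The norm of a unit of a cubic field, computed by an automorphism acting nontrivially on it. -/
theorem isSign_normHom_of_mem {i : Fin 4} {σ : B ≃ₐ[ℚ] B} (hσ : σ ∉ Subgroup.zpowers (τ i))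
    {u : (𝓞 B)ˣ} (hu : u ∈ unitsOfSubfield (κ i)) : IsSign (normHom σ u) := by
  refine isSign_of_rational fun g => ?_
  -- The norm is fixed by σ, and by Gal(B/k_i) because u is; together these generate the whole
  -- Galois group.
  obtain ⟨z, hz, hg⟩ := h.exists_coset hσ g
  have h1 : conjHom z (normHom σ u) = normHom σ u := by
    rw [h.conjHom_normHom, h.conjHom_zpowers hu hz]
  rcases hg with rfl | rfl | rfl
  · exact h1
  · rw [conjHom_mul, h1, h.conjHom_normHom_self]
  · rw [conjHom_mul, h1, pow_two, conjHom_mul, h.conjHom_normHom_self, h.conjHom_normHom_self]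

/-- The basic relation between a unit and its norms to the cubic subfields. -/
theorem isSign_cube_div (u : (𝓞 B)ˣ) : IsSign (u ^ 3 / ∏ i, normHom (τ i) u) := by
  classical
  have hsign : IsSign (∏ g : B ≃ₐ[ℚ] B, conjHom g u) := by
    refine isSign_of_rational fun g => ?_
    rw [map_prod]
    exact Fintype.prod_equiv (Equiv.mulLeft g) _ _ fun x => (conjHom_mul g x u).symm
  -- The identity together with the τ_i and τ_i² lists the nine automorphisms once each. In ∏ N_i(u)
  -- the identity occurs four times, hence the extra factor u³ beside the absolute norm.
  let f : Option (Fin 4 × Bool) → (B ≃ₐ[ℚ] B) := fun o =>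
    o.elim 1 fun p => if p.2 then τ p.1 else τ p.1 ^ 2
  have hf : Function.Bijective f := by
    rw [Nat.bijective_iff_surjective_and_card]
    refine ⟨fun g => ?_, by rw [h.card, Nat.card_eq_fintype_card]; rfl⟩
    by_cases hg : g = 1
    · exact ⟨none, hg.symm⟩
    · obtain ⟨i, hi | hi⟩ := h.cover g hg
      · exact ⟨some (i, true), hi.symm⟩
      · exact ⟨some (i, false), hi.symm⟩
  have hprod : ∏ g : B ≃ₐ[ℚ] B, conjHom g u =
      u * ∏ i, conjHom (τ i) u * conjHom (τ i) (conjHom (τ i) u) := by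
    rw [← Fintype.prod_bijective f hf (fun o => conjHom (f o) u) _ fun _ => rfl,
      Fintype.prod_option, Fintype.prod_prod_type]
    simp only [f, Option.elim, conjHom_one, Fintype.prod_bool, if_true, Bool.false_eq_true, if_false,
      pow_two, conjHom_mul]
  have : u ^ 3 / ∏ i, normHom (τ i) u = (∏ g : B ≃ₐ[ℚ] B, conjHom g u)⁻¹ := by
    rw [hprod]
    simp only [normHom_apply, mul_assoc]
    rw [Finset.prod_mul_distrib, Finset.prod_const, Finset.card_univ, Fintype.card_fin]
    rw [div_eq_iff_eq_mul, mul_inv_rev]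
    generalize (∏ i, conjHom (τ i) u * conjHom (τ i) (conjHom (τ i) u)) = P
    rw [← mul_inv_rev, eq_inv_mul_iff_mul_eq, pow_succ' u 3, mul_right_comm]
  rw [this]
  exact hsign.inv

/-- The sign -1 is excluded because g has odd order: g u = -u would give u = g³ u = -u. -/
theorem conjHom_eq_of_isSign_div {g : B ≃ₐ[ℚ] B} {u : (𝓞 B)ˣ} (hs : IsSign (conjHom g u / u)) :
    conjHom g u = u := by
  rcases hs with h1 | h1
  · exact div_eq_one.1 h1
  · exfalso
    rw [div_eq_iff_eq_mul, neg_one_mul] at h1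
    have h2 := h.conjHom_cube g u
    rw [h1, conjHom_neg, h1, neg_neg, h1] at h2
    have : (-1 : (𝓞 B)ˣ) = 1 := by
      simpa using congrArg (· * u⁻¹) h2
    exact neg_one_ne_one_units this

end IsCubicFrame

/-! ### Units modulo ±1 and Dirichlet's theorem over ℤ[ζ] -/

section ModSign

variable {B : Type*} [Field B] [NumberField B]

variable (B) in
/-- The subgroup `{1, -1}` of the unit group. -/
def signUnits : Subgroup (𝓞 B)ˣ where
  carrier := {u | IsSign u}
  mul_mem' := IsSign.mul
  one_mem' := isSign_one
  inv_mem' := IsSign.inv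

variable (B) in
/-- The units modulo `±1`, written additively. -/
def UnitsModSign : Type _ := Additive ((𝓞 B)ˣ ⧸ signUnits B)

noncomputable instance : AddCommGroup (UnitsModSign B) :=
  inferInstanceAs (AddCommGroup (Additive ((𝓞 B)ˣ ⧸ signUnits B)))

/-- The class of a unit modulo `±1`. -/
def unitClass (u : (𝓞 B)ˣ) : UnitsModSign B := Additive.ofMul (u : (𝓞 B)ˣ ⧸ signUnits B)

theorem unitClass_mul (u v : (𝓞 B)ˣ) : unitClass (u * v) = unitClass u + unitClass v := rfl

theorem unitClass_inv (u : (𝓞 B)ˣ) : unitClass u⁻¹ = -unitClass u := rfl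

theorem unitClass_div (u v : (𝓞 B)ˣ) : unitClass (u / v) = unitClass u - unitClass v := rfl

theorem unitClass_zpow (u : (𝓞 B)ˣ) (n : ℤ) : unitClass (u ^ n) = n • unitClass u := rfl

theorem unitClass_pow (u : (𝓞 B)ˣ) (n : ℕ) : unitClass (u ^ n) = n • unitClass u := rfl

theorem unitClass_eq_zero {u : (𝓞 B)ˣ} : unitClass u = 0 ↔ IsSign u :=
  QuotientGroup.eq_one_iff (N := signUnits B) u

theorem unitClass_eq_iff {u v : (𝓞 B)ˣ} : unitClass u = unitClass v ↔ IsSign (u / v) := by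
  rw [← unitClass_eq_zero, unitClass_div, sub_eq_zero]

theorem unitClass_neg (u : (𝓞 B)ˣ) : unitClass (-u) = unitClass u := by
  rw [unitClass_eq_iff]
  right
  rw [neg_div, div_self']

theorem unitClass_prod {ι : Type*} (s : Finset ι) (f : ι → (𝓞 B)ˣ) :
    unitClass (∏ i ∈ s, f i) = ∑ i ∈ s, unitClass (f i) := by
  classical
  induction s using Finset.induction_on with
  | empty => rfl
  | insert a s ha ih => rw [Finset.prod_insert ha, Finset.sum_insert ha, unitClass_mul, ih]

/-- Galois conjugation on the units modulo `±1`. -/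
noncomputable def actClass (σ : B ≃ₐ[ℚ] B) : UnitsModSign B →+ UnitsModSign B :=
  MonoidHom.toAdditive (QuotientGroup.map (signUnits B) (signUnits B) (conjHom σ) (by
    rintro u (rfl | rfl)
    · exact Or.inl (map_one _)
    · exact Or.inr (by simp)))

@[simp] theorem actClass_unitClass (σ : B ≃ₐ[ℚ] B) (u : (𝓞 B)ˣ) :
    actClass σ (unitClass u) = unitClass (conjHom σ u) := rfl

theorem unitClass_smul_injective (hodd : Odd (Module.finrank ℚ B)) {u : (𝓞 B)ˣ} {n : ℤ}
    (hn : n ≠ 0) (h : n • unitClass u = 0) : unitClass u = 0 := by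
  rw [← unitClass_zpow, unitClass_eq_zero] at h
  rw [unitClass_eq_zero]
  refine isSign_of_pow_eq_one hodd (n := n.natAbs) (by simpa using hn) ?_
  rcases Int.natAbs_eq n with h1 | h1
  · rw [h1, zpow_natCast] at h; exact h
  · rw [h1, zpow_neg, zpow_natCast] at h
    simpa using h.inv

end ModSign

/-- A Galois field of odd degree is totally real, so a cyclic cubic field has three infinite places.
-/
theorem NumberField.Units.rank_of_cubic {K : Type*} [Field K] [NumberField K] [IsGalois ℚ K]
    (h : Module.finrank ℚ K = 3) : NumberField.Units.rank K = 2 := by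
  have := IsUnramifiedAtInfinitePlaces_of_odd_finrank (k := ℚ) (K := K) (by rw [h]; decide)
  have h1 := IsUnramifiedAtInfinitePlaces.card_infinitePlace (k := ℚ) (K := K)
  have h2 : Fintype.card (InfinitePlace ℚ) = 1 :=
    Fintype.card_eq_one_iff_nonempty_unique.2 ⟨inferInstance⟩
  rw [h, h2] at h1
  rw [NumberField.Units.rank, h1]

namespace IsCubicFrame

variable {B : Type*} [Field B] [NumberField B] [IsGalois ℚ B]
variable {κ : Fin 4 → IntermediateField ℚ B} {τ : Fin 4 → (B ≃ₐ[ℚ] B)} (h : IsCubicFrame κ τ)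
include h

theorem isGalois (F : IntermediateField ℚ B) : IsGalois ℚ F := by
  have : IsAbelianGalois ℚ B := { is_comm := ⟨h.comm⟩ }
  exact (IsAbelianGalois.tower_bot ℚ F B).toIsGalois

theorem exists_fundamental_pair (i : Fin 4) :
    ∃ u ∈ unitsOfSubfield (κ i), ∃ v ∈ unitsOfSubfield (κ i),
      (∀ w ∈ unitsOfSubfield (κ i), ∃ a b : ℤ,
        unitClass w = a • unitClass u + b • unitClass v) ∧
      ∀ a b : ℤ, a • unitClass u + b • unitClass v = 0 → a = 0 ∧ b = 0 := by
  have := h.isGalois (κ i)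
  have hr := NumberField.Units.rank_of_cubic (h.finrank i)
  set K := κ i
  let f : (𝓞 K)ˣ →* (𝓞 B)ˣ := Units.map (algebraMap (𝓞 K) (𝓞 B)).toMonoidHom
  have hf : Function.Injective f := Units.map_injective (FaithfulSMul.algebraMap_injective _ _)
  have hmem : ∀ x, f x ∈ unitsOfSubfield K := fun x => ⟨x, rfl⟩
  let e := finCongr hr
  let g : Fin 2 → (𝓞 K)ˣ := fun j => NumberField.Units.fundSystem K (e.symm j)
  have hprod : ∀ c : Fin (NumberField.Units.rank K) → ℤ,
      ∏ j, NumberField.Units.fundSystem K j ^ c j =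
        g 0 ^ c (e.symm 0) * g 1 ^ c (e.symm 1) := by
    intro c
    rw [← Fintype.prod_equiv e.symm (fun j => g j ^ c (e.symm j)) _ fun j => rfl,
      Fin.prod_univ_two]
  have hsign : ∀ x ∈ NumberField.Units.torsion K, unitClass (f x) = 0 := by
    intro x hx
    rw [unitClass_eq_zero]
    rcases NumberField.Units.torsion_eq_one_or_neg_one_of_odd_finrank
      (by rw [h.finrank i]; decide) ⟨x, hx⟩ with h1 | h1
    · left; rw [show x = 1 from h1, map_one]
    · right; rw [show x = -1 from h1]; ext; simp [f]
  refine ⟨f (g 0), hmem _, f (g 1), hmem _, ?_, ?_⟩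
  · rintro _ ⟨w, rfl⟩
    obtain ⟨⟨ζ, c⟩, hw, -⟩ := NumberField.Units.exist_unique_eq_mul_prod K w
    refine ⟨c (e.symm 0), c (e.symm 1), ?_⟩
    rw [hprod] at hw
    change unitClass (f w) = _
    rw [hw, map_mul, map_mul, map_zpow, map_zpow, unitClass_mul, unitClass_mul, unitClass_zpow,
      unitClass_zpow, hsign _ ζ.2, zero_add]
  · intro a b hab
    rw [← unitClass_zpow, ← unitClass_zpow, ← unitClass_mul, unitClass_eq_zero, ← map_zpow,
      ← map_zpow, ← map_mul] at hab
    have htor : ∃ ζ : NumberField.Units.torsion K, (ζ : (𝓞 K)ˣ) = g 0 ^ a * g 1 ^ b := by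
      refine ⟨⟨_, ?_⟩, rfl⟩
      rw [NumberField.Units.torsion, CommGroup.mem_torsion, isOfFinOrder_iff_pow_eq_one]
      refine ⟨2, by norm_num, hf ?_⟩
      rw [map_pow, map_one]
      rcases hab with h1 | h1 <;> rw [h1] <;> simp
    obtain ⟨ζ, hζ⟩ := htor
    obtain ⟨x, -, hx⟩ := NumberField.Units.exist_unique_eq_mul_prod K (g 0 ^ a * g 1 ^ b)
    have e1 := hx (ζ, 0) (by simp [hζ])
    have e2 := hx (1, fun j => ![a, b] (e j)) (by
      change _ = ((1 : NumberField.Units.torsion K) : (𝓞 K)ˣ) * ∏ j, _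
      rw [hprod]; simp)
    have e3 := congrArg Prod.snd (e1.trans e2.symm)
    have h0 := congrFun e3 (e.symm 0)
    have h1 := congrFun e3 (e.symm 1)
    simp at h0 h1
    exact ⟨h0.symm, h1.symm⟩

/-- The relation `1 + σ + σ² = 0` on the units of a cubic field modulo `±1`. -/
theorem unitClass_conj_conj {i : Fin 4} {σ : B ≃ₐ[ℚ] B} (hσ : σ ∉ Subgroup.zpowers (τ i))
    {u : (𝓞 B)ˣ} (hu : u ∈ unitsOfSubfield (κ i)) :
    unitClass (conjHom σ (conjHom σ u)) = -unitClass u - unitClass (conjHom σ u) := by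
  have h1 := unitClass_eq_zero.2 (h.isSign_normHom_of_mem hσ hu)
  rw [normHom_apply, unitClass_mul, unitClass_mul] at h1
  rw [eq_sub_iff_add_eq, ← sub_eq_zero, ← h1]
  abel

theorem conjHom_mem {i : Fin 4} (σ : B ≃ₐ[ℚ] B) {u : (𝓞 B)ˣ} (hu : u ∈ unitsOfSubfield (κ i)) :
    conjHom σ u ∈ unitsOfSubfield (κ i) := by
  rw [h.mem_units_iff] at hu ⊢
  rw [h.conjHom_comm, hu]

/-- Dirichlet's theorem in Galois form: the units of `κ i` modulo `±1` are generated by one unit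
and its conjugate. -/
theorem exists_cyclic_generator {i : Fin 4} {σ : B ≃ₐ[ℚ] B} (hσ : σ ∉ Subgroup.zpowers (τ i)) :
    ∃ ε ∈ unitsOfSubfield (κ i), ∀ w ∈ unitsOfSubfield (κ i), ∃ a b : ℤ,
      unitClass w = a • unitClass ε + b • unitClass (conjHom σ ε) := by
  obtain ⟨u, hu, v, hv, hgen, hind⟩ := h.exists_fundamental_pair i
  obtain ⟨p, r, hpr⟩ := hgen _ (h.conjHom_mem σ hu)
  obtain ⟨q, s, hqs⟩ := hgen _ (h.conjHom_mem σ hv)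
  -- In a fundamental pair σ acts by the integer matrix (p q; r s). The relation 1 + σ + σ² = 0
  -- forces trace -1 and determinant 1.
  have hact : ∀ a b : ℤ, actClass σ (a • unitClass u + b • unitClass v) =
      (p * a + q * b) • unitClass u + (r * a + s * b) • unitClass v := by
    intro a b
    rw [map_add, map_zsmul, map_zsmul, actClass_unitClass, actClass_unitClass, hpr, hqs]
    module
  have e1 : (p * p + q * r + p + 1) • unitClass u + (r * p + s * r + r) • unitClass v = 0 := by
    have h1 := h.unitClass_conj_conj hσ hu
    rw [← actClass_unitClass, hpr, hact] at h1
    have : (p * p + q * r + p + 1) • unitClass u + (r * p + s * r + r) • unitClass v =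
        ((p * p + q * r) • unitClass u + (r * p + s * r) • unitClass v) + unitClass u +
          (p • unitClass u + r • unitClass v) := by module
    rw [this, h1]
    abel
  have e2 : (p * q + q * s + q) • unitClass u + (r * q + s * s + s + 1) • unitClass v = 0 := by
    have h1 := h.unitClass_conj_conj hσ hv
    rw [← actClass_unitClass, hqs, hact] at h1
    have : (p * q + q * s + q) • unitClass u + (r * q + s * s + s + 1) • unitClass v =
        ((p * q + q * s) • unitClass u + (r * q + s * s) • unitClass v) + unitClass v +
          (q • unitClass u + s • unitClass v) := by module
    rw [this, h1]
    abel
  obtain ⟨e11, e12⟩ := hind _ _ e1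
  obtain ⟨e21, e22⟩ := hind _ _ e2
  -- Otherwise p² + p + 1 = 0, which has no integer solution.
  have hr : r ≠ 0 := by
    rintro rfl
    nlinarith [sq_nonneg (2 * p + 1)]
  have htr : p + s = -1 := by
    have : r * (p + s + 1) = 0 := by linear_combination e12
    rcases mul_eq_zero.1 this with h1 | h1
    · exact absurd h1 hr
    · linarith
  have hdet : p * s - q * r = 1 := by linear_combination p * htr - e11
  obtain ⟨x, y, hxy⟩ := exists_generator_of_order_three htr hdet
  have hε : unitClass (u ^ x * v ^ y) = x • unitClass u + y • unitClass v := rfl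
  refine ⟨u ^ x * v ^ y, mul_mem (zpow_mem hu x) (zpow_mem hv y), fun w hw => ?_⟩
  obtain ⟨a, b, hab⟩ := hgen w hw
  obtain ⟨m, n, hm, hn⟩ := hxy a b
  refine ⟨m, n, ?_⟩
  rw [← actClass_unitClass, hε, hact, hab, hm, hn]
  module

theorem exists_isCanonicalBasis : ∃ e, IsCanonicalBasis κ e := by
  have key : ∀ i, ∃ (ε : (𝓞 B)ˣ) (σ : B ≃ₐ[ℚ] B),
      Subgroup.closure {-1, ε, conjUnit σ ε} = unitsOfSubfield (κ i) := by
    intro i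
    obtain ⟨j, hj⟩ := exists_ne i
    obtain ⟨ε, hε, hgen⟩ := h.exists_cyclic_generator (h.notMem_zpowers hj)
    refine ⟨ε, τ j, le_antisymm ?_ fun w hw => ?_⟩
    · rw [Subgroup.closure_le]
      rintro x (rfl | rfl | rfl)
      · exact neg_one_mem_unitsOfSubfield _
      · exact hε
      · exact h.conjHom_mem _ hε
    · obtain ⟨a, b, hab⟩ := hgen w hw
      have h1 : unitClass w = unitClass (ε ^ a * conjHom (τ j) ε ^ b) := hab
      rw [unitClass_eq_iff] at h1
      have h2 : w = w / (ε ^ a * conjHom (τ j) ε ^ b) * (ε ^ a * conjHom (τ j) ε ^ b) := by simp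
      have hc : ∀ x ∈ ({-1, ε, conjUnit (τ j) ε} : Set (𝓞 B)ˣ),
        x ∈ Subgroup.closure {-1, ε, conjUnit (τ j) ε} := fun x hx => Subgroup.subset_closure hx
      rw [h2]
      refine mul_mem ?_ (mul_mem (zpow_mem (hc _ (by simp)) _) (zpow_mem (hc _ ?_) _))
      · rcases h1 with h1 | h1 <;> rw [h1]
        · exact one_mem _
        · exact hc _ (by simp)
      · right; right; rfl
  choose ε σ hεσ using key
  exact ⟨_, ε, σ, hεσ, rfl⟩

end IsCubicFrame

/-! ### The coordinate lattice of the units of B -/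

/-- Units `ε i` of the four cubic fields that, together with their conjugates under `σ i`, form a
canonical basis, and the coordinates `φ` of the norms of units of `B` with respect to it. -/
structure IsCoordinateSystem {B : Type*} [Field B] [NumberField B]
    (κ : Fin 4 → IntermediateField ℚ B) (τ : Fin 4 → (B ≃ₐ[ℚ] B)) (ε : Fin 4 → (𝓞 B)ˣ)
    (σ : Fin 4 → (B ≃ₐ[ℚ] B)) (φ : Additive (𝓞 B)ˣ →+ EisensteinBlocks) : Prop where
  mem : ∀ i, ε i ∈ unitsOfSubfield (κ i)
  notMem : ∀ i, σ i ∉ Subgroup.zpowers (τ i)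
  generate : ∀ i, ∀ w ∈ unitsOfSubfield (κ i), ∃ a b : ℤ,
    unitClass w = a • unitClass (ε i) + b • unitClass (conjHom (σ i) (ε i))
  independent : ∀ i, ∀ a b : ℤ,
    a • unitClass (ε i) + b • unitClass (conjHom (σ i) (ε i)) = 0 → a = 0 ∧ b = 0
  norm_eq : ∀ u i, unitClass (IsCubicFrame.normHom (τ i) u) =
    (φ (Additive.ofMul u) i).1 • unitClass (ε i) +
      (φ (Additive.ofMul u) i).2 • unitClass (conjHom (σ i) (ε i))

namespace IsCubicFrame

variable {B : Type*} [Field B] [NumberField B] [IsGalois ℚ B]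
variable {κ : Fin 4 → IntermediateField ℚ B} {τ : Fin 4 → (B ≃ₐ[ℚ] B)} (h : IsCubicFrame κ τ)
include h

theorem generate_of_closure {i : Fin 4} {ε ε' : (𝓞 B)ˣ}
    (hcl : Subgroup.closure {-1, ε, ε'} = unitsOfSubfield (κ i)) :
    ∀ w ∈ unitsOfSubfield (κ i), ∃ a b : ℤ,
      unitClass w = a • unitClass ε + b • unitClass ε' := by
  intro w hw
  rw [← hcl] at hw
  induction hw using Subgroup.closure_induction with
  | mem x hx =>
    rcases hx with rfl | rfl | rfl
    · exact ⟨0, 0, by rw [unitClass_eq_zero.2 isSign_neg_one]; simp⟩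
    · exact ⟨1, 0, by simp⟩
    · exact ⟨0, 1, by simp⟩
  | one => exact ⟨0, 0, by rw [unitClass_eq_zero.2 isSign_one]; simp⟩
  | mul x y _ _ hx hy =>
    obtain ⟨a, b, hab⟩ := hx
    obtain ⟨c, d, hcd⟩ := hy
    exact ⟨a + c, b + d, by rw [unitClass_mul, hab, hcd]; module⟩
  | inv x _ hx =>
    obtain ⟨a, b, hab⟩ := hx
    exact ⟨-a, -b, by rw [unitClass_inv, hab]; module⟩

theorem exists_unitClass_ne_zero (i : Fin 4) : ∃ w ∈ unitsOfSubfield (κ i), unitClass w ≠ 0 := by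
  obtain ⟨u, hu, v, hv, -, hind⟩ := h.exists_fundamental_pair i
  refine ⟨u, hu, fun h0 => ?_⟩
  have := hind 1 0 (by rw [h0]; simp)
  simp at this

/-- If σ fixed k_i, the units modulo ±1 would be generated by one class, on which an automorphism
acting nontrivially on k_i would be an integer m with m² + m + 1 = 0. -/
theorem notMem_of_closure {i : Fin 4} {ε : (𝓞 B)ˣ} {σ : B ≃ₐ[ℚ] B}
    (hcl : Subgroup.closure {-1, ε, conjHom σ ε} = unitsOfSubfield (κ i)) :
    σ ∉ Subgroup.zpowers (τ i) := by
  intro hσ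
  have hε : ε ∈ unitsOfSubfield (κ i) := by
    rw [← hcl]; exact Subgroup.subset_closure (by simp)
  have hgen := h.generate_of_closure hcl
  simp only [h.conjHom_zpowers hε hσ] at hgen
  have hgen' : ∀ w ∈ unitsOfSubfield (κ i), ∃ a : ℤ, unitClass w = a • unitClass ε := by
    intro w hw
    obtain ⟨a, b, hab⟩ := hgen w hw
    exact ⟨a + b, by rw [hab]; module⟩
  have hε0 : unitClass ε ≠ 0 := by
    intro h0
    obtain ⟨w, hw, hw0⟩ := h.exists_unitClass_ne_zero i
    obtain ⟨a, ha⟩ := hgen' w hw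
    exact hw0 (by rw [ha, h0, smul_zero])
  obtain ⟨j, hj⟩ := exists_ne i
  have hρ := h.notMem_zpowers hj
  obtain ⟨m, hm⟩ := hgen' _ (h.conjHom_mem (τ j) hε)
  have h1 := h.unitClass_conj_conj hρ hε
  rw [← actClass_unitClass, hm, map_zsmul, actClass_unitClass, hm] at h1
  have h2 : (m ^ 2 + m + 1) • unitClass ε = 0 := by
    have : (m ^ 2 + m + 1) • unitClass ε = m • m • unitClass ε + m • unitClass ε + unitClass ε := by
      module
    rw [this, h1]; abel
  exact hε0 (unitClass_smul_injective h.odd_finrank (by nlinarith [sq_nonneg (2 * m + 1)]) h2)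

/-- Multiplying the relation by the conjugate of a + b ζ leaves the norm a² - a b + b² as an
annihilator of the nonzero, torsion-free class of ε. The norm form is definite. -/
theorem independent_of_closure {i : Fin 4} {ε : (𝓞 B)ˣ} {σ : B ≃ₐ[ℚ] B}
    (hcl : Subgroup.closure {-1, ε, conjHom σ ε} = unitsOfSubfield (κ i)) (a b : ℤ)
    (hab : a • unitClass ε + b • unitClass (conjHom σ ε) = 0) : a = 0 ∧ b = 0 := by
  have hε : ε ∈ unitsOfSubfield (κ i) := by
    rw [← hcl]; exact Subgroup.subset_closure (by simp)
  have hε0 : unitClass ε ≠ 0 := by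
    intro h0
    obtain ⟨w, hw, hw0⟩ := h.exists_unitClass_ne_zero i
    obtain ⟨c, d, hcd⟩ := h.generate_of_closure hcl w hw
    exact hw0 (by rw [hcd, ← actClass_unitClass, h0, map_zero, smul_zero, smul_zero, add_zero])
  have h1 := congrArg (actClass σ) hab
  rw [map_add, map_zsmul, map_zsmul, actClass_unitClass, actClass_unitClass,
    h.unitClass_conj_conj (h.notMem_of_closure hcl) hε, map_zero] at h1
  have h2 : (a ^ 2 - a * b + b ^ 2) • unitClass ε = 0 := by
    have : (a ^ 2 - a * b + b ^ 2) • unitClass ε =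
        (a - b) • (a • unitClass ε + b • unitClass (conjHom σ ε)) - b •
          (a • unitClass (conjHom σ ε) + b • (-unitClass ε - unitClass (conjHom σ ε))) := by
      module
    rw [this, hab, h1]
    simp
  have h3 : a ^ 2 - a * b + b ^ 2 = 0 := by
    by_contra hne
    exact hε0 (unitClass_smul_injective h.odd_finrank hne h2)
  have hb : b = 0 := by
    have : b ^ 2 = 0 := by nlinarith [sq_nonneg (2 * a - b), sq_nonneg b]
    exact pow_eq_zero_iff two_ne_zero |>.1 this
  subst hb
  refine ⟨?_, rfl⟩
  simpa using h3

theorem exists_isCoordinateSystem {ε : Fin 4 → (𝓞 B)ˣ} {σ : Fin 4 → (B ≃ₐ[ℚ] B)}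
    (hcl : ∀ i, Subgroup.closure {-1, ε i, conjUnit (σ i) (ε i)} = unitsOfSubfield (κ i)) :
    ∃ φ, IsCoordinateSystem κ τ ε σ φ := by
  have hind := fun i => h.independent_of_closure (hcl i)
  have hgen := fun i => h.generate_of_closure (hcl i)
  have hex : ∀ (u : (𝓞 B)ˣ) (i : Fin 4), ∃ z : ℤ × ℤ, unitClass (normHom (τ i) u) =
      z.1 • unitClass (ε i) + z.2 • unitClass (conjHom (σ i) (ε i)) := by
    intro u i
    obtain ⟨a, b, hab⟩ := hgen i _ (h.normHom_mem i u)
    exact ⟨(a, b), hab⟩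
  choose f hf using hex
  have huniq : ∀ (i : Fin 4) (z w : ℤ × ℤ), z.1 • unitClass (ε i) +
      z.2 • unitClass (conjHom (σ i) (ε i)) = w.1 • unitClass (ε i) +
      w.2 • unitClass (conjHom (σ i) (ε i)) → z = w := by
    intro i z w hzw
    have : (z.1 - w.1) • unitClass (ε i) + (z.2 - w.2) • unitClass (conjHom (σ i) (ε i)) = 0 := by
      rw [← sub_eq_zero] at hzw
      rw [← hzw]
      module
    obtain ⟨h1, h2⟩ := hind i _ _ this
    ext <;> linarith
  refine ⟨AddMonoidHom.mk' (fun u => f u.toMul) fun u v => ?_, ⟨fun i => ?_, fun i =>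
    h.notMem_of_closure (hcl i), hgen, hind, hf⟩⟩
  · ext1 i
    apply huniq
    rw [← hf, toMul_add, map_mul, unitClass_mul, hf, hf, Pi.add_apply, Prod.fst_add, Prod.snd_add]
    module
  · rw [← hcl]; exact Subgroup.subset_closure (by simp)

variable {ε : Fin 4 → (𝓞 B)ˣ} {σ : Fin 4 → (B ≃ₐ[ℚ] B)} {φ : Additive (𝓞 B)ˣ →+ EisensteinBlocks}
  (hφ : IsCoordinateSystem κ τ ε σ φ)
include hφ

theorem coord_eq {u : (𝓞 B)ˣ} {i : Fin 4} {a b : ℤ} (hu : unitClass (normHom (τ i) u) =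
    a • unitClass (ε i) + b • unitClass (conjHom (σ i) (ε i))) :
    φ (Additive.ofMul u) i = (a, b) := by
  have h1 := hφ.norm_eq u i
  rw [hu] at h1
  have : ((φ (Additive.ofMul u) i).1 - a) • unitClass (ε i) +
      ((φ (Additive.ofMul u) i).2 - b) • unitClass (conjHom (σ i) (ε i)) = 0 := by
    rw [← sub_eq_zero] at h1
    rw [← neg_eq_zero, ← h1]
    module
  obtain ⟨h1, h2⟩ := hφ.independent i _ _ this
  ext <;> simp <;> linarith

theorem coord_eq_zero_iff {u : (𝓞 B)ˣ} {i : Fin 4} :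
    φ (Additive.ofMul u) i = 0 ↔ IsSign (normHom (τ i) u) := by
  rw [← unitClass_eq_zero]
  constructor
  · intro h0
    rw [hφ.norm_eq u i, h0]
    simp
  · intro h0
    exact h.coord_eq hφ (by rw [h0]; simp)

/-- If all four norms are signs, so is u³ by the relation u³ = ± ∏ N_i(u), and then u itself. -/
theorem coord_eq_zero {u : (𝓞 B)ˣ} : φ (Additive.ofMul u) = 0 ↔ IsSign u := by
  constructor
  · intro h0
    have h1 : ∀ i, IsSign (normHom (τ i) u) := fun i => (h.coord_eq_zero_iff hφ).1 (by rw [h0]; rfl)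
    have h2 := h.isSign_cube_div u
    have h3 : unitClass (u ^ 3) = 0 := by
      rw [unitClass_eq_iff.2 h2, unitClass_prod]
      exact Finset.sum_eq_zero fun i _ => unitClass_eq_zero.2 (h1 i)
    exact isSign_of_pow_eq_one h.odd_finrank three_ne_zero (unitClass_eq_zero.1 h3)
  · intro hu
    ext1 i
    refine (h.coord_eq_zero_iff hφ).2 ?_
    rcases hu with rfl | rfl
    · rw [map_one]; exact isSign_one
    · rw [normHom_neg_one]; exact isSign_neg_one

theorem coord_eq_iff {u v : (𝓞 B)ˣ} :
    φ (Additive.ofMul u) = φ (Additive.ofMul v) ↔ unitClass u = unitClass v := by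
  rw [unitClass_eq_iff, ← h.coord_eq_zero hφ, ofMul_div, map_sub, sub_eq_zero]

theorem coord_of_mem_self {i : Fin 4} {u : (𝓞 B)ˣ} (hu : u ∈ unitsOfSubfield (κ i)) {a b : ℤ}
    (hab : unitClass u = a • unitClass (ε i) + b • unitClass (conjHom (σ i) (ε i))) :
    φ (Additive.ofMul u) i = (3 * a, 3 * b) := by
  apply h.coord_eq hφ
  rw [h.normHom_of_mem hu, unitClass_pow, hab]
  module

theorem coord_of_mem_other {i j : Fin 4} (hij : j ≠ i) {u : (𝓞 B)ˣ}
    (hu : u ∈ unitsOfSubfield (κ i)) : φ (Additive.ofMul u) j = 0 :=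
  (h.coord_eq_zero_iff hφ).2 (h.isSign_normHom_of_mem (h.notMem_zpowers hij) hu)

theorem coord_mem_triple {i : Fin 4} {u : (𝓞 B)ˣ} (hu : u ∈ unitsOfSubfield (κ i)) :
    φ (Additive.ofMul u) ∈ EisensteinBlocks.triple := by
  intro j
  by_cases hj : j = i
  · subst hj
    obtain ⟨a, b, hab⟩ := hφ.generate j u hu
    rw [h.coord_of_mem_self hφ hu hab]
    simp
  · rw [h.coord_of_mem_other hφ hj hu]
    simp

/-- The unit with prescribed exponents with respect to the canonical basis. -/
theorem coord_prod (x : EisensteinBlocks) :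
    φ (Additive.ofMul (∏ i, (ε i) ^ (x i).1 * (conjHom (σ i) (ε i)) ^ (x i).2)) = (3 : ℤ) • x := by
  have hmem : ∀ i, (ε i) ^ (x i).1 * (conjHom (σ i) (ε i)) ^ (x i).2 ∈ unitsOfSubfield (κ i) :=
    fun i => mul_mem (zpow_mem (hφ.mem i) _) (zpow_mem (h.conjHom_mem _ (hφ.mem i)) _)
  rw [ofMul_prod, map_sum]
  ext1 j
  rw [Finset.sum_apply, Finset.sum_eq_single j]
  · rw [h.coord_of_mem_self hφ (hmem j) (by rw [unitClass_mul]; rfl)]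
    rfl
  · intro i _ hij
    exact h.coord_of_mem_other hφ hij.symm (hmem i)
  · simp

theorem unitsOfSubfield_le (i : Fin 4) : unitsOfSubfield (κ i) ≤ subfieldUnits B :=
  le_iSup₂_of_le (κ i) (h.finrank i) le_rfl

/-- A unit of k_i has norm u³ to k_i and norm ±1 to the other three fields, so V has coordinates in
3Λ. Conversely each vector of 3Λ is attained by a product of canonical basis elements, and -1 lies
in V. -/
theorem mem_subfieldUnits_iff {u : (𝓞 B)ˣ} :
    u ∈ subfieldUnits B ↔ φ (Additive.ofMul u) ∈ EisensteinBlocks.triple := by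
  constructor
  · intro hu
    let S : Subgroup (𝓞 B)ˣ := AddSubgroup.toSubgroup' (EisensteinBlocks.triple.comap φ)
    have : subfieldUnits B ≤ S := by
      refine iSup₂_le fun F hF => ?_
      obtain ⟨i, rfl⟩ := (h.finrank_eq F).1 hF
      exact fun u hu => h.coord_mem_triple hφ hu
    exact this hu
  · intro hu
    obtain ⟨x, hx⟩ := EisensteinBlocks.mem_triple_iff_exists.1 hu
    rw [← h.coord_prod hφ, h.coord_eq_iff hφ, unitClass_eq_iff] at hx
    set v := ∏ i, (ε i) ^ (x i).1 * (conjHom (σ i) (ε i)) ^ (x i).2 with hv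
    have hvV : v ∈ subfieldUnits B := by
      refine prod_mem fun i _ => h.unitsOfSubfield_le hφ i ?_
      exact mul_mem (zpow_mem (hφ.mem i) _) (zpow_mem (h.conjHom_mem _ (hφ.mem i)) _)
    have hneg : -1 ∈ subfieldUnits B := h.unitsOfSubfield_le hφ 0 (neg_one_mem_unitsOfSubfield _)
    rw [← div_mul_cancel u v]
    refine mul_mem ?_ hvV
    rcases hx with h1 | h1 <;> rw [h1]
    · exact one_mem _
    · exact hneg

theorem index_subfieldUnits :
    (subfieldUnits B).index = EisensteinBlocks.triple.relIndex φ.range := by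
  rw [← AddSubgroup.index_comap, ← Subgroup.index_toAddSubgroup]
  congr 1
  ext u
  exact h.mem_subfieldUnits_iff hφ

/-- On k_i the automorphism g restricts to a power of σ_i, which is multiplication by ζ on block i.
Hence 1 - g acts there as 0, 1 - ζ or 1 - ζ². -/
theorem coord_conj (g : B ≃ₐ[ℚ] B) (i : Fin 4) :
    (∀ u, φ (Additive.ofMul (u / conjHom g u)) i = 0) ∧ g ∈ Subgroup.zpowers (τ i) ∨
    (∀ u, φ (Additive.ofMul (u / conjHom g u)) i = ((φ (Additive.ofMul u) i).1 +
      (φ (Additive.ofMul u) i).2, 2 * (φ (Additive.ofMul u) i).2 - (φ (Additive.ofMul u) i).1)) ∨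
    ∀ u, φ (Additive.ofMul (u / conjHom g u)) i = (2 * (φ (Additive.ofMul u) i).1 -
      (φ (Additive.ofMul u) i).2, (φ (Additive.ofMul u) i).1 + (φ (Additive.ofMul u) i).2) := by
  have e1 := h.unitClass_conj_conj (hφ.notMem i) (hφ.mem i)
  have e2 : unitClass (conjHom (σ i) (conjHom (σ i) (conjHom (σ i) (ε i)))) =
    unitClass (ε i) := by rw [h.conjHom_cube]
  have hdiv : ∀ u, unitClass (normHom (τ i) (u / conjHom g u)) =
      unitClass (normHom (τ i) u) - actClass g (unitClass (normHom (τ i) u)) := by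
    intro u
    rw [map_div, unitClass_div, actClass_unitClass, h.conjHom_normHom]
  obtain ⟨z, hz, hg⟩ := h.exists_coset (hφ.notMem i) g
  have hgz : ∀ σ', g = σ' * z → ∀ u, actClass g (unitClass (normHom (τ i) u)) =
      actClass σ' (unitClass (normHom (τ i) u)) := by
    rintro σ' rfl u
    rw [actClass_unitClass, conjHom_mul, h.conjHom_zpowers (h.normHom_mem i u) hz,
      actClass_unitClass]
  rcases hg with hg | hg | hg
  · refine Or.inl ⟨fun u => h.coord_eq hφ ?_, hg ▸ hz⟩
    rw [hdiv, hgz 1 (by rw [one_mul, hg]), actClass_unitClass, conjHom_one]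
    simp
  · refine Or.inr (Or.inl fun u => h.coord_eq hφ ?_)
    rw [hdiv, hgz _ hg, hφ.norm_eq u i, map_add, map_zsmul, map_zsmul, actClass_unitClass,
      actClass_unitClass, e1]
    module
  · refine Or.inr (Or.inr fun u => h.coord_eq hφ ?_)
    rw [hdiv, hgz _ hg, hφ.norm_eq u i, map_add, map_zsmul, map_zsmul, actClass_unitClass,
      actClass_unitClass, pow_two, conjHom_mul, conjHom_mul, e1, e2]
    module

theorem coord_div_self (i : Fin 4) (u : (𝓞 B)ˣ) :
    φ (Additive.ofMul (u / conjHom (τ i) u)) i = 0 := by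
  rw [h.coord_eq_zero_iff hφ, map_div, ← h.conjHom_normHom, h.conjHom_normHom_self, div_self']
  exact isSign_one

theorem isStable : EisensteinBlocks.IsStable φ.range where
  triple_le := by
    intro x hx
    obtain ⟨y, rfl⟩ := EisensteinBlocks.mem_triple_iff_exists.1 hx
    exact ⟨_, h.coord_prod hφ y⟩
  twist := by
    rintro i _ ⟨u, rfl⟩
    refine ⟨φ (Additive.ofMul (u.toMul / conjHom (τ i) u.toMul)), ⟨_, rfl⟩,
      h.coord_div_self hφ i _, fun j hj => ?_⟩
    rcases h.coord_conj hφ (τ i) j with h1 | h1 | h1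
    · exact absurd h1.2 (h.notMem_zpowers hj.symm)
    · exact Or.inl (h1 _)
    · exact Or.inr (h1 _)
  single := by
    rintro i _ ⟨u, rfl⟩ hu
    replace hu : ∀ j, j ≠ i → φ (Additive.ofMul u.toMul) j = 0 := hu
    -- All coordinates of u/τ_i(u) vanish, so u is fixed by τ_i and is a unit of k_i.
    refine h.coord_mem_triple hφ (i := i) (u := u.toMul) (h.mem_units_iff.2 ?_)
    refine h.conjHom_eq_of_isSign_div ?_
    rw [← inv_div]
    refine IsSign.inv ((h.coord_eq_zero hφ).1 ?_)
    ext1 j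
    by_cases hj : j = i
    · subst hj
      exact h.coord_div_self hφ j _
    · rcases h.coord_conj hφ (τ i) j with h1 | h1 | h1
      · exact h1.1 _
      · rw [h1, hu j hj]; rfl
      · rw [h1, hu j hj]; rfl

end IsCubicFrame

/-! ### Unit transition matrices and their diagonal -/

namespace EisensteinBlocks

/-- The list of the eight coordinates. -/
def flat : EisensteinBlocks →+ (Fin 8 → ℤ) where
  toFun x := ![(x 0).1, (x 0).2, (x 1).1, (x 1).2, (x 2).1, (x 2).2, (x 3).1, (x 3).2]
  map_zero' := by ext i; fin_cases i <;> rfl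
  map_add' x y := by ext i; fin_cases i <;> rfl

theorem flat_injective : Function.Injective flat := by
  intro x y hxy
  have h : ∀ i : Fin 8, flat x i = flat y i := fun i => congrFun hxy i
  ext i
  · fin_cases i
    exacts [h 0, h 2, h 4, h 6]
  · fin_cases i
    exacts [h 1, h 3, h 5, h 7]

theorem flat_surjective (y : Fin 8 → ℤ) : ∃ x, flat x = y := by
  refine ⟨![(y 0, y 1), (y 2, y 3), (y 4, y 5), (y 6, y 7)], ?_⟩
  ext i
  fin_cases i <;> rfl

variable {L : AddSubgroup EisensteinBlocks} {A : Matrix (Fin 8) (Fin 8) ℤ}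

theorem three_smul_mem_map_flat (hL : triple ≤ L) (x : Fin 8 → ℤ) : (3 : ℤ) • x ∈ L.map flat := by
  obtain ⟨x, rfl⟩ := flat_surjective x
  exact ⟨(3 : ℤ) • x, hL (mem_triple_iff_exists.2 ⟨x, rfl⟩), map_zsmul flat 3 x⟩

/-- The diagonal entry of the Hermite normal form at each of the last three positions is `3` or
`1`, according to the vectors of the lattice ending at this position. -/
theorem diagonal_eq (hL : triple ≤ L) (hA : ∀ i j, j < i → A i j = 0) (hd : ∀ j, 0 < A j j)
    (h : ∀ x, x ∈ L.map flat ↔ ∃ c, x = A.mulVec c) :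
    ((A 7 7 = 1 ∧ ∃ x ∈ L, ¬ 3 ∣ (x 3).2) ∨ (A 7 7 = 3 ∧ ¬ ∃ x ∈ L, ¬ 3 ∣ (x 3).2)) ∧
    ((A 6 6 = 1 ∧ ∃ x ∈ L, (x 3).2 = 0 ∧ ¬ 3 ∣ (x 3).1) ∨
      (A 6 6 = 3 ∧ ¬ ∃ x ∈ L, (x 3).2 = 0 ∧ ¬ 3 ∣ (x 3).1)) ∧
    ((A 5 5 = 1 ∧ ∃ x ∈ L, x 3 = 0 ∧ ¬ 3 ∣ (x 2).2) ∨
      (A 5 5 = 3 ∧ ¬ ∃ x ∈ L, x 3 = 0 ∧ ¬ 3 ∣ (x 2).2)) := by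
  have key := Matrix.diagonal_dichotomy (three_smul_mem_map_flat hL) hA hd h
  -- Counted from 0, positions 6 and 7 are the two coordinates of the last block and position 5 is
  -- the second coordinate of the third.
  have h7 : (∃ x ∈ L.map flat, (∀ j, 7 < j → x j = 0) ∧ ¬ 3 ∣ x 7) ↔
      ∃ x ∈ L, ¬ 3 ∣ (x 3).2 := by
    constructor
    · rintro ⟨_, ⟨x, hx, rfl⟩, -, h3⟩
      exact ⟨x, hx, h3⟩
    · rintro ⟨x, hx, h3⟩
      exact ⟨_, ⟨x, hx, rfl⟩, fun j hj => absurd hj (by revert j; decide), h3⟩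
  have h6 : (∃ x ∈ L.map flat, (∀ j, 6 < j → x j = 0) ∧ ¬ 3 ∣ x 6) ↔
      ∃ x ∈ L, (x 3).2 = 0 ∧ ¬ 3 ∣ (x 3).1 := by
    constructor
    · rintro ⟨_, ⟨x, hx, rfl⟩, h0, h3⟩
      exact ⟨x, hx, h0 7 (by decide), h3⟩
    · rintro ⟨x, hx, h0, h3⟩
      refine ⟨_, ⟨x, hx, rfl⟩, fun j hj => ?_, h3⟩
      have : j = 7 := by revert j; decide
      rw [this]; exact h0
  have h5 : (∃ x ∈ L.map flat, (∀ j, 5 < j → x j = 0) ∧ ¬ 3 ∣ x 5) ↔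
      ∃ x ∈ L, x 3 = 0 ∧ ¬ 3 ∣ (x 2).2 := by
    constructor
    · rintro ⟨_, ⟨x, hx, rfl⟩, h0, h3⟩
      exact ⟨x, hx, Prod.ext (h0 6 (by decide)) (h0 7 (by decide)), h3⟩
    · rintro ⟨x, hx, h0, h3⟩
      refine ⟨_, ⟨x, hx, rfl⟩, fun j hj => ?_, h3⟩
      have : j = 6 ∨ j = 7 := by revert j; decide
      rcases this with rfl | rfl
      · exact congrArg Prod.fst h0
      · exact congrArg Prod.snd h0
  have k7 := key 7
  have k6 := key 6
  have k5 := key 5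
  rw [h7] at k7
  rw [h6] at k6
  rw [h5] at k5
  exact ⟨k7, k6, k5⟩

/-- The index of the multiples of `3` read off from the Hermite normal form. -/
theorem relIndex_iff_diagonal (hL : IsStable L)
    (hP : ∀ x ∈ L, x 2 = 0 → x 3 = 0 → x ∈ triple) (hne : ¬ L ≤ triple)
    (hA : ∀ i j, j < i → A i j = 0) (hd : ∀ j, 0 < A j j)
    (h : ∀ x, x ∈ L.map flat ↔ ∃ c, x = A.mulVec c) :
    (triple.relIndex L = 27 ↔ A 6 6 = 1 ∧ A 7 7 = 1 ∧ A 5 5 = 1) ∧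
    ((L.map lastBlock).index < 9 →
      (triple.relIndex L = 3 ↔ A 6 6 = 3 ∧ A 7 7 = 1 ∧ A 5 5 = 3) ∧
      (triple.relIndex L = 9 ↔ A 6 6 = 3 ∧ A 7 7 = 1 ∧ A 5 5 = 1)) := by
  obtain ⟨h7, h6, h5⟩ := diagonal_eq hL.triple_le hA hd h
  have h27 := relIndex_eq_iff_isFull hL hP hne
  by_cases hF : IsFull L
  · have e7 := hF.exists_eighth hL
    have e6 := hF.exists_seventh hL
    have e5 := hF.exists_third hL hP
    have g7 : A 7 7 = 1 := h7.elim (fun h => h.1) fun h => absurd e7 h.2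
    have g6 : A 6 6 = 1 := h6.elim (fun h => h.1) fun h => absurd e6 h.2
    have g5 : A 5 5 = 1 := h5.elim (fun h => h.1) fun h => absurd e5 h.2
    rw [h27.2 hF, g7, g6, g5]
    simp
  -- A vector ending at position 6 with entry prime to 3 has nonzero residue in the last block,
  -- which would make L full.
  · have g6 : A 6 6 = 3 :=
      h6.elim (fun h => absurd (isFull_of_exists_seventh h.2) hF) fun h => h.1
    refine ⟨?_, fun hlt => ?_⟩
    · rw [h27, g6]
      simp [hF]
    · have e7 := exists_eighth_of_index_lt hL hlt
      have g7 : A 7 7 = 1 := h7.elim (fun h => h.1) fun h => absurd e7 h.2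
      have h3 := relIndex_eq_three_iff hL hP hF e7
      have h39 := relIndex_of_not_isFull hL hP hF hne
      rcases h5 with ⟨g5, e5⟩ | ⟨g5, e5⟩
      · have : triple.relIndex L ≠ 3 := fun h => h3.1 h e5
        rw [h39.resolve_left this, g6, g7, g5]
        simp
      · rw [h3.2 e5, g6, g7, g5]
        simp

end EisensteinBlocks

namespace IsCubicFrame

open EisensteinBlocks

variable {B : Type*} [Field B] [NumberField B] [IsGalois ℚ B]
variable {κ : Fin 4 → IntermediateField ℚ B} {τ : Fin 4 → (B ≃ₐ[ℚ] B)} (h : IsCubicFrame κ τ)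
variable {ε : Fin 4 → (𝓞 B)ˣ} {σ : Fin 4 → (B ≃ₐ[ℚ] B)} {φ : Additive (𝓞 B)ˣ →+ EisensteinBlocks}
  (hφ : IsCoordinateSystem κ τ ε σ φ)
include h hφ

theorem coord_prod_flat (x : EisensteinBlocks) :
    φ (Additive.ofMul (∏ i, ![ε 0, conjUnit (σ 0) (ε 0), ε 1, conjUnit (σ 1) (ε 1),
      ε 2, conjUnit (σ 2) (ε 2), ε 3, conjUnit (σ 3) (ε 3)] i ^ flat x i)) = (3 : ℤ) • x := by
  rw [← h.coord_prod hφ x]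
  congr 2
  rw [Fin.prod_univ_eight, Fin.prod_univ_four]
  simp only [mul_assoc]
  rfl

theorem unitClass_cube_eq_iff (u : (𝓞 B)ˣ) (y : Fin 8 → ℤ) :
    unitClass (u ^ 3) = unitClass (∏ i, ![ε 0, conjUnit (σ 0) (ε 0), ε 1, conjUnit (σ 1) (ε 1),
      ε 2, conjUnit (σ 2) (ε 2), ε 3, conjUnit (σ 3) (ε 3)] i ^ y i) ↔
      flat (φ (Additive.ofMul u)) = y := by
  obtain ⟨x, rfl⟩ := flat_surjective y
  rw [← h.coord_eq_iff hφ, h.coord_prod_flat hφ, flat_injective.eq_iff, ofMul_pow, map_nsmul,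
    ← natCast_zsmul]
  exact (zsmul_right_injective (G := EisensteinBlocks) (by norm_num : (3 : ℤ) ≠ 0)).eq_iff

/-- Since u³ = ± ∏ N_i(u), the exponents of γ_j³ are the coordinates of γ_j. The columns of A thus
span the coordinate lattice. -/
theorem mem_range_iff_of_isUnitTransition {γ : Fin 8 → (𝓞 B)ˣ} {A : Matrix (Fin 8) (Fin 8) ℤ}
    (hA : IsUnitTransition ![ε 0, conjUnit (σ 0) (ε 0), ε 1, conjUnit (σ 1) (ε 1),
      ε 2, conjUnit (σ 2) (ε 2), ε 3, conjUnit (σ 3) (ε 3)] γ A) (x : Fin 8 → ℤ) :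
    x ∈ φ.range.map flat ↔ ∃ c, x = A.mulVec c := by
  obtain ⟨⟨-, hcl⟩, -, -, hγ⟩ := hA
  have hcol : ∀ j, flat (φ (Additive.ofMul (γ j))) = A.mulVec (Pi.single j 1) := by
    intro j
    rw [Matrix.mulVec_single_one]
    exact (h.unitClass_cube_eq_iff hφ (γ j) fun i => A i j).1 (by rw [hγ j])
  constructor
  · rintro ⟨_, ⟨u, rfl⟩, rfl⟩
    obtain ⟨u, rfl⟩ := Additive.ofMul.surjective u
    have hu : u ∈ Subgroup.closure (insert (-1) (Set.range γ)) := by rw [hcl]; trivial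
    induction hu using Subgroup.closure_induction with
    | mem x hx =>
      rcases hx with rfl | ⟨j, rfl⟩
      · exact ⟨0, by rw [(h.coord_eq_zero hφ).2 isSign_neg_one]; simp⟩
      · exact ⟨_, hcol j⟩
    | one => exact ⟨0, by simp⟩
    | mul x y _ _ hx hy =>
      obtain ⟨a, ha⟩ := hx
      obtain ⟨b, hb⟩ := hy
      exact ⟨a + b, by rw [ofMul_mul, map_add, map_add, ha, hb, Matrix.mulVec_add]⟩
    | inv x _ hx =>
      obtain ⟨a, ha⟩ := hx
      exact ⟨-a, by rw [ofMul_inv, map_neg, map_neg, ha, Matrix.mulVec_neg]⟩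
  · rintro ⟨c, rfl⟩
    have : A.mulVec c = ∑ j, c j • A.mulVec (Pi.single j 1) := by
      ext i
      simp [Matrix.mulVec, dotProduct, mul_comm]
    rw [this]
    have hmem : ∀ j, A.mulVec (Pi.single j 1) ∈ φ.range.map flat :=
      fun j => ⟨_, ⟨_, rfl⟩, hcol j⟩
    exact AddSubgroup.sum_mem _ fun j _ => AddSubgroup.zsmul_mem _ (hmem j) _

theorem exists_isUnitTransition :
    ∃ γ A, IsUnitTransition ![ε 0, conjUnit (σ 0) (ε 0), ε 1, conjUnit (σ 1) (ε 1),
      ε 2, conjUnit (σ 2) (ε 2), ε 3, conjUnit (σ 3) (ε 3)] γ A := by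
  obtain ⟨A, hA, hd, hL⟩ := AddSubgroup.exists_upperTriangular (φ.range.map flat)
    (three_smul_mem_map_flat (h.isStable hφ).triple_le)
  set e : Fin 8 → (𝓞 B)ˣ := ![ε 0, conjUnit (σ 0) (ε 0), ε 1, conjUnit (σ 1) (ε 1),
      ε 2, conjUnit (σ 2) (ε 2), ε 3, conjUnit (σ 3) (ε 3)] with he
  have hcol : ∀ j, ∃ u : (𝓞 B)ˣ, u ^ 3 = ∏ i, e i ^ A i j := by
    intro j
    obtain ⟨_, ⟨u, rfl⟩, hu⟩ := (hL (A.mulVec (Pi.single j 1))).2 ⟨_, rfl⟩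
    rw [Matrix.mulVec_single_one] at hu
    have h1 := (h.unitClass_cube_eq_iff hφ u.toMul fun i => A i j).2 hu
    rw [unitClass_eq_iff] at h1
    rcases h1 with h1 | h1
    · exact ⟨u.toMul, div_eq_one.1 h1⟩
    -- The sign is absorbed into u, as -1 is a cube.
    · refine ⟨-u.toMul, ?_⟩
      rw [div_eq_iff_eq_mul, neg_one_mul] at h1
      rw [Odd.neg_pow (by decide), h1, neg_neg]
  choose γ hγ using hcol
  have hcol' : ∀ j, flat (φ (Additive.ofMul (γ j))) = A.mulVec (Pi.single j 1) := by
    intro j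
    rw [Matrix.mulVec_single_one]
    exact (h.unitClass_cube_eq_iff hφ (γ j) fun i => A i j).1 (by rw [hγ j])
  have hprod : ∀ c : Fin 8 → ℤ,
      flat (φ (Additive.ofMul (∏ j, γ j ^ c j))) = A.mulVec c := by
    intro c
    rw [ofMul_prod, map_sum, map_sum]
    simp only [ofMul_zpow, map_zsmul, hcol']
    ext i
    simp [Matrix.mulVec, dotProduct, mul_comm]
  refine ⟨γ, A, ⟨fun n hn => ?_, ?_⟩, hA, hd, hγ⟩
  · have h0 : A.mulVec n = 0 := by rw [← hprod, hn, ofMul_one, map_zero, map_zero]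
    have hpos : ∀ j, 0 < j → n j = 0 :=
      Matrix.eq_zero_of_upperTriangular_mulVec hA hd fun j _ => congrFun h0 j
    have hz : A 0 0 * n 0 = 0 := by
      rw [← Matrix.upperTriangular_mulVec_apply hA hpos, h0]; rfl
    ext j
    by_cases hj : j = 0
    · rw [hj]; exact (mul_eq_zero.1 hz).resolve_left (hd 0).ne'
    · exact hpos j (Fin.pos_iff_ne_zero.2 hj)
  · rw [eq_top_iff]
    intro u _
    obtain ⟨c, hc⟩ := (hL (flat (φ (Additive.ofMul u)))).1 ⟨_, ⟨_, rfl⟩, rfl⟩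
    rw [← hprod, flat_injective.eq_iff, h.coord_eq_iff hφ, unitClass_eq_iff] at hc
    rw [← div_mul_cancel u (∏ j, γ j ^ c j)]
    refine mul_mem ?_ (prod_mem fun j _ => zpow_mem (Subgroup.subset_closure (by simp)) _)
    rcases hc with h1 | h1 <;> rw [h1]
    · exact one_mem _
    · exact Subgroup.subset_closure (by simp)

end IsCubicFrame

/-! ### Norm index and first cohomology of the units -/

namespace IsCubicFrame

open EisensteinBlocks

variable {B : Type*} [Field B] [NumberField B] [IsGalois ℚ B]
variable {κ : Fin 4 → IntermediateField ℚ B} {τ : Fin 4 → (B ≃ₐ[ℚ] B)} (h : IsCubicFrame κ τ)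

/-- The homomorphism `u ↦ u / g u`. -/
noncomputable def diffHom (g : B ≃ₐ[ℚ] B) : (𝓞 B)ˣ →* (𝓞 B)ˣ := MonoidHom.id _ / conjHom g

omit [IsGalois ℚ B] in
theorem diffHom_apply (g : B ≃ₐ[ℚ] B) (u : (𝓞 B)ˣ) : diffHom g u = u / conjHom g u := rfl

include h

/-- A generator of the Galois group of `B` over one of its cubic subfields. -/
theorem exists_relative_generator (i : Fin 4) : ∃ t : B ≃ₐ[κ i] B, (∀ x, t x = τ i x) ∧
    (∀ s : B ≃ₐ[κ i] B, s ∈ Subgroup.zpowers t) ∧ orderOf t = 3 := by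
  have hmem : τ i ∈ (κ i).fixingSubgroup := by rw [h.fixing]; exact Subgroup.mem_zpowers _
  let e := IntermediateField.fixingSubgroupEquiv (κ i)
  have ho : orderOf (⟨τ i, hmem⟩ : (κ i).fixingSubgroup) = 3 := by
    rw [← Subgroup.orderOf_coe]
    exact orderOf_eq_prime (h.cube _) (h.ne_one i)
  refine ⟨e ⟨τ i, hmem⟩, fun x => rfl, fun s => ?_, by rw [MulEquiv.orderOf_eq, ho]⟩
  obtain ⟨⟨s, hs⟩, rfl⟩ := e.surjective s
  have hs' := hs
  rw [h.fixing] at hs'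
  obtain ⟨m, hm⟩ := hs'
  refine ⟨m, ?_⟩
  change e ⟨τ i, hmem⟩ ^ m = _
  rw [← map_zpow]
  congr 1
  exact Subtype.ext hm

omit [IsGalois ℚ B] h in
theorem _root_.prod_univ_of_orderOf_eq_three {G M : Type*} [Group G] [Fintype G] [CommMonoid M]
    {t : G} (ht : ∀ s, s ∈ Subgroup.zpowers t) (ho : orderOf t = 3) (f : G → M) :
    ∏ s, f s = f 1 * f t * f (t ^ 2) := by
  have hb : Function.Bijective fun i : Fin 3 => t ^ (i : ℕ) := by
    rw [Nat.bijective_iff_surjective_and_card]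
    constructor
    · intro s
      have h3 : t ^ 3 = 1 := by rw [← ho, pow_orderOf_eq_one]
      rcases (mem_zpowers_of_cube h3).1 (ht s) with rfl | rfl | rfl
      · exact ⟨0, by simp⟩
      · exact ⟨1, by simp⟩
      · exact ⟨2, by simp⟩
    · rw [Nat.card_fin, ← ho, orderOf_eq_card_of_forall_mem_zpowers ht]
  rw [← Fintype.prod_bijective _ hb (fun i => f (t ^ (i : ℕ))) f fun _ => rfl, Fin.prod_univ_three]
  simp

theorem algebraMap_norm (i : Fin 4) (x : B) :
    algebraMap (κ i) B (Algebra.norm (κ i) x) = x * τ i x * τ i (τ i x) := by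
  obtain ⟨t, ht, hgen, ho⟩ := h.exists_relative_generator i
  rw [Algebra.norm_eq_prod_automorphisms, prod_univ_of_orderOf_eq_three hgen ho, pow_two,
    AlgEquiv.mul_apply, ht, ht, AlgEquiv.one_apply]

theorem map_norm_units (i : Fin 4) (u : (𝓞 B)ˣ) :
    Units.map (algebraMap (𝓞 (κ i)) (𝓞 B)).toMonoidHom
      (Units.map (RingOfIntegers.norm (κ i)) u) = normHom (τ i) u := by
  apply units_ext
  rw [normHom_apply, NumberField.Units.coe_mul, NumberField.Units.coe_mul, coe_conjHom,
    coe_conjHom, coe_conjHom, ← h.algebraMap_norm i]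
  rfl

variable {ε : Fin 4 → (𝓞 B)ˣ} {σ : Fin 4 → (B ≃ₐ[ℚ] B)} {φ : Additive (𝓞 B)ˣ →+ EisensteinBlocks}
  (hφ : IsCoordinateSystem κ τ ε σ φ)
include hφ

/-- The unit norm index is the index of the projection of the coordinate lattice. -/
theorem index_normUnits :
    (normUnits (κ 3) B).index = (φ.range.map lastBlock).index := by
  let f : (𝓞 (κ 3))ˣ →* (𝓞 B)ˣ := Units.map (algebraMap (𝓞 (κ 3)) (𝓞 B)).toMonoidHom
  have hf : Function.Injective f := Units.map_injective (FaithfulSMul.algebraMap_injective _ _)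
  have hex : ∀ v, ∃ z : ℤ × ℤ, unitClass (f v) =
      z.1 • unitClass (ε 3) + z.2 • unitClass (conjHom (σ 3) (ε 3)) := by
    intro v
    obtain ⟨a, b, hab⟩ := hφ.generate 3 (f v) ⟨v, rfl⟩
    exact ⟨(a, b), hab⟩
  choose θ hθ using hex
  have huniq : ∀ (v) (w : ℤ × ℤ), unitClass (f v) = w.1 • unitClass (ε 3) +
      w.2 • unitClass (conjHom (σ 3) (ε 3)) → θ v = w := by
    intro v w hw
    have : ((θ v).1 - w.1) • unitClass (ε 3) + ((θ v).2 - w.2) •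
        unitClass (conjHom (σ 3) (ε 3)) = 0 := by
      have h1 := hθ v
      rw [hw, ← sub_eq_zero] at h1
      rw [← neg_eq_zero, ← h1]
      module
    obtain ⟨h1, h2⟩ := hφ.independent 3 _ _ this
    ext <;> linarith
  let Θ : Additive (𝓞 (κ 3))ˣ →+ ℤ × ℤ := AddMonoidHom.mk' (fun v => θ v.toMul) fun v w => by
    apply huniq
    rw [toMul_add, map_mul, unitClass_mul, hθ, hθ, Prod.fst_add, Prod.snd_add]
    module
  have hΘ : ∀ v, Θ (Additive.ofMul v) = θ v := fun v => rfl
  have hsurj : Function.Surjective Θ := by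
    intro z
    obtain ⟨v, hv⟩ := mul_mem (zpow_mem (hφ.mem 3) z.1)
      (zpow_mem (h.conjHom_mem (σ 3) (hφ.mem 3)) z.2)
    refine ⟨Additive.ofMul v, huniq v z ?_⟩
    change unitClass (Units.map _ v) = _
    rw [hv]; rfl
  -- The kernel is ±1, and -1 is the norm of -1 because the relative degree is odd; the index
  -- survives passing to coordinates.
  have hker : Θ.ker ≤ (normUnits (κ 3) B).toAddSubgroup := by
    intro v hv
    have h1 : θ v.toMul = 0 := hv
    have h2 := hθ v.toMul
    rw [h1] at h2
    simp only [Prod.fst_zero, Prod.snd_zero, zero_smul, add_zero] at h2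
    rcases unitClass_eq_zero.1 h2 with h3 | h3
    · have : v.toMul = 1 := hf (by rw [h3, map_one])
      change v.toMul ∈ normUnits (κ 3) B
      rw [this]; exact one_mem _
    · refine ⟨-1, hf ?_⟩
      rw [h3]
      exact (h.map_norm_units 3 (-1)).trans (normHom_neg_one _)
  have hmap : (normUnits (κ 3) B).toAddSubgroup.map Θ = φ.range.map lastBlock := by
    have hval : ∀ u : (𝓞 B)ˣ, θ (Units.map (RingOfIntegers.norm (κ 3)) u) =
        φ (Additive.ofMul u) 3 := fun u => huniq _ _ (by
      rw [← hφ.norm_eq u 3, ← h.map_norm_units 3 u])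
    ext z
    constructor
    · rintro ⟨_, ⟨u, rfl⟩, rfl⟩
      exact ⟨_, ⟨Additive.ofMul u, rfl⟩, (hval u).symm⟩
    · rintro ⟨_, ⟨u, rfl⟩, rfl⟩
      exact ⟨Additive.ofMul (Units.map (RingOfIntegers.norm (κ 3)) u.toMul), ⟨u.toMul, rfl⟩,
        hval u.toMul⟩
  rw [← Subgroup.index_toAddSubgroup, ← hmap, AddSubgroup.index_map_eq _ hsurj hker]

theorem exists_isDifference :
    ∃ Δ, IsDifference Δ ∧ ∀ u, φ (Additive.ofMul (diffHom (τ 3) u)) = Δ (φ (Additive.ofMul u)) := by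
  have key : ∀ j : Fin 4, ∃ δ : ℤ × ℤ →+ ℤ × ℤ,
      (∀ u, φ (Additive.ofMul (diffHom (τ 3) u)) j = δ (φ (Additive.ofMul u) j)) ∧
      (j = 3 → ∀ z, δ z = 0) ∧
      (j ≠ 3 → (∀ z, δ z = (z.1 + z.2, 2 * z.2 - z.1)) ∨
        ∀ z, δ z = (2 * z.1 - z.2, z.1 + z.2)) := by
    intro j
    rcases h.coord_conj hφ (τ 3) j with h1 | h1 | h1
    · have hj : j = 3 := by
        by_contra hj
        exact h.notMem_zpowers (Ne.symm hj) h1.2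
      exact ⟨0, fun u => h1.1 u, fun _ _ => rfl, fun h => absurd hj h⟩
    · by_cases hj : j = 3
      · subst hj
        exact ⟨0, fun u => h.coord_div_self hφ 3 u, fun _ _ => rfl, fun h => absurd rfl h⟩
      · exact ⟨AddMonoidHom.mk' (fun z => (z.1 + z.2, 2 * z.2 - z.1)) fun z w => by
          ext <;> simp <;> ring, h1, fun h => absurd h hj, fun _ => Or.inl fun _ => rfl⟩
    · by_cases hj : j = 3
      · subst hj
        exact ⟨0, fun u => h.coord_div_self hφ 3 u, fun _ _ => rfl, fun h => absurd rfl h⟩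
      · exact ⟨AddMonoidHom.mk' (fun z => (2 * z.1 - z.2, z.1 + z.2)) fun z w => by
          ext <;> simp <;> ring, h1, fun h => absurd h hj, fun _ => Or.inr fun _ => rfl⟩
  choose δ h1 h2 h3 using key
  refine ⟨AddMonoidHom.pi fun j => (δ j).comp (Pi.evalAddMonoidHom _ j), ⟨fun x => h2 3 rfl _,
    fun j hj => ?_⟩, fun u => funext fun j => h1 j u⟩
  exact (h3 j hj).imp (fun h x => h _) fun h x => h _

/-- The order of the first cohomology group of the units over a cubic subfield. -/
theorem relIndex_diffHom_range (h0 : (subfieldUnits B).index ≠ 0) :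
    (diffHom (τ 3)).range.relIndex (normHom (τ 3)).ker = 3 * (normUnits (κ 3) B).index := by
  obtain ⟨Δ, hΔ, hφΔ⟩ := h.exists_isDifference hφ
  have hL := h.isStable hφ
  rw [h.index_subfieldUnits hφ] at h0
  have hΔL : φ.range.map Δ ≤ φ.range := by
    rintro _ ⟨_, ⟨u, rfl⟩, rfl⟩
    exact ⟨_, hφΔ u.toMul⟩
  rw [h.index_normUnits hφ, ← hΔ.relIndex_map hL hΔL h0]
  set D := (diffHom (τ 3)).range.toAddSubgroup with hD
  set K := (normHom (τ 3)).ker.toAddSubgroup with hK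
  have hDmap : D.map φ = φ.range.map Δ := by
    ext x
    constructor
    · rintro ⟨_, ⟨u, rfl⟩, rfl⟩
      exact ⟨_, ⟨Additive.ofMul u, rfl⟩, (hφΔ u).symm⟩
    · rintro ⟨_, ⟨u, rfl⟩, rfl⟩
      exact ⟨Additive.ofMul (diffHom (τ 3) u.toMul), ⟨_, rfl⟩, hφΔ u.toMul⟩
  have hKmap : K.map φ = φ.range ⊓ lastBlock.ker := by
    ext x
    constructor
    · rintro ⟨u, hu, rfl⟩
      refine ⟨⟨u, rfl⟩, (h.coord_eq_zero_iff hφ (u := u.toMul)).2 ?_⟩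
      exact Or.inl hu
    · rintro ⟨⟨u, rfl⟩, hu⟩
      rcases (h.coord_eq_zero_iff hφ (u := u.toMul)).1 hu with h1 | h1
      · exact ⟨u, h1, rfl⟩
      · refine ⟨Additive.ofMul (-u.toMul), ?_, ?_⟩
        · change normHom (τ 3) (-u.toMul) = 1
          rw [← neg_one_mul, map_mul, normHom_neg_one, h1]
          simp
        · exact (h.coord_eq_iff hφ).2 (unitClass_neg _)
  have hDK : D ≤ K := by
    rintro _ ⟨u, rfl⟩
    change normHom (τ 3) (diffHom (τ 3) u) = 1
    rw [diffHom_apply, map_div, ← h.conjHom_normHom, h.conjHom_normHom_self, div_self']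
  rw [← Subgroup.relIndex_toAddSubgroup, ← hDmap, ← hKmap, ← AddSubgroup.relIndex_comap,
    AddSubgroup.comap_map_eq, ← AddSubgroup.inf_relIndex_right (D ⊔ φ.ker)]
  congr 1
  refine le_antisymm (le_inf le_sup_left hDK) ?_
  rintro x ⟨hx, hxK⟩
  obtain ⟨d, hd, n, hn, rfl⟩ := AddSubgroup.mem_sup.1 hx
  have hnK : n ∈ K := by
    have := K.sub_mem hxK (hDK hd)
    rwa [add_sub_cancel_left] at this
  -- The kernel of φ is ±1, and -1 does not have relative norm 1, so no sign ambiguity remains among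
  -- units of norm 1.
  have : n = 0 := by
    rcases (h.coord_eq_zero hφ (u := n.toMul)).1 hn with h1 | h1
    · exact h1
    · exfalso
      have h2 : normHom (τ 3) n.toMul = 1 := hnK
      rw [h1, normHom_neg_one] at h2
      exact neg_one_ne_one_units h2
  rw [this, add_zero]
  exact hd

end IsCubicFrame

/-! ### Ramification of rational primes in the cubic subfields -/

/-- At a prime P above an unramified p, the valuation of A at P is its p-adic valuation, and it is
also three times that of a. -/
theorem three_dvd_padicValInt_of_cube {K : Type*} [Field K] [NumberField K] {p : ℕ} (hp : p.Prime)
    (hram : p ∉ ramifiedPrimes K) {a : 𝓞 K} {A : ℤ} (hA : A ≠ 0) {u : 𝓞 K} (hu : IsUnit u)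
    (h : a ^ 3 = A * u) : 3 ∣ padicValInt p A := by
  have : Fact p.Prime := ⟨hp⟩
  have hunr : Algebra.IsUnramifiedIn (𝓞 K) (Ideal.span {(p : ℤ)}) := by
    by_contra hc
    exact hram ⟨hp, hc⟩
  have hpZ : Prime (p : ℤ) := Nat.prime_iff_prime_int.1 hp
  have : (Ideal.span {(p : ℤ)}).IsPrime := (Ideal.span_singleton_prime hpZ.ne_zero).2 hpZ
  obtain ⟨P, hP1, hP2⟩ := Ideal.nonempty_primesOver (S := 𝓞 K) (Ideal.span {(p : ℤ)})
  have hmap : (Ideal.span {(p : ℤ)}).map (algebraMap ℤ (𝓞 K)) = Ideal.span {(p : 𝓞 K)} := by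
    rw [Ideal.map_span]; simp
  have hbot : (Ideal.span {(p : ℤ)}).map (algebraMap ℤ (𝓞 K)) ≠ ⊥ := by
    rw [hmap, ne_eq, Ideal.span_singleton_eq_bot]
    exact_mod_cast hp.ne_zero
  have hP0 : P ≠ ⊥ := Ideal.ne_bot_of_liesOver_of_ne_bot
    (p := Ideal.span {(p : ℤ)}) (by simpa using hp.ne_zero) P
  have hPp : Prime P := Ideal.prime_of_isPrime hP0 hP1
  have h1 : emultiplicity P (Ideal.span {(p : 𝓞 K)}) = 1 := by
    have h2 := Ideal.IsDedekindDomain.ramificationIdx_eq_multiplicity (Ideal.span {(p : ℤ)}) P hbot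
    rw [hunr.ramificationIdx_eq_one hP2, hmap] at h2
    have h3 : FiniteMultiplicity P (Ideal.span {(p : 𝓞 K)}) :=
      FiniteMultiplicity.of_prime_left hPp (by rw [← hmap]; exact hbot)
    rw [h3.emultiplicity_eq_multiplicity, ← h2]
    rfl
  obtain ⟨c, hc⟩ := padicValInt_dvd (p := p) A
  have hc' : ¬ (p : ℤ) ∣ c := by
    rintro ⟨d, rfl⟩
    have : (p : ℤ) ^ (padicValInt p A + 1) ∣ A := ⟨d, by rw [pow_succ, mul_assoc, ← hc]⟩
    rw [padicValInt_dvd_iff] at this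
    omega
  have h2 : emultiplicity P (Ideal.span {(c : 𝓞 K)}) = 0 := by
    rw [emultiplicity_eq_zero, Ideal.dvd_span_singleton]
    intro hcP
    have : c ∈ P.under ℤ := by
      rw [Ideal.mem_comap]; simpa using hcP
    rw [← Ideal.LiesOver.over (p := Ideal.span {(p : ℤ)}), Ideal.mem_span_singleton] at this
    exact hc' this
  have hid : Ideal.span {a} ^ 3 =
      Ideal.span {(p : 𝓞 K)} ^ padicValInt p A * Ideal.span {(c : 𝓞 K)} := by
    rw [Ideal.span_singleton_pow, h, Ideal.span_singleton_pow, Ideal.span_singleton_mul_span_singleton,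
      Ideal.span_singleton_mul_right_unit hu]
    conv_lhs => rw [hc]
    push_cast
    rfl
  have h3 := congrArg (emultiplicity P) hid
  rw [emultiplicity_mul hPp, emultiplicity_pow hPp, emultiplicity_pow hPp, h1, h2, mul_one,
    add_zero] at h3
  have hfin : FiniteMultiplicity P (Ideal.span {a}) := by
    refine FiniteMultiplicity.of_prime_left hPp ?_
    rw [ne_eq, Ideal.zero_eq_bot, Ideal.span_singleton_eq_bot]
    rintro rfl
    rw [zero_pow three_ne_zero, eq_comm, mul_eq_zero] at h
    rcases h with h | h
    · exact hA (by exact_mod_cast h)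
    · exact hu.ne_zero h
  rw [hfin.emultiplicity_eq_multiplicity] at h3
  exact ⟨_, by exact_mod_cast h3.symm⟩

theorem IsUnramifiedExtension.ramificationIdx_eq_one {k L : Type*} [Field k] [NumberField k]
    [Field L] [NumberField L] [Algebra k L] (h : IsUnramifiedExtension k L) (P : Ideal (𝓞 L))
    [P.IsPrime] : P.ramificationIdx (𝓞 k) = 1 :=
  have := h.1 P inferInstance
  Ideal.ramificationIdx_eq_one _ _

section Ramification

variable {B : Type*} [Field B] [NumberField B] [IsGalois ℚ B]

theorem card_inertia_inf_fixingSubgroup (F : IntermediateField ℚ B) (P : Ideal (𝓞 B)) [P.IsPrime] :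
    Nat.card (P.inertia (B ≃ₐ[ℚ] B) ⊓ F.fixingSubgroup : Subgroup (B ≃ₐ[ℚ] B)) =
      P.ramificationIdx (𝓞 F) := by
  have h1 : Nat.card (P.inertia (B ≃ₐ[F] B)) = P.ramificationIdx (𝓞 F) := by
    rw [Ideal.card_inertia_eq_ramificationIdxIn (P.under (𝓞 F)),
      Ideal.ramificationIdxIn_eq_ramificationIdx _ P (B ≃ₐ[F] B)]
  rw [← h1]
  refine Nat.card_congr ⟨fun g => ⟨F.fixingSubgroupEquiv ⟨g.1, g.2.2⟩, g.2.1⟩,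
    fun g => ⟨(F.fixingSubgroupEquiv.symm g.1).1, g.2, (F.fixingSubgroupEquiv.symm g.1).2⟩,
    fun g => ?_, fun g => ?_⟩
  · exact Subtype.ext rfl
  · exact Subtype.ext rfl

theorem card_inertia (P : Ideal (𝓞 B)) [P.IsPrime] :
    Nat.card (P.inertia (B ≃ₐ[ℚ] B)) = P.ramificationIdx ℤ := by
  rw [Ideal.card_inertia_eq_ramificationIdxIn (P.under ℤ),
      Ideal.ramificationIdxIn_eq_ramificationIdx _ P (B ≃ₐ[ℚ] B)]

/-- The primes of a Galois field above p share one ramification index, so index 1 at a single prime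
would make p unramified. -/
theorem ramificationIdx_under_ne_one {F : IntermediateField ℚ B} [IsGalois ℚ F] {p : ℕ}
    (hp : p ∈ ramifiedPrimes F) (P : Ideal (𝓞 B)) [P.IsPrime]
    [P.LiesOver (Ideal.span {(p : ℤ)})] : (P.under (𝓞 F)).ramificationIdx ℤ ≠ 1 := by
  intro h1
  apply hp.2
  rw [Algebra.isUnramifiedIn_iff_forall_ramificationIdx_eq_one]
  intro Q _ hQ
  have : (P.under (𝓞 F)).LiesOver (Ideal.span {(p : ℤ)}) :=
    Ideal.LiesOver.tower_bot P (P.under (𝓞 F)) _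
  rw [← h1]
  exact Ideal.ramificationIdx_eq_of_isGaloisGroup (Ideal.span {(p : ℤ)}) Q _ (F ≃ₐ[ℚ] F)

theorem exists_liesOver_span {p : ℕ} (hp : p.Prime) :
    ∃ P : Ideal (𝓞 B), P.IsPrime ∧ P.LiesOver (Ideal.span {(p : ℤ)}) := by
  have hpZ : Prime (p : ℤ) := Nat.prime_iff_prime_int.1 hp
  have : (Ideal.span {(p : ℤ)}).IsPrime := (Ideal.span_singleton_prime hpZ.ne_zero).2 hpZ
  obtain ⟨P, hP⟩ := Ideal.nonempty_primesOver (S := 𝓞 B) (Ideal.span {(p : ℤ)})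
  exact ⟨P, hP⟩

namespace IsCubicFrame

variable {κ : Fin 4 → IntermediateField ℚ B} {τ : Fin 4 → (B ≃ₐ[ℚ] B)} (h : IsCubicFrame κ τ)
  (hunr : IsUnramifiedExtension (κ 3) B)
include h hunr

theorem ramifiedPrimes_subset (i : Fin 4) : ramifiedPrimes (κ i) ⊆ ramifiedPrimes (κ 3) := by
  intro p hp
  refine ⟨hp.1, fun hun => ?_⟩
  obtain ⟨P, _, _⟩ := exists_liesOver_span (B := B) hp.1
  have := h.isGalois (κ i)
  have : (P.under (𝓞 (κ 3))).LiesOver (Ideal.span {(p : ℤ)}) :=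
    Ideal.LiesOver.tower_bot P (P.under (𝓞 (κ 3))) _
  have h1 : P.ramificationIdx ℤ = 1 := by
    rw [Ideal.ramificationIdx_tower (P.under (𝓞 (κ 3))) P, hunr.ramificationIdx_eq_one,
      hun.ramificationIdx_eq_one this]
  rw [Ideal.ramificationIdx_tower (P.under (𝓞 (κ i))) P] at h1
  exact ramificationIdx_under_ne_one hp P (Nat.eq_one_of_mul_eq_one_right h1)

/-- Inertia at p meets Gal(B/k) trivially, so its order is at most 3. If p ramified in all three
other fields, inertia would be nontrivial and equal to the group of some k_j with j ≠ 3, in which p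
is then unramified. -/
theorem exists_unramified (p : ℕ) : ∃ i, i ≠ 3 ∧ p ∉ ramifiedPrimes (κ i) := by
  by_contra! hcon
  have hp := (hcon 0 (by decide)).1
  obtain ⟨P, _, _⟩ := exists_liesOver_span (B := B) hp
  have := fun i => h.isGalois (κ i)
  set I := P.inertia (B ≃ₐ[ℚ] B) with hI
  have h3 : I ⊓ (κ 3).fixingSubgroup = ⊥ := by
    rw [← Subgroup.card_eq_one, card_inertia_inf_fixingSubgroup, hunr.ramificationIdx_eq_one]
  have hle : Nat.card I ≤ 3 := by
    have h4 : Nat.card I ∣ (κ 3).fixingSubgroup.index := by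
      have : Nat.card I = (κ 3).fixingSubgroup.relIndex I := by
        rw [← Subgroup.inf_relIndex_right, inf_comm, h3, Subgroup.relIndex_bot_left]
      rw [this]
      have : (κ 3).fixingSubgroup.Normal := ⟨fun n hn g => by
        rwa [h.comm g n, mul_inv_cancel_right]⟩
      exact Subgroup.relIndex_dvd_index_of_normal _ _
    have h5 : (κ 3).fixingSubgroup.index = 3 := by
      rw [← IntermediateField.finrank_eq_fixingSubgroup_index]
      exact h.finrank 3
    rw [h5] at h4
    exact Nat.le_of_dvd (by norm_num) h4
  have hne : I ≠ ⊥ := by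
    intro hb
    have h6 := card_inertia P
    rw [← hI, hb, Subgroup.card_bot, Ideal.ramificationIdx_tower (P.under (𝓞 (κ 0))) P] at h6
    exact ramificationIdx_under_ne_one (hcon 0 (by decide)) P
      (Nat.eq_one_of_mul_eq_one_right h6.symm)
  obtain ⟨g, hg, hg1⟩ := (Subgroup.ne_bot_iff_exists_ne_one.1 hne) |> fun ⟨g, hg⟩ =>
    (⟨g.1, g.2, fun h0 => hg (Subtype.ext h0)⟩ : ∃ g, g ∈ I ∧ g ≠ 1)
  obtain ⟨j, hj⟩ : ∃ j, g ∈ (κ j).fixingSubgroup := by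
    obtain ⟨j, hj⟩ := h.cover g hg1
    refine ⟨j, ?_⟩
    rw [h.fixing, mem_zpowers_of_cube (h.cube _)]
    exact Or.inr hj
  have hj3 : j ≠ 3 := by
    rintro rfl
    have : g ∈ I ⊓ (κ 3).fixingSubgroup := ⟨hg, hj⟩
    rw [h3] at this
    exact hg1 this
  have hcard : Nat.card (κ j).fixingSubgroup = 3 := by
    rw [h.fixing, card_zpowers_of_cube (h.cube _) (h.ne_one _)]
  have hdvd : Nat.card (I ⊓ (κ j).fixingSubgroup : Subgroup _) ∣ 3 := by
    rw [← hcard]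
    exact Subgroup.card_dvd_of_le inf_le_right
  -- All of the inertia is spent in B/k_j, leaving ramification index 1 for k_j over ℚ.
  have hc3 : P.ramificationIdx (𝓞 (κ j)) = 3 := by
    rw [← card_inertia_inf_fixingSubgroup]
    rcases (Nat.dvd_prime Nat.prime_three).1 hdvd with h7 | h7
    · rw [Subgroup.card_eq_one] at h7
      have : g ∈ I ⊓ (κ j).fixingSubgroup := ⟨hg, hj⟩
      rw [h7] at this
      exact absurd this hg1
    · exact h7
  have h8 := card_inertia P
  rw [Ideal.ramificationIdx_tower (P.under (𝓞 (κ j))) P, hc3] at h8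
  have h9 := ramificationIdx_under_ne_one (hcon j hj3) P
  have h10 : 0 < Nat.card I := Nat.card_pos
  rw [← hI] at h8
  omega

end IsCubicFrame

end Ramification

/-! ### Cubes, Hilbert's theorem 90 and resolvents -/

theorem eq_one_of_cube_eq_one {B : Type*} [Field B] [NumberField B]
    (hodd : Odd (Module.finrank ℚ B)) {x : B} (hx : x ^ 3 = 1) : x = 1 := by
  have hint : IsIntegral ℤ x := IsIntegral.of_pow (n := 3) (by norm_num) (by rw [hx]; exact isIntegral_one)
  let y : 𝓞 B := ⟨x, hint⟩
  have hy : y ^ 3 = 1 := RingOfIntegers.ext hx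
  obtain ⟨u, hu⟩ : IsUnit y := IsUnit.of_pow_eq_one hy (by norm_num)
  have hu3 : u ^ 3 = 1 := Units.ext (by rw [Units.val_pow_eq_pow_val, hu, hy, Units.val_one])
  have h1 : u = 1 := by
    rcases isSign_of_pow_eq_one hodd (n := 3) (by norm_num) (Or.inl hu3) with h | h
    · exact h
    · rw [h] at hu3
      rw [Odd.neg_one_pow (by decide)] at hu3
      exact absurd hu3 neg_one_ne_one_units
  have h2 : y = 1 := by rw [← hu, h1, Units.val_one]
  exact congrArg (algebraMap (𝓞 B) B) h2

/-- A rational integer that is a cube in a Galois number field of odd degree is the cube of a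
rational integer. -/
theorem exists_int_of_cube_eq {B : Type*} [Field B] [NumberField B] [IsGalois ℚ B]
    (hodd : Odd (Module.finrank ℚ B)) {x : B} {A : ℤ} (hx : x ^ 3 = A) : ∃ q : ℤ, A = q ^ 3 := by
  by_cases h0 : x = 0
  · refine ⟨0, ?_⟩
    rw [h0, zero_pow (by norm_num), eq_comm] at hx
    simpa using hx
  have h1 : x ∈ (⊥ : IntermediateField ℚ B) := by
    rw [IsGalois.mem_bot_iff_fixed]
    intro g
    -- Conjugates of x differ by cube roots of unity, and 1 is the only one in B, so x is rational.
    have h3 : (g x / x) ^ 3 = 1 := by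
      rw [div_pow, ← map_pow, hx, map_intCast, ← hx, div_self (pow_ne_zero 3 h0)]
    exact (div_eq_one_iff_eq h0).1 (eq_one_of_cube_eq_one hodd h3)
  obtain ⟨q, hq⟩ := IntermediateField.mem_bot.1 h1
  have h2 : IsIntegral ℤ q := by
    rw [← isIntegral_algebraMap_iff (A := ℚ) (B := B) (algebraMap ℚ B).injective, hq]
    refine IsIntegral.of_pow (n := 3) (by norm_num) ?_
    rw [hx]
    exact isIntegral_algebraMap (R := ℤ) (A := B) (x := A)
  obtain ⟨n, hn⟩ := IsIntegrallyClosed.isIntegral_iff.1 h2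
  refine ⟨n, ?_⟩
  have : ((n : ℤ) : B) = x := by rw [← hq, ← hn]; simp
  rw [← this] at hx
  exact_mod_cast hx.symm

theorem exists_cube_of_three_dvd_padicValInt {A : ℤ} (hA : A ≠ 0)
    (h : ∀ p : ℕ, p.Prime → 3 ∣ padicValInt p A) : ∃ q : ℤ, A = q ^ 3 := by
  have h1 : ∃ m : ℕ, A.natAbs = m ^ 3 := by
    have h2 : A.natAbs ≠ 0 := Int.natAbs_ne_zero.2 hA
    rw [← Nat.prod_factorization_pow_eq_self h2, Finsupp.prod]
    refine ⟨∏ p ∈ A.natAbs.factorization.support, p ^ (A.natAbs.factorization p / 3), ?_⟩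
    rw [← Finset.prod_pow]
    refine Finset.prod_congr rfl fun p hp => ?_
    have hp' : p.Prime := Nat.prime_of_mem_primeFactors (n := A.natAbs) hp
    rw [← pow_mul]
    congr 1
    have := h p hp'
    rw [padicValInt, ← Nat.factorization_def _ hp'] at this
    omega
  obtain ⟨m, hm⟩ := h1
  rcases Int.natAbs_eq A with h3 | h3
  · exact ⟨m, by rw [h3, hm]; push_cast; rfl⟩
  · exact ⟨-m, by rw [h3, hm]; push_cast; ring⟩

/-- Hilbert's theorem 90 for an automorphism of order three of a number field. -/
theorem exists_mul_apply_eq_of_norm_eq_one {L : Type*} [Field L] [NumberField L] {g : L ≃ₐ[ℚ] L}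
    (h3 : g ^ 3 = 1) (h1 : g ≠ 1) {η : L} (hη : η * g η * g (g η) = 1) :
    ∃ b : 𝓞 L, b ≠ 0 ∧ η * g b = b := by
  have hg3 : ∀ x, g (g (g x)) = x := fun x => by
    have := DFunLike.congr_fun h3 x
    simpa [pow_succ] using this
  -- Linear independence of the characters 1, g, g² gives a nonvanishing resolvent; it satisfies η
  -- g(a) = a.
  obtain ⟨c, hc⟩ : ∃ c, c + η * g c + η * g η * g (g c) ≠ 0 := by
    by_contra! hcon
    have hne : g ^ 2 ≠ g := fun h => h1 (by rw [← mul_left_cancel_iff (a := g), ← pow_two, h, mul_one])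
    have hne' : g ^ 2 ≠ 1 := fun h => h1 (by rw [← h3, pow_succ, h, one_mul])
    let f : Fin 3 → (L →* L) := ![((1 : L ≃ₐ[ℚ] L) : L →* L), (g : L →* L), ((g ^ 2 : L ≃ₐ[ℚ] L) : L →* L)]
    have hcoe : ∀ a b : L ≃ₐ[ℚ] L, (a : L →* L) = (b : L →* L) → a = b := fun a b hab =>
      AlgEquiv.ext fun x => DFunLike.congr_fun hab x
    have hf : Function.Injective f := by
      intro i j hij
      fin_cases i <;> fin_cases j
      · rfl
      · exact absurd (hcoe _ _ hij).symm h1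
      · exact absurd (hcoe _ _ hij).symm hne'
      · exact absurd (hcoe _ _ hij) h1
      · rfl
      · exact absurd (hcoe _ _ hij).symm hne
      · exact absurd (hcoe _ _ hij) hne'
      · exact absurd (hcoe _ _ hij) hne
      · rfl
    have hli := (linearIndependent_monoidHom L L).comp f hf
    rw [Fintype.linearIndependent_iff] at hli
    have := hli ![1, η, η * g η] (by
      ext x
      rw [Fin.sum_univ_three]
      simpa [f, pow_two] using hcon x) 0
    simp at this
  set a := c + η * g c + η * g η * g (g c) with ha
  have hga : η * g a = a := by
    rw [ha]
    simp only [map_add, map_mul, hg3]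
    linear_combination c * hη
  -- Scaling by a rational integer, which g fixes, makes the solution integral.
  obtain ⟨m, hm, hint⟩ := IsAlgebraic.exists_integral_multiple
    ((IsFractionRing.isAlgebraic_iff ℤ ℚ L).2 (Algebra.IsAlgebraic.isAlgebraic (R := ℚ) a))
  refine ⟨⟨_, hint⟩, fun h0 => ?_, ?_⟩
  · have := congrArg (algebraMap (𝓞 L) L) h0
    rw [map_zero] at this
    change m • a = 0 at this
    rw [zsmul_eq_mul, mul_eq_zero] at this
    exact this.elim (fun h => hm (by exact_mod_cast h)) hc
  · change η * g (m • a) = m • a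
    rw [map_zsmul, mul_smul_comm, hga]

namespace IsCubicFrame

variable {B : Type*} [Field B] [NumberField B] [IsGalois ℚ B]
variable {κ : Fin 4 → IntermediateField ℚ B} {τ : Fin 4 → (B ≃ₐ[ℚ] B)} (h : IsCubicFrame κ τ)
include h

theorem exists_restrict {i : Fin 4} {σ : B ≃ₐ[ℚ] B} (hσ : σ ∉ Subgroup.zpowers (τ i)) :
    ∃ s : κ i ≃ₐ[ℚ] κ i, (∀ x : κ i, ((s x : κ i) : B) = σ x) ∧ (∀ g, g ∈ Subgroup.zpowers s) ∧
      orderOf s = 3 := by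
  have := h.isGalois (κ i)
  let s : κ i ≃ₐ[ℚ] κ i := AlgEquiv.restrictNormal σ (κ i)
  have hs : ∀ x : κ i, ((s x : κ i) : B) = σ x := fun x => AlgEquiv.restrictNormal_commutes σ (κ i) x
  have hcard : Nat.card (κ i ≃ₐ[ℚ] κ i) = 3 := by
    rw [IsGalois.card_aut_eq_finrank, h.finrank]
  have hne : s ≠ 1 := by
    intro h1
    apply hσ
    rw [← h.fixing]
    rintro ⟨x, hx⟩
    have := hs ⟨x, hx⟩
    rw [h1] at this
    exact this.symm
  have ho : orderOf s = 3 := by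
    have : orderOf s ∣ 3 := by rw [← hcard]; exact orderOf_dvd_natCard s
    rcases (Nat.dvd_prime Nat.prime_three).1 this with h2 | h2
    · exact absurd (orderOf_eq_one_iff.1 h2) hne
    · exact h2
  refine ⟨s, hs, fun g => ?_, ho⟩
  have : Subgroup.zpowers s = ⊤ := by
    apply Subgroup.eq_top_of_card_eq
    rw [Nat.card_zpowers, ho, hcard]
  rw [this]; trivial

/-- A substitute for Kummer theory when ζ is not in the field: if η = a/σ(a), multiplying a, η σ(a)
and η σ(η) σ²(a) shows that a³ is the norm of a times η² σ(η). Thus ε² σ(ε) is, modulo cubes, a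
rational integer. -/
theorem exists_resolvent {i : Fin 4} {σ : B ≃ₐ[ℚ] B} (hσ : σ ∉ Subgroup.zpowers (τ i))
    {ε : (𝓞 B)ˣ} (hε : ε ∈ unitsOfSubfield (κ i)) :
    ∃ (a : 𝓞 (κ i)) (A : ℤ) (u : (𝓞 (κ i))ˣ), A ≠ 0 ∧ a ^ 3 = A * u ∧
      Units.map (algebraMap (𝓞 (κ i)) (𝓞 B)).toMonoidHom u = ε ^ 2 * conjHom σ ε := by
  have hgal := h.isGalois (κ i)
  obtain ⟨v, hv⟩ := hε
  obtain ⟨s, hs, hgen, ho⟩ := h.exists_restrict hσ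
  have key : ∀ η : (𝓞 (κ i))ˣ, Algebra.norm ℤ (η : 𝓞 (κ i)) = 1 →
      ∃ (a : 𝓞 (κ i)) (A : ℤ), A ≠ 0 ∧ a ^ 3 = A * (η ^ 2 * conjHom s η : (𝓞 (κ i))ˣ) := by
    intro η hη
    have hnorm : ∀ a : 𝓞 (κ i), (Algebra.norm ℤ a : κ i) = (a : κ i) * s a * s (s a) := by
      intro a
      have h1 := Algebra.norm_eq_prod_automorphisms ℚ (a : κ i)
      rw [prod_univ_of_orderOf_eq_three hgen ho, ← Algebra.coe_norm_int] at h1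
      simpa [pow_two] using h1
    obtain ⟨a, ha0, hmul⟩ := exists_mul_apply_eq_of_norm_eq_one (L := κ i)
      (by rw [← ho, pow_orderOf_eq_one]) (fun h1 => by rw [h1, orderOf_one] at ho; omega)
      (by rw [← hnorm, hη, Int.cast_one] : (η : κ i) * s η * s (s η) = 1)
    refine ⟨a, Algebra.norm ℤ a, Algebra.norm_ne_zero_iff.2 ha0, ?_⟩
    have hA := hnorm a
    apply RingOfIntegers.coe_injective
    have h2 := congrArg s hmul
    rw [map_mul] at h2
    have h3 : ((η ^ 2 * conjHom s η : (𝓞 (κ i))ˣ) : κ i) = (η : κ i) ^ 2 * s η := by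
      rw [NumberField.Units.coe_mul, NumberField.Units.coe_pow, coe_conjHom]
    rw [map_pow, map_mul, map_intCast, h3, hA]
    calc (a : κ i) ^ 3 = a * a * a := by ring
      _ = a * (η * s a) * (η * (s η * s (s a))) := by rw [h2, hmul]
      _ = _ := by ring
  have hconj : ∀ η : (𝓞 (κ i))ˣ, Units.map (algebraMap (𝓞 (κ i)) (𝓞 B)).toMonoidHom (conjHom s η) =
      conjHom σ (Units.map (algebraMap (𝓞 (κ i)) (𝓞 B)).toMonoidHom η) := fun η =>
    units_ext (hs _)
  have hnorm : Algebra.norm ℤ (v : 𝓞 (κ i)) = 1 ∨ Algebra.norm ℤ (v : 𝓞 (κ i)) = -1 :=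
    Int.isUnit_iff.1 (v.isUnit.map (Algebra.norm ℤ))
  refine hnorm.elim (fun h1 => ?_) fun h1 => ?_
  · obtain ⟨a, A, hA, haA⟩ := key v h1
    exact ⟨a, A, _, hA, haA, by rw [map_mul, map_pow, hconj, hv]⟩
  -- For norm -1 the argument applies to -v, and the sign is moved into A.
  · have h2 : Algebra.norm ℤ ((-v : (𝓞 (κ i))ˣ) : 𝓞 (κ i)) = 1 := by
      have h3 : Algebra.norm ℤ (algebraMap ℤ (𝓞 (κ i)) (-1)) = -1 := by
        rw [Algebra.norm_algebraMap, RingOfIntegers.rank, h.finrank]; norm_num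
      rw [map_neg, map_one] at h3
      rw [Units.val_neg, ← neg_one_mul, map_mul, h1, h3]; norm_num
    obtain ⟨a, A, hA, haA⟩ := key (-v) h2
    refine ⟨a, -A, v ^ 2 * conjHom s v, neg_ne_zero.2 hA, ?_, by
      rw [map_mul, map_pow, hconj, hv]⟩
    rw [haA, conjHom_neg, neg_sq, mul_neg, Units.val_neg]
    push_cast
    ring

variable {ε : Fin 4 → (𝓞 B)ˣ} {σ : Fin 4 → (B ≃ₐ[ℚ] B)} {φ : Additive (𝓞 B)ˣ →+ EisensteinBlocks}
  (hφ : IsCoordinateSystem κ τ ε σ φ)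
include hφ

/-- The multiplicative relations between the resolvents correspond to units of `B`. -/
theorem mem_range_iff_exists_cube {α : Fin 4 → 𝓞 B} {A : Fin 4 → ℤ} (hA : ∀ i, A i ≠ 0)
    (hα : ∀ i, α i ^ 3 = A i * (ε i ^ 2 * conjHom (σ i) (ε i) : (𝓞 B)ˣ)) (n : Fin 4 → ℕ) :
    (fun i => (2 * (n i : ℤ), (n i : ℤ)) : EisensteinBlocks) ∈ φ.range ↔
      ∃ q : ℤ, ∏ i, A i ^ n i = q ^ 3 := by
  set x : EisensteinBlocks := fun i => (2 * (n i : ℤ), (n i : ℤ)) with hx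
  set W : (𝓞 B)ˣ := ∏ i, (ε i) ^ (x i).1 * (conjHom (σ i) (ε i)) ^ (x i).2 with hW
  have hWφ : φ (Additive.ofMul W) = (3 : ℤ) • x := h.coord_prod hφ x
  -- The cube of the product of resolvents is an integer times the unit W with exponents x. Hence W
  -- is a cube in B exactly if that integer is, and then the integer is already a cube in ℤ.
  have hβ : (∏ i, α i ^ n i) ^ 3 = ((∏ i, A i ^ n i : ℤ) : 𝓞 B) * W := by
    have hW' : (W : 𝓞 B) =
        ∏ i, ((ε i ^ 2 * conjHom (σ i) (ε i) : (𝓞 B)ˣ) : 𝓞 B) ^ n i := by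
      rw [hW, Units.coe_prod]
      refine Finset.prod_congr rfl fun i _ => ?_
      rw [← Units.val_pow_eq_pow_val]
      congr 1
      rw [mul_pow, ← pow_mul, ← zpow_natCast, ← zpow_natCast]
      push_cast
      rfl
    rw [hW', Int.cast_prod, ← Finset.prod_mul_distrib, ← Finset.prod_pow]
    refine Finset.prod_congr rfl fun i _ => ?_
    rw [← pow_mul, mul_comm (n i), pow_mul, hα, mul_pow, Int.cast_pow]
  have hA0 : ∏ i, A i ^ n i ≠ 0 := Finset.prod_ne_zero_iff.2 fun i _ => pow_ne_zero _ (hA i)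
  constructor
  · rintro ⟨u, hu⟩
    have h1 : IsSign (W / u.toMul ^ 3) := by
      rw [← h.coord_eq_zero hφ, ofMul_div, map_sub, hWφ, ofMul_pow, map_nsmul,
        ofMul_toMul, hu]
      exact sub_eq_zero.2 (by module)
    obtain ⟨v, hv⟩ : ∃ v : (𝓞 B)ˣ, W = v ^ 3 := by
      rcases h1 with h1 | h1
      · exact ⟨_, div_eq_one.1 h1⟩
      · refine ⟨-u.toMul, ?_⟩
        rw [div_eq_iff_eq_mul] at h1
        rw [h1, Odd.neg_pow (by decide), neg_one_mul]
    have h2 : ((∏ i, α i ^ n i : 𝓞 B) * ((v⁻¹ : (𝓞 B)ˣ) : 𝓞 B)) ^ 3 =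
        ((∏ i, A i ^ n i : ℤ) : 𝓞 B) := by
      rw [mul_pow, hβ, hv, mul_assoc, ← Units.val_pow_eq_pow_val, ← Units.val_mul, inv_pow,
        mul_inv_cancel, Units.val_one, mul_one]
    have h3 := congrArg (algebraMap (𝓞 B) B) h2
    rw [map_pow, map_intCast] at h3
    exact exists_int_of_cube_eq h.odd_finrank h3
  · rintro ⟨q, hq⟩
    have hq0 : (q : B) ≠ 0 := by
      intro h0
      have h0' : q = 0 := by exact_mod_cast h0
      rw [h0', zero_pow (by norm_num)] at hq
      exact hA0 hq
    have h1 : (((∏ i, α i ^ n i : 𝓞 B) : B) / q) ^ 3 = (W : B) := by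
      have := congrArg (algebraMap (𝓞 B) B) hβ
      rw [map_pow, map_mul, map_intCast, hq] at this
      rw [div_pow, this, Int.cast_pow]
      field_simp
    have hint : IsIntegral ℤ (((∏ i, α i ^ n i : 𝓞 B) : B) / q) := by
      refine IsIntegral.of_pow (n := 3) (by norm_num) ?_
      rw [h1]
      exact RingOfIntegers.isIntegral_coe _
    let d : 𝓞 B := ⟨_, hint⟩
    have h2 : d ^ 3 = W := RingOfIntegers.coe_injective (by rw [map_pow]; exact h1)
    have h3 : IsUnit d := by
      rw [← isUnit_pow_iff (n := 3) (by norm_num), h2]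
      exact W.isUnit
    obtain ⟨δ, hδ⟩ := h3
    have h4 : δ ^ 3 = W := Units.ext (by rw [Units.val_pow_eq_pow_val, hδ, h2])
    refine ⟨Additive.ofMul δ, ?_⟩
    have h5 : (3 : ℤ) • φ (Additive.ofMul δ) = (3 : ℤ) • x := by
      rw [← hWφ, ← h4, ofMul_pow, map_nsmul]
      module
    ext i
    · have := congrArg Prod.fst (congrFun h5 i)
      simpa using this
    · have := congrArg Prod.snd (congrFun h5 i)
      simpa using this

end IsCubicFrame

/-! ### Relations between ramification vectors and the choice of ordering -/

namespace EisensteinBlocks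

variable {L : AddSubgroup EisensteinBlocks}

/-- The coordinates (2, 1) stand for 2 + ζ = 1 - ζ², a generator of the prime above 3 and the
exponent pair of ε² σ(ε). A relation thus becomes a statement about products of resolvents. -/
theorem mem_relations_iff_mem (hL : IsStable L) (c : Fin 4 → ZMod 3) :
    c ∈ relations L ↔
      (fun i => (2 * ((c i).val : ℤ), ((c i).val : ℤ)) : EisensteinBlocks) ∈ L := by
  set x : EisensteinBlocks := fun i => (2 * ((c i).val : ℤ), ((c i).val : ℤ)) with hx
  have hres : x ∈ residue.ker := mem_residue_ker.2 fun i => ⟨(c i).val, by simp only [hx]; ring⟩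
  have hfirst : firstMod x = -c := by
    ext i
    change ((2 * ((c i).val : ℤ) : ℤ) : ZMod 3) = -c i
    push_cast
    rw [ZMod.natCast_zmod_val]
    generalize c i = z
    revert z
    decide
  constructor
  · intro hc
    obtain ⟨y, ⟨hy1, hy2⟩, hy⟩ := (relations L).neg_mem hc
    have h1 : x - y ∈ triple := by
      rw [← firstMod_ker_inf]
      refine ⟨?_, AddSubgroup.sub_mem _ hres hy1⟩
      change firstMod (x - y) = 0
      rw [map_sub, hfirst, hy, sub_self]
    have := L.add_mem (hL.triple_le h1) hy2
    rwa [sub_add_cancel] at this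
  · intro h
    rw [← neg_mem_iff, ← hfirst]
    exact ⟨x, ⟨hres, h⟩, rfl⟩

/-- If some vector supported in two blocks is not a multiple of `3`, there is a relation between
these two blocks. -/
theorem IsStable.exists_relation_pair (hL : IsStable L) {i j : Fin 4} {x : EisensteinBlocks}
    (hij : i ≠ j) (hx : x ∈ L) (h0 : ∀ l, l ≠ i → l ≠ j → x l = 0) (hxt : x ∉ triple) :
    ∃ c ∈ relations L, c i ≠ 0 ∧ c j ≠ 0 ∧ ∀ l, l ≠ i → l ≠ j → c l = 0 := by
  have hz : ∀ l, l ≠ i → l ≠ j → residue x l = 0 := fun l h1 h2 => by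
    rw [residue_apply_eq_zero, h0 l h1 h2]; simp
  -- Twisting away block j leaves a relation in block i alone, which must be zero; so x vanishes
  -- modulo 1 - ζ and is itself a relation.
  have hone : ∀ i j : Fin 4, i ≠ j → (∀ l, l ≠ i → l ≠ j → residue x l = 0) →
      residue x i = 0 := by
    intro i j hij hz
    obtain ⟨v, hv, hvj, hvl⟩ := hL.exists_twist j ⟨x, hx, rfl⟩
    have : v = 0 := by
      refine hL.relations_single i hv fun l hl => ?_
      by_cases hlj : l = j
      · rw [hlj, hvj]
      · rw [hvl l hlj]; exact hz l hl hlj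
    rw [← hvl i hij, this]; rfl
  have hi := hone i j hij hz
  have hj := hone j i hij.symm fun l h1 h2 => hz l h2 h1
  have hres : x ∈ residue.ker := by
    rw [AddMonoidHom.mem_ker]
    ext l
    by_cases h1 : l = i
    · rw [h1, hi]; rfl
    · by_cases h2 : l = j
      · rw [h2, hj]; rfl
      · exact hz l h1 h2
  have hc : firstMod x ∈ relations L := ⟨x, ⟨hres, hx⟩, rfl⟩
  have hcl : ∀ l, l ≠ i → l ≠ j → firstMod x l = 0 := fun l h1 h2 => by
    rw [firstMod_apply_eq_zero, h0 l h1 h2]; simp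
  have hc0 : firstMod x ≠ 0 := fun h => hxt (by
    rw [← firstMod_ker_inf]
    exact ⟨h, hres⟩)
  refine ⟨_, hc, fun h => hc0 ?_, fun h => hc0 ?_, hcl⟩
  · refine hL.relations_single j hc fun l hl => ?_
    by_cases hli : l = i
    · rw [hli, h]
    · exact hcl l hli hl
  · refine hL.relations_single i hc fun l hl => ?_
    by_cases hlj : l = j
    · rw [hlj, h]
    · exact hcl l hl hlj

end EisensteinBlocks

namespace IsCubicFrame

open EisensteinBlocks

variable {B : Type*} [Field B] [NumberField B] [IsGalois ℚ B]
variable {κ : Fin 4 → IntermediateField ℚ B} {τ : Fin 4 → (B ≃ₐ[ℚ] B)} (h : IsCubicFrame κ τ)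
variable {ε : Fin 4 → (𝓞 B)ˣ} {σ : Fin 4 → (B ≃ₐ[ℚ] B)} {φ : Additive (𝓞 B)ˣ →+ EisensteinBlocks}
  (hφ : IsCoordinateSystem κ τ ε σ φ)
include h hφ

/-- The relations in the coordinate lattice are the linear relations between ramification vectors
of the four cubic fields. -/
theorem exists_ramification_vectors :
    ∃ v : Fin 4 → ℕ → ZMod 3, (∀ i p, p ∉ ramifiedPrimes (κ i) → v i p = 0) ∧
      ∀ c : Fin 4 → ZMod 3, c ∈ relations φ.range ↔ ∀ p, ∑ i, c i * v i p = 0 := by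
  -- The vector of k_i consists of the p-adic valuations modulo 3 of its resolvent integer. A
  -- relation holds exactly if the corresponding product of these integers is a cube.
  choose a A u hA ha hu using fun i => h.exists_resolvent (hφ.notMem i) (hφ.mem i)
  refine ⟨fun i p => if p.Prime then (padicValInt p (A i) : ZMod 3) else 0, fun i p hp => ?_,
    fun c => ?_⟩
  · by_cases hprime : p.Prime
    · simp only [hprime, if_true]
      rw [ZMod.natCast_eq_zero_iff]
      exact three_dvd_padicValInt_of_cube hprime hp (hA i) (u i).isUnit (ha i)
    · simp [hprime]
  rw [mem_relations_iff_mem (h.isStable hφ)]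
  have hα : ∀ i, (algebraMap (𝓞 (κ i)) (𝓞 B) (a i)) ^ 3 =
      A i * (ε i ^ 2 * conjHom (σ i) (ε i) : (𝓞 B)ˣ) := by
    intro i
    rw [← map_pow, ha, map_mul, map_intCast, ← hu]
    rfl
  rw [h.mem_range_iff_exists_cube hφ hA hα]
  have hA0 : ∏ i, A i ^ (c i).val ≠ 0 := Finset.prod_ne_zero_iff.2 fun i _ => pow_ne_zero _ (hA i)
  have hval : ∀ p : ℕ, p.Prime → ((padicValInt p (∏ i, A i ^ (c i).val) : ℕ) : ZMod 3) =
      ∑ i, c i * (padicValInt p (A i) : ZMod 3) := by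
    intro p hp
    have : Fact p.Prime := ⟨hp⟩
    have hmul : ∀ (s : Finset (Fin 4)), padicValInt p (∏ i ∈ s, A i ^ (c i).val) =
        ∑ i ∈ s, (c i).val * padicValInt p (A i) := by
      intro s
      induction s using Finset.induction_on with
      | empty => simp
      | insert i s hi ih =>
        rw [Finset.prod_insert hi, Finset.sum_insert hi, padicValInt.mul (pow_ne_zero _ (hA i))
          (Finset.prod_ne_zero_iff.2 fun j _ => pow_ne_zero _ (hA j)), ih]
        congr 1
        rw [padicValInt, Int.natAbs_pow, padicValNat.pow]
        rfl
    rw [hmul, Nat.cast_sum]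
    refine Finset.sum_congr rfl fun i _ => ?_
    rw [Nat.cast_mul, ZMod.natCast_zmod_val]
  constructor
  · rintro ⟨q, hq⟩ p
    by_cases hp : p.Prime
    · have : Fact p.Prime := ⟨hp⟩
      simp only [hp, if_true]
      rw [← hval p hp, hq, ZMod.natCast_eq_zero_iff, padicValInt, Int.natAbs_pow,
        padicValNat.pow]
      exact dvd_mul_right _ _
    · simp [hp]
  · intro hc
    refine exists_cube_of_three_dvd_padicValInt hA0 fun p hp => ?_
    rw [← ZMod.natCast_eq_zero_iff, hval p hp, ← hc p]
    simp [hp]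

/-- Every prime ramified in some k_i is ramified in k, so the four ramification vectors lie in a
space of dimension 3 and satisfy a nontrivial relation. -/
theorem not_range_le_triple (hunr : IsUnramifiedExtension (κ 3) B)
    (ht : (ramifiedPrimes (κ 3)).ncard = 3) : ¬ φ.range ≤ triple := by
  obtain ⟨v, hv, hrel⟩ := h.exists_ramification_vectors hφ
  have hfin : (ramifiedPrimes (κ 3)).Finite := Set.finite_of_ncard_ne_zero (by omega)
  have := hfin.fintype
  let f : (Fin 4 → ZMod 3) →ₗ[ZMod 3] (ramifiedPrimes (κ 3) → ZMod 3) :=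
    LinearMap.pi fun p => ∑ i, v i p • LinearMap.proj i
  have hf : ∀ c p, f c p = ∑ i, c i * v i p := by
    intro c p
    simp [f, mul_comm]
  have hker : LinearMap.ker f ≠ ⊥ := by
    apply LinearMap.ker_ne_bot_of_finrank_lt
    rw [Module.finrank_pi, Module.finrank_pi, Fintype.card_fin, ← Nat.card_eq_fintype_card,
      Nat.card_coe_set_eq, ht]
    norm_num
  obtain ⟨c, hc, hc0⟩ := (Submodule.ne_bot_iff _).1 hker
  have hcr : c ∈ relations φ.range := by
    rw [hrel]
    intro p
    by_cases hp : p ∈ ramifiedPrimes (κ 3)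
    · rw [← hf c ⟨p, hp⟩, LinearMap.mem_ker.1 hc]; rfl
    · refine Finset.sum_eq_zero fun i _ => ?_
      rw [hv i p fun h1 => hp (h.ramifiedPrimes_subset hunr i h1), mul_zero]
  obtain ⟨x, hx, -, hx1⟩ := (h.isStable hφ).exists_of_mem_relations hcr
  intro hle
  apply hc0
  ext i
  by_contra hi
  exact hx1 i hi (hle hx i).2

/-- Not all pairs of cubic fields among the first three satisfy a relation. -/
theorem exists_independent_pair (hunr : IsUnramifiedExtension (κ 3) B) :
    ∃ j : Fin 4, (j = 1 ∨ j = 2) ∧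
      ∀ x ∈ φ.range, (∀ l, l ≠ 0 → l ≠ j → x l = 0) → x ∈ triple := by
  by_contra! hcon
  obtain ⟨v, hv, hrel⟩ := h.exists_ramification_vectors hφ
  have hL := h.isStable hφ
  -- A relation between blocks 0 and j with both coefficients nonzero makes the two vectors
  -- proportional. If this held for j = 1 and j = 2, a prime in the support of v 0 would ramify in
  -- all three fields.
  have key : ∀ j : Fin 4, (j = 1 ∨ j = 2) → ∀ p, v 0 p ≠ 0 → v j p ≠ 0 := by
    intro j hj p hp hjp
    have hj0 : (0 : Fin 4) ≠ j := by rcases hj with rfl | rfl <;> decide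
    obtain ⟨x, hx, hx0, hxt⟩ := hcon j hj
    obtain ⟨c, hc, hc0, hcj, hcl⟩ := hL.exists_relation_pair hj0 hx hx0 hxt
    have h1 := (hrel c).1 hc p
    rw [Finset.sum_eq_single 0] at h1
    · exact (mul_ne_zero hc0 hp) h1
    · intro l _ hl
      by_cases hlj : l = j
      · rw [hlj, hjp, mul_zero]
      · rw [hcl l hl hlj, zero_mul]
    · simp
  obtain ⟨p, hp⟩ : ∃ p, v 0 p ≠ 0 := by
    by_contra! hv0
    have h1 : (Pi.single 0 1 : Fin 4 → ZMod 3) ∈ relations φ.range := by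
      rw [hrel]
      intro p
      refine Finset.sum_eq_zero fun i _ => ?_
      by_cases hi : i = 0
      · rw [hi, hv0, mul_zero]
      · rw [Pi.single_eq_of_ne hi, zero_mul]
    have h2 := hL.relations_single 0 h1 fun j hj => Pi.single_eq_of_ne hj _
    have h3 := congrFun h2 0
    rw [Pi.single_eq_same] at h3
    exact absurd h3 (by decide)
  obtain ⟨i, hi, hip⟩ := h.exists_unramified hunr p
  have h0 := hv i p hip
  have hcases : i = 0 ∨ i = 1 ∨ i = 2 := by
    omega
  rcases hcases with rfl | hi'
  · exact hp h0
  · exact key i hi' p hp h0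

end IsCubicFrame

/-- The cubic fields can be ordered in such a way that units whose norms to the last two fields
are trivial are products of units of subfields. -/
theorem exists_isCubicFrame_independent {B : Type*} [Field B] [NumberField B] [IsGalois ℚ B]
    (hB : Nonempty ((B ≃ₐ[ℚ] B) ≃* Multiplicative (ZMod 3) × Multiplicative (ZMod 3)))
    (k : IntermediateField ℚ B) (hk : Module.finrank ℚ k = 3) (hunr : IsUnramifiedExtension k B) :
    ∃ κ τ, IsCubicFrame κ τ ∧ κ 3 = k ∧ ∀ u : (𝓞 B)ˣ, IsSign (IsCubicFrame.normHom (τ 2) u) →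
      IsSign (IsCubicFrame.normHom (τ 3) u) → u ∈ subfieldUnits B := by
  obtain ⟨κ, τ, h, rfl⟩ := exists_isCubicFrame hB k hk
  obtain ⟨e, ε, σ, hcl, -⟩ := h.exists_isCanonicalBasis
  obtain ⟨φ, hφ⟩ := h.exists_isCoordinateSystem hcl
  obtain ⟨j, hj, hP⟩ := h.exists_independent_pair hφ hunr
  have key : ∀ i : Fin 4, (∀ l, l ≠ 0 → l ≠ j → l = i ∨ l = 3) → ∀ u : (𝓞 B)ˣ,
      IsSign (IsCubicFrame.normHom (τ i) u) → IsSign (IsCubicFrame.normHom (τ 3) u) →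
      u ∈ subfieldUnits B := by
    intro i hi u h1 h2
    rw [h.mem_subfieldUnits_iff hφ]
    refine hP _ ⟨_, rfl⟩ fun l hl0 hlj => ?_
    rcases hi l hl0 hlj with rfl | rfl
    · exact (h.coord_eq_zero_iff hφ).2 h1
    · exact (h.coord_eq_zero_iff hφ).2 h2
  -- If the independent pair is {0, 2}, positions 1 and 2 are exchanged; k stays last.
  rcases hj with rfl | rfl
  · exact ⟨κ, τ, h, rfl, key 2 (by decide)⟩
  · exact ⟨_, _, h.perm (Equiv.swap 1 2), rfl, key 1 (by decide)⟩

/-! ### Galois-invariant ideals in unramified extensions -/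

section InvariantIdeals

open scoped Pointwise
open UniqueFactorizationMonoid

variable {k L : Type*} [Field k] [NumberField k] [Field L] [NumberField L] [Algebra k L]

theorem Ideal.smul_map_algebraMap (g : L ≃ₐ[k] L) (I : Ideal (𝓞 k)) :
    g • I.map (algebraMap (𝓞 k) (𝓞 L)) = I.map (algebraMap (𝓞 k) (𝓞 L)) := by
  rw [Ideal.pointwise_smul_def, Ideal.map_map]
  congr 1
  ext x
  exact g.commutes (x : k)

theorem Ideal.smul_span_singleton (g : L ≃ₐ[k] L) (x : 𝓞 L) :
    g • Ideal.span {x} = Ideal.span {g • x} := by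
  rw [Ideal.pointwise_smul_def, Ideal.map_span, Set.image_singleton]
  rfl

variable [IsGalois k L]

/-- In an unramified extension, a Galois invariant ideal contained in a prime ideal is divisible by
the prime ideal below. -/
theorem IsUnramifiedExtension.le_map_under (h : IsUnramifiedExtension k L) {J P : Ideal (𝓞 L)}
    [hP : P.IsPrime] (hJ : J ≠ ⊥) (hinv : ∀ g : L ≃ₐ[k] L, g • J = J) (hJP : J ≤ P) :
    J ≤ (P.under (𝓞 k)).map (algebraMap (𝓞 k) (𝓞 L)) := by
  classical
  have hP0 : P ≠ ⊥ := fun h0 => hJ (by rwa [h0, le_bot_iff] at hJP)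
  have hp0 : P.under (𝓞 k) ≠ ⊥ := fun h0 => hP0 (Ideal.eq_bot_of_comap_eq_bot h0)
  have hm0 : (P.under (𝓞 k)).map (algebraMap (𝓞 k) (𝓞 L)) ≠ ⊥ := Ideal.map_ne_bot_of_ne_bot hp0
  rw [← Ideal.dvd_iff_le, dvd_iff_normalizedFactors_le_normalizedFactors hm0 hJ,
    Multiset.le_iff_count]
  intro Q
  -- The prime factors of the extended ideal are the conjugates of P, each occurring once since the
  -- extension is unramified; invariance of J makes each of them divide J.
  by_cases hQ : Q ∈ normalizedFactors ((P.under (𝓞 k)).map (algebraMap (𝓞 k) (𝓞 L)))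
  · have hQprime : Q.IsPrime := Ideal.isPrime_of_prime (prime_of_normalized_factor Q hQ)
    have hQle := Ideal.dvd_iff_le.1 (dvd_of_mem_normalizedFactors hQ)
    have hpmax : (P.under (𝓞 k)).IsMaximal :=
      (inferInstance : (P.under (𝓞 k)).IsPrime).isMaximal hp0
    have hQover : Q.LiesOver (P.under (𝓞 k)) := ⟨hpmax.eq_of_le
      (Ideal.IsPrime.ne_top inferInstance) (Ideal.map_le_iff_le_comap.1 hQle)⟩
    rw [← Ideal.IsDedekindDomain.ramificationIdx_eq_normalizedFactors_count _ _ hm0,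
      h.ramificationIdx_eq_one, Multiset.one_le_count_iff_mem]
    obtain ⟨g, rfl⟩ := Ideal.exists_smul_eq_of_isGaloisGroup (P.under (𝓞 k)) P Q (L ≃ₐ[k] L)
    rw [Ideal.mem_normalizedFactors_iff hJ]
    refine ⟨hQprime, ?_⟩
    rw [← hinv g]
    exact Ideal.pointwise_smul_le_pointwise_smul_iff.2 hJP
  · rw [Multiset.count_eq_zero_of_notMem hQ]
    exact Nat.zero_le _

theorem IsUnramifiedExtension.exists_map_eq (h : IsUnramifiedExtension k L) (J : Ideal (𝓞 L))
    (hJ : J ≠ ⊥) (hinv : ∀ g : L ≃ₐ[k] L, g • J = J) :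
    ∃ I : Ideal (𝓞 k), I.map (algebraMap (𝓞 k) (𝓞 L)) = J := by
  induction J using WellFoundedGT.induction with
  | ind J ih =>
    by_cases htop : J = ⊤
    · exact ⟨⊤, by rw [htop, Ideal.map_top]⟩
    obtain ⟨P, hP, hJP⟩ := Ideal.exists_le_maximal J htop
    have := hP.isPrime
    obtain ⟨J', rfl⟩ := Ideal.dvd_iff_le.2 (h.le_map_under hJ hinv hJP)
    set M := (P.under (𝓞 k)).map (algebraMap (𝓞 k) (𝓞 L))
    have hM : M ≠ ⊥ := left_ne_zero_of_mul hJ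
    have hJ' : J' ≠ ⊥ := right_ne_zero_of_mul hJ
    obtain ⟨I, rfl⟩ := ih J' (lt_of_le_of_ne Ideal.mul_le_right fun heq => by
      have h1 : M = 1 := mul_right_cancel₀ hJ' (heq.trans (one_mul _).symm)
      exact hP.ne_top (top_le_iff.1 (by
        rw [← Ideal.one_eq_top, ← h1]; exact Ideal.map_comap_le))) hJ' fun g => by
      have h1 := hinv g
      rw [smul_mul', Ideal.smul_map_algebraMap] at h1
      exact mul_left_cancel₀ hM h1
    exact ⟨_, Ideal.map_mul _ _ _⟩

end InvariantIdeals

/-! ### The transfer kernel as first cohomology of the units -/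

namespace IsCubicFrame

open scoped nonZeroDivisors Pointwise

variable {B : Type*} [Field B] [NumberField B] [IsGalois ℚ B]
variable {κ : Fin 4 → IntermediateField ℚ B} {τ : Fin 4 → (B ≃ₐ[ℚ] B)}

/-- The unit `u` arises from a generator of the extension of an ideal of class `c`. -/
def IsTransferPair (κ : Fin 4 → IntermediateField ℚ B) (τ : Fin 4 → (B ≃ₐ[ℚ] B)) (i : Fin 4)
    (u : (𝓞 B)ˣ) (c : ClassGroup (𝓞 (κ i))) : Prop :=
  ∃ (I : (Ideal (𝓞 (κ i)))⁰) (b : 𝓞 B), b ≠ 0 ∧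
    (I : Ideal (𝓞 (κ i))).map (algebraMap (𝓞 (κ i)) (𝓞 B)) = Ideal.span {b} ∧
    (u : B) * τ i b = b ∧ ClassGroup.mk0 I = c

theorem IsTransferPair.mul {i : Fin 4} {u u' : (𝓞 B)ˣ} {c c' : ClassGroup (𝓞 (κ i))}
    (h : IsTransferPair κ τ i u c) (h' : IsTransferPair κ τ i u' c') :
    IsTransferPair κ τ i (u * u') (c * c') := by
  obtain ⟨I, b, hb, hI, hu, rfl⟩ := h
  obtain ⟨I', b', hb', hI', hu', rfl⟩ := h'
  refine ⟨I * I', b * b', mul_ne_zero hb hb', ?_, ?_, map_mul _ _ _⟩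
  · rw [Submonoid.coe_mul, Ideal.map_mul, hI, hI', Ideal.span_singleton_mul_span_singleton]
  · have hmul : ((b * b' : 𝓞 B) : B) = b * b' := rfl
    rw [NumberField.Units.coe_mul, hmul, map_mul, mul_mul_mul_comm, hu, hu']

variable (h : IsCubicFrame κ τ)
include h

theorem apply_algebraMap (i : Fin 4) (x : κ i) : τ i (x : B) = x := h.mem_iff.1 x.2

/-- Two generators with the same u have a quotient fixed by τ_i, so it lies in k_i and relates the
two ideals by a principal factor; extension of ideals is injective. -/
theorem IsTransferPair.unique {i : Fin 4} {u : (𝓞 B)ˣ} {c c' : ClassGroup (𝓞 (κ i))}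
    (hc : IsTransferPair κ τ i u c) (hc' : IsTransferPair κ τ i u c') : c = c' := by
  obtain ⟨I, b, hb, hI, hu, rfl⟩ := hc
  obtain ⟨I', b', hb', hI', hu', rfl⟩ := hc'
  have hbB : (b : B) ≠ 0 := by simpa using hb
  have hbB' : (b' : B) ≠ 0 := by simpa using hb'
  have hmem : (b : B) / b' ∈ κ i := by
    rw [h.mem_iff, map_div₀]
    nth_rewrite 2 [← hu]
    nth_rewrite 2 [← hu']
    rw [mul_div_mul_left _ _ (NumberField.Units.coe_ne_zero u)]
  obtain ⟨x, y, hy, hxy⟩ := IsFractionRing.div_surjective (A := 𝓞 (κ i)) (⟨_, hmem⟩ : κ i)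
  have hy0 : y ≠ 0 := nonZeroDivisors.ne_zero hy
  have hyB : algebraMap (𝓞 (κ i)) (𝓞 B) y ≠ 0 := by simpa using hy0
  have heq : algebraMap (𝓞 (κ i)) (𝓞 B) y * b = algebraMap (𝓞 (κ i)) (𝓞 B) x * b' := by
    apply RingOfIntegers.coe_injective
    rw [map_mul, map_mul]
    have h1 : ((x : κ i) : B) / ((y : κ i) : B) = (b : B) / b' := congrArg Subtype.val hxy
    have h2 : ((y : κ i) : B) ≠ 0 := by simpa using hy0
    rw [div_eq_div_iff h2 hbB'] at h1
    change ((y : κ i) : B) * b = ((x : κ i) : B) * b'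
    rw [h1, mul_comm]
  have hx0 : x ≠ 0 := by
    rintro rfl
    rw [map_zero, zero_mul] at heq
    exact mul_ne_zero hyB hb heq
  rw [ClassGroup.mk0_eq_mk0_iff]
  refine ⟨y, x, hy0, hx0, Ideal.map_injective_of_faithfullyFlat (B := 𝓞 B) ?_⟩
  rw [Ideal.map_mul, Ideal.map_mul, hI, hI', Ideal.map_span, Ideal.map_span, Set.image_singleton,
    Set.image_singleton, Ideal.span_singleton_mul_span_singleton,
    Ideal.span_singleton_mul_span_singleton, heq]

theorem IsTransferPair.one_iff {i : Fin 4} {u : (𝓞 B)ˣ} :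
    IsTransferPair κ τ i u 1 ↔ u ∈ (diffHom (τ i)).range := by
  constructor
  · rintro ⟨⟨I, hI0⟩, b, hb, hI, hu, hc⟩
    rw [ClassGroup.mk0_eq_one_iff] at hc
    obtain ⟨a, ha⟩ := hc
    change I = Ideal.span {a} at ha
    change I.map _ = _ at hI
    rw [ha, Ideal.map_span, Set.image_singleton, Ideal.span_singleton_eq_span_singleton] at hI
    obtain ⟨v, hv⟩ := hI
    have hbv : (b : B) = ((a : κ i) : B) * (v : B) := by
      rw [← hv]
      rfl
    have hbB : (b : B) ≠ 0 := by simpa using hb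
    have haB : ((a : κ i) : B) ≠ 0 := fun h0 => hbB (by rw [hbv, h0, zero_mul])
    refine ⟨v, ?_⟩
    rw [diffHom_apply, div_eq_iff_eq_mul]
    apply units_ext
    rw [NumberField.Units.coe_mul, coe_conjHom]
    rw [hbv, map_mul, h.apply_algebraMap] at hu
    exact (mul_left_cancel₀ haB (by linear_combination hu)).symm
  · rintro ⟨v, rfl⟩
    refine ⟨1, v, v.ne_zero, ?_, ?_, map_one _⟩
    · rw [Submonoid.coe_one, Ideal.one_eq_top, Ideal.map_top, eq_comm,
        Ideal.span_singleton_eq_top]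
      exact v.isUnit
    · rw [← coe_conjHom, ← NumberField.Units.coe_mul, diffHom_apply, div_mul_cancel]

/-- Hilbert 90 writes u = b/τ_i(b). The ideal (b) is invariant, hence extended from k_i because
B/k_i is unramified. -/
theorem exists_isTransferPair {i : Fin 4} (hunr : IsUnramifiedExtension (κ i) B) {u : (𝓞 B)ˣ}
    (hu : normHom (τ i) u = 1) : ∃ c, IsTransferPair κ τ i u c := by
  have hu' : (u : B) * τ i u * τ i (τ i u) = 1 := by
    have := congrArg (fun v : (𝓞 B)ˣ => (v : B)) hu
    simpa [normHom_apply, NumberField.Units.coe_mul] using this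
  obtain ⟨b, hb, hub⟩ := exists_mul_apply_eq_of_norm_eq_one (h.cube _) (h.ne_one i) hu'
  obtain ⟨t, ht, hgen, -⟩ := h.exists_relative_generator i
  have htb : (u : 𝓞 B) * t • b = b := RingOfIntegers.coe_injective (by
    rw [map_mul]
    exact (congrArg _ (ht b)).trans hub)
  have hb0 : Ideal.span {b} ≠ ⊥ := by simpa using hb
  obtain ⟨I, hI⟩ := hunr.exists_map_eq (Ideal.span {b}) hb0 (by
    have h1 : t ∈ MulAction.stabilizer (B ≃ₐ[κ i] B) (Ideal.span {b}) := by
      rw [MulAction.mem_stabilizer_iff, Ideal.smul_span_singleton]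
      conv_rhs => rw [← htb]
      rw [Ideal.span_singleton_mul_left_unit u.isUnit]
    exact fun g => (Subgroup.zpowers_le.2 h1) (hgen g))
  have hI0 : I ≠ 0 := by
    rintro rfl
    exact hb0 (by rw [← hI, Ideal.zero_eq_bot, Ideal.map_bot])
  exact ⟨_, ⟨I, mem_nonZeroDivisors_of_ne_zero hI0⟩, b, hb, hI, hub, rfl⟩

theorem mem_ker_extendedHom_iff {i : Fin 4} {c : ClassGroup (𝓞 (κ i))} :
    c ∈ (ClassGroup.extendedHom (𝓞 (κ i)) (𝓞 B)).ker ↔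
      ∃ u, normHom (τ i) u = 1 ∧ IsTransferPair κ τ i u c := by
  constructor
  · intro hc
    obtain ⟨I, rfl⟩ := ClassGroup.mk0_surjective c
    rw [MonoidHom.mem_ker, ClassGroup.extendedHom_mk0, ClassGroup.mk0_eq_one_iff] at hc
    obtain ⟨b, hb⟩ := hc
    change (I : Ideal (𝓞 (κ i))).map _ = Ideal.span {b} at hb
    have hb0 : b ≠ 0 := by
      rintro rfl
      rw [Ideal.span_singleton_eq_bot.2 rfl,
        Ideal.map_eq_bot_iff_of_injective (FaithfulSMul.algebraMap_injective _ _)] at hb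
      exact nonZeroDivisors.ne_zero I.2 hb
    obtain ⟨t, ht, -, -⟩ := h.exists_relative_generator i
    have h1 : Ideal.span {t • b} = Ideal.span {b} := by
      rw [← hb, ← Ideal.smul_map_algebraMap t, hb, Ideal.smul_span_singleton]
    obtain ⟨u, hu⟩ := Ideal.span_singleton_eq_span_singleton.1 h1
    have hub : (u : B) * τ i b = b := by
      have h2 := congrArg (algebraMap (𝓞 B) B) hu
      rw [map_mul, mul_comm] at h2
      rw [← ht]
      exact h2
    refine ⟨u, units_ext ?_, I, b, hb0, hb, hub, rfl⟩
    have h3 := congrArg (τ i) hub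
    have h4 := congrArg (τ i) h3
    rw [map_mul] at h3 h4
    rw [map_mul] at h4
    have hcube : τ i (τ i (τ i b)) = b := by
      have := DFunLike.congr_fun (h.cube (τ i)) (b : B)
      simpa [pow_succ] using this
    rw [hcube] at h4
    have hbB : (b : B) ≠ 0 := by simpa using hb0
    rw [normHom_apply, NumberField.Units.coe_mul, NumberField.Units.coe_mul, coe_conjHom,
      coe_conjHom, coe_conjHom, NumberField.Units.coe_one]
    apply mul_right_cancel₀ hbB
    calc (u : B) * τ i u * τ i (τ i u) * b = u * (τ i u * (τ i (τ i u) * b)) := by ring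
      _ = 1 * b := by rw [h4, h3, hub, one_mul]
  · rintro ⟨u, -, I, b, -, hb, -, rfl⟩
    rw [MonoidHom.mem_ker, ClassGroup.extendedHom_mk0, ClassGroup.mk0_eq_one_iff]
    exact ⟨b, hb⟩

/-- The capitulation kernel of an unramified cubic extension is isomorphic to the first cohomology
group of the units. -/
theorem exists_transfer_hom (i : Fin 4) (hunr : IsUnramifiedExtension (κ i) B) :
    ∃ ψ : (normHom (τ i)).ker →* ClassGroup (𝓞 (κ i)),
      ψ.ker = (diffHom (τ i)).range.subgroupOf (normHom (τ i)).ker ∧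
      ψ.range = (ClassGroup.extendedHom (𝓞 (κ i)) (𝓞 B)).ker := by
  choose f hf using fun u : (normHom (τ i)).ker => h.exists_isTransferPair hunr u.2
  let ψ : (normHom (τ i)).ker →* ClassGroup (𝓞 (κ i)) := MonoidHom.mk' f fun u v =>
    IsTransferPair.unique h (hf (u * v)) ((hf u).mul (hf v))
  refine ⟨ψ, ?_, ?_⟩
  · ext u
    rw [MonoidHom.mem_ker, Subgroup.mem_subgroupOf, ← IsTransferPair.one_iff h]
    constructor
    · intro hu
      rw [← hu]
      exact hf u
    · exact fun hu => IsTransferPair.unique h (hf u) hu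
  · ext c
    rw [h.mem_ker_extendedHom_iff]
    constructor
    · rintro ⟨u, rfl⟩
      exact ⟨u, u.2, hf u⟩
    · rintro ⟨u, hu, huc⟩
      exact ⟨⟨u, hu⟩, IsTransferPair.unique h (hf ⟨u, hu⟩) huc⟩

theorem card_transferKernel (i : Fin 4) (hunr : IsUnramifiedExtension (κ i) B) :
    Nat.card (transferKernel (κ i) B) =
      (diffHom (τ i)).range.relIndex (normHom (τ i)).ker := by
  obtain ⟨ψ, hker, hrange⟩ := h.exists_transfer_hom i hunr
  have hle : (ClassGroup.extendedHom (𝓞 (κ i)) (𝓞 B)).ker ≤ threeClassGroup (κ i) := by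
    rw [← hrange]
    rintro _ ⟨u, rfl⟩
    have h3 : u ^ 3 ∈ ψ.ker := by
      rw [hker]
      -- For u of norm 1 and w = u² τ(u) one has w/τ(w) = u³. Capitulating classes are therefore
      -- killed by 3 and lie in the 3-class group.
      refine ⟨u * u * conjHom (τ i) u, ?_⟩
      have hu : (u : (𝓞 B)ˣ) * conjHom (τ i) u * conjHom (τ i) (conjHom (τ i) u) = 1 := by
        rw [← normHom_apply]; exact u.2
      rw [diffHom_apply, div_eq_iff_eq_mul, map_mul, map_mul]
      change _ = (u : (𝓞 B)ˣ) ^ 3 * _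
      calc (u : (𝓞 B)ˣ) * u * conjHom (τ i) u
          = u * u * conjHom (τ i) u * (u * conjHom (τ i) u * conjHom (τ i) (conjHom (τ i) u)) := by
            rw [hu, mul_one]
        _ = _ := by
            rw [pow_succ, pow_two]
            simp only [mul_assoc, mul_left_comm, mul_comm]
    rw [CommGroup.mem_primaryComponent]
    exact ⟨1, by rw [pow_one, ← map_pow]; exact h3⟩
  have heq : transferKernel (κ i) B =
      (ClassGroup.extendedHom (𝓞 (κ i)) (𝓞 B)).ker.subgroupOf (threeClassGroup (κ i)) := rfl
  rw [heq, Nat.card_congr (Subgroup.subgroupOfEquivOfLe hle).toEquiv, ← hrange,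
    ← Subgroup.index_ker, hker]
  rfl

end IsCubicFrame

/-! ### Assembly of the theorem -/

theorem card_eq_nine {G : Type*} [Group G]
    (hG : Nonempty (G ≃* Multiplicative (ZMod 3) × Multiplicative (ZMod 3))) : Nat.card G = 9 := by
  obtain ⟨e⟩ := hG
  rw [Nat.card_congr e.toEquiv, Nat.card_prod]
  simp

theorem mainTheorem12 {B : Type*} [Field B] [NumberField B] [IsGalois ℚ B]
    (hB : Nonempty ((B ≃ₐ[ℚ] B) ≃* Multiplicative (ZMod 3) × Multiplicative (ZMod 3)))
    (k : IntermediateField ℚ B) (hk : Module.finrank ℚ k = 3)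
    (ht : (ramifiedPrimes k).ncard = 3)
    (hunr : IsUnramifiedExtension k B) :
    -- the possible values of the subfield unit index
    ((subfieldUnits B).index = 3 ∨ (subfieldUnits B).index = 9 ∨ (subfieldUnits B).index = 27) ∧
    -- the diagonal entries `a₆₆`, `a₇₇`, `a₈₈` (rows and columns are counted from `0` here)
    (∃ κ : Fin 4 → IntermediateField ℚ B, IsOrdering k κ ∧
      (∃ e : Fin 8 → (𝓞 B)ˣ, IsCanonicalBasis κ e) ∧
      ∀ e : Fin 8 → (𝓞 B)ˣ, IsCanonicalBasis κ e →
        (∃ γ A, IsUnitTransition e γ A) ∧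
        ∀ γ A, IsUnitTransition e γ A →
          ((subfieldUnits B).index = 27 ↔ A 6 6 = 1 ∧ A 7 7 = 1 ∧ A 5 5 = 1) ∧
          (Nonempty (threeClassGroup k ≃* Multiplicative (ZMod 3) × Multiplicative (ZMod 3)) →
            ((subfieldUnits B).index = 3 ↔ A 6 6 = 3 ∧ A 7 7 = 1 ∧ A 5 5 = 3) ∧
            ((subfieldUnits B).index = 9 ↔ A 6 6 = 3 ∧ A 7 7 = 1 ∧ A 5 5 = 1))) ∧
    -- the unit norm index and the transfer kernel
    ((subfieldUnits B).index = 27 ↔ (normUnits k B).index = 1) ∧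
    ((subfieldUnits B).index = 27 → Nat.card (transferKernel k B) = 3) ∧
    (Nonempty (threeClassGroup k ≃* Multiplicative (ZMod 3) × Multiplicative (ZMod 3)) →
      (subfieldUnits B).index = 3 ∨ (subfieldUnits B).index = 9 →
        (normUnits k B).index = 3 ∧
        Nat.card (transferKernel k B) = 9 ∧ transferKernel k B = ⊤) := by

  obtain ⟨κ, τ, h, rfl, hP⟩ := exists_isCubicFrame_independent hB k hk hunr
  have hcoord : ∀ {ε σ φ}, IsCoordinateSystem κ τ ε σ φ →
      (∀ x ∈ φ.range, x 2 = 0 → x 3 = 0 → x ∈ EisensteinBlocks.triple) ∧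
        ¬ φ.range ≤ EisensteinBlocks.triple := by
    refine fun {ε σ φ} hφ => ⟨?_, h.not_range_le_triple hφ hunr ht⟩
    rintro _ ⟨u, rfl⟩ h2 h3
    exact (h.mem_subfieldUnits_iff hφ (u := u.toMul)).1
      (hP _ ((h.coord_eq_zero_iff hφ).1 h2) ((h.coord_eq_zero_iff hφ).1 h3))
  obtain ⟨e, he⟩ := h.exists_isCanonicalBasis
  obtain ⟨ε, σ, hcl, -⟩ := id he
  obtain ⟨φ, hφ⟩ := h.exists_isCoordinateSystem hcl
  have hL := h.isStable hφ
  have htri : (subfieldUnits B).index = 3 ∨ (subfieldUnits B).index = 9 ∨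
      (subfieldUnits B).index = 27 := by
    rw [h.index_subfieldUnits hφ]
    exact EisensteinBlocks.relIndex_trichotomy hL (hcoord hφ).1 (hcoord hφ).2
  have hnorm : (subfieldUnits B).index = 27 ↔ (normUnits (κ 3) B).index = 1 := by
    rw [h.index_subfieldUnits hφ, h.index_normUnits hφ,
      EisensteinBlocks.index_map_lastBlock_eq_one_iff hL,
      EisensteinBlocks.relIndex_eq_iff_isFull hL (hcoord hφ).1 (hcoord hφ).2]
  -- Capitulation is H¹ of the units. The subfield unit index is finite, as `htri` shows it to be 3,
  -- 9 or 27.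
  have hcard : Nat.card (transferKernel (κ 3) B) = 3 * (normUnits (κ 3) B).index := by
    rw [h.card_transferKernel 3 hunr, h.relIndex_diffHom_range hφ (by omega)]
  -- The kernel, of order three times the norm index, is a subgroup of a group of order 9.
  have hdvd : Nonempty (threeClassGroup (κ 3) ≃*
      Multiplicative (ZMod 3) × Multiplicative (ZMod 3)) → (normUnits (κ 3) B).index ∣ 3 := by
    intro h9
    have h1 := Subgroup.card_subgroup_dvd_card (transferKernel (κ 3) B)
    rw [hcard, card_eq_nine h9] at h1
    exact Nat.dvd_of_mul_dvd_mul_left (by norm_num) (h1 : 3 * _ ∣ 3 * 3)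
  refine ⟨htri, ⟨κ, h.isOrdering, ⟨e, he⟩, ?_⟩, hnorm, fun h27 => ?_, fun h9 hI => ?_⟩
  · rintro _ ⟨ε, σ, hcl, rfl⟩
    obtain ⟨φ, hφ⟩ := h.exists_isCoordinateSystem hcl
    refine ⟨h.exists_isUnitTransition hφ, fun γ A hA => ?_⟩
    obtain ⟨h27, h39⟩ := EisensteinBlocks.relIndex_iff_diagonal (h.isStable hφ) (hcoord hφ).1
      (hcoord hφ).2 hA.2.1 hA.2.2.1 (h.mem_range_iff_of_isUnitTransition hφ hA)
    rw [h.index_subfieldUnits hφ]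
    refine ⟨h27, fun h9 => h39 ?_⟩
    rw [← h.index_normUnits hφ]
    -- This bound on the norm index is the only use of the class group hypothesis on the diagonal:
    -- it excludes the projection 3ℤ[ζ] and so gives a_88 = 1.
    exact (Nat.le_of_dvd (by norm_num) (hdvd h9)).trans_lt (by norm_num)
  · rw [hcard, hnorm.1 h27]
  · have hidx : (normUnits (κ 3) B).index = 3 := by
      rcases (Nat.dvd_prime Nat.prime_three).1 (hdvd h9) with h1 | h1
      · have := hnorm.2 h1
        omega
      · exact h1
    have hT : Nat.card (transferKernel (κ 3) B) = 9 := by rw [hcard, hidx]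
    refine ⟨hidx, hT, ?_⟩
    have : Finite (threeClassGroup (κ 3)) := Nat.finite_of_card_ne_zero (by
      rw [card_eq_nine h9]; norm_num)
    exact Subgroup.eq_top_of_card_eq _ (by rw [hT, card_eq_nine h9])
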